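/- Let $N\ge 1$, let $\Omega\subset\mathbb R^N$ be a nonempty bounded open set, let $s\in(0,1)$, and let $p:\mathbb R^N\times\mathbb R^N\to\mathbb R$ be continuous with $p(x,y)=p(y,x)$ and $$1<\inf_{\mathbb R^N\times\mathbb R^N}p\le\sup_{\mathbb R^N\times\mathbb R^N}p<\frac Ns .$$ Write $\bar p(x)=p(x,x)$ and $\nabla_su(x,y)=\frac{u(x)-u(y)}{|x-y|^s}$, and set $$\rho(u)=\int_{\mathbb R^N}\int_{\mathbb R^N}\frac{|u(x)-u(y)|^{p(x,y)}}{|x-y|^{N+sp(x,y)}}\frac{dx\,dy}{p(x,y)},\qquad K(u)=\inf\{\lambda>0:\rho(u/\lambda)<1\},$$ $$k(u)=\inf\Big\{\lambda>0:\int_\Omega\Big|\frac{u(x)}{\lambda}\Big|^{\bar p(x)}\frac{dx}{\bar p(x)}\le 1\Big\}.$$ Let $X$ be the space of (classes of a.e. equal) measurable functions $u$ on $\mathbb R^N$ with $\int_{\mathbb R^N}|u|^{\bar p(x)}dx<\infty$, $\rho(u)<\infty$ and $u=0$ a.e. outside $\Omega$, normed by $K$, and let $\mathcal M=\{u\in X:k(u)=1\}$.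 A real number $\Lambda$ is called an eigenvalue with eigenfunction $u\in X$ if $u\neq0$ and, for all $\varphi\in X$, $$\int_{\mathbb R^N}\int_{\mathbb R^N}\Big|\frac{\nabla_su}{K(u)}\Big|^{p(x,y)-2}\frac{\nabla_su}{K(u)}\,\nabla_s\varphi\,\frac{dx\,dy}{|x-y|^N}=\Lambda\,S(u)\int_\Omega\Big|\frac{u}{k(u)}\Big|^{\bar p(x)-2}\frac{u}{k(u)}\,\varphi\,dx,$$ where $$S(u)=\frac{\int_{\mathbb R^N}\int_{\mathbb R^N}\big|\frac{\nabla_su}{K(u)}\big|^{p(x,y)}\frac{dx\,dy}{|x-y|^N}}{\int_\Omega\big|\frac{u}{k(u)}\big|^{\bar p(x)}dx}.$$ The Krasnoselskii genus $\gamma(A)$ of a symmetric set $A\subset X$ is the least integer $m\ge0$ for which there is a continuous odd map $A\to\mathbb R^m\setminus\{0\}$, and $\gamma(A)=\infty$ if there is no such $m$. For $n\ge1$ let $\mathcal C_n$ be the family of all compact sets $A\subset\mathcal M$ with $A=-A$ and $\gamma(A)\ge n$, and let $$\Lambda_n=\inf_{A\in\mathcal C_n}\ \sup_{u\in A}K(u).$$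 Then the sequence $(\Lambda_n)_{n\ge1}$ is nondecreasing, $\Lambda_n\to\infty$ as $n\to\infty$, and for every $n\ge1$ the value $\Lambda_n$ is finite and is an eigenvalue with an eigenfunction $u_n\in\mathcal M$. -/

import Mathlib

open Set Filter Topology MeasureTheory
open scoped ENNReal

noncomputable section

namespace FracEigen

/-- Euclidean space of dimension `N`. -/
abbrev Eu (N : ℕ) : Type := EuclideanSpace ℝ (Fin N)

section Modulars

variable {N : ℕ}

/-- Integrand of the Gagliardo modular:
`|u(x) - u(y)|^{p(x,y)} / (p(x,y) |x-y|^{N + s p(x,y)})` at `z = (x, y)`. -/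
def gagliardoDensity (s : ℝ) (p : Eu N → Eu N → ℝ) (u : Eu N → ℝ) (z : Eu N × Eu N) : ℝ :=
  |u z.1 - u z.2| ^ p z.1 z.2 / (p z.1 z.2 * ‖z.1 - z.2‖ ^ ((N : ℝ) + s * p z.1 z.2))

/-- The Gagliardo modular of `u` over `ℝ^N × ℝ^N`, with weight `dx dy / p(x,y)`. -/
def gagliardoModular (s : ℝ) (p : Eu N → Eu N → ℝ) (u : Eu N → ℝ) : ℝ≥0∞ :=
  ∫⁻ z : Eu N × Eu N, ENNReal.ofReal (gagliardoDensity s p u z)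

/-- `K(u)`: the Luxemburg seminorm of the Gagliardo modular. -/
def gagliardoNorm (s : ℝ) (p : Eu N → Eu N → ℝ) (u : Eu N → ℝ) : ℝ :=
  sInf {t : ℝ | 0 < t ∧ gagliardoModular s p (fun x => u x / t) < 1}

/-- `k(u)`: the Luxemburg norm of `L^{r(·)}(Ω)`, with weight `dx / r(x)`. -/
def lebesgueNorm (Ω : Set (Eu N)) (r : Eu N → ℝ) (u : Eu N → ℝ) : ℝ :=
  sInf {t : ℝ | 0 < t ∧ ∫⁻ x in Ω, ENNReal.ofReal (|u x / t| ^ r x / r x) ≤ 1}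

end Modulars

/-- The data of the eigenvalue problem: a nonempty bounded open set `Ω` of `ℝ^N`, a fractional
order `s ∈ (0,1)` and a continuous symmetric exponent `p` on `ℝ^N × ℝ^N` with
`1 < inf p ≤ sup p < N / s`. -/
structure Data (N : ℕ) where
  Ω : Set (Eu N)
  isOpen_Ω : IsOpen Ω
  isBounded_Ω : Bornology.IsBounded Ω
  nonempty_Ω : Ω.Nonempty
  s : ℝ
  s_pos : 0 < s
  s_lt_one : s < 1
  p : Eu N → Eu N → ℝ
  continuous_p : Continuous (fun z : Eu N × Eu N => p z.1 z.2)
  symm_p : ∀ x y, p x y = p y x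
  inf_p : ∃ a : ℝ, 1 < a ∧ ∀ x y, a ≤ p x y
  sup_p : ∃ b : ℝ, b < N / s ∧ ∀ x y, p x y ≤ b

namespace Data

variable {N : ℕ} (D : Data N)

/-- `p̄(x) = p(x,x)`. -/
def pbar (x : Eu N) : ℝ := D.p x x

lemma one_lt_p (x y : Eu N) : 1 < D.p x y := by
  obtain ⟨a, ha, h⟩ := D.inf_p
  exact lt_of_lt_of_le ha (h x y)

lemma p_pos (x y : Eu N) : 0 < D.p x y := one_pos.trans (D.one_lt_p x y)

lemma N_pos (D : Data N) : 0 < N := by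
  rcases Nat.eq_zero_or_pos N with rfl | h
  · obtain ⟨b, hb, h⟩ := D.sup_p
    have h1 := h 0 0
    have h2 := D.one_lt_p 0 0
    simp at hb
    linarith
  · exact h

lemma density_nonneg (u : Eu N → ℝ) (z : Eu N × Eu N) : 0 ≤ gagliardoDensity D.s D.p u z := by
  have := D.p_pos z.1 z.2
  unfold gagliardoDensity
  positivity

lemma measurable_density {u : Eu N → ℝ} (hu : Measurable u) :
    Measurable (gagliardoDensity D.s D.p u) := by
  have hp : Measurable (fun z : Eu N × Eu N => D.p z.1 z.2) := D.continuous_p.measurable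
  unfold gagliardoDensity
  fun_prop

lemma modular_congr {u v : Eu N → ℝ} (h : u =ᵐ[volume] v) :
    gagliardoModular D.s D.p u = gagliardoModular D.s D.p v := by
  refine lintegral_congr_ae ?_
  have h1 : ∀ᵐ z : Eu N × Eu N, u z.1 = v z.1 :=
    Measure.quasiMeasurePreserving_fst.ae h
  have h2 : ∀ᵐ z : Eu N × Eu N, u z.2 = v z.2 :=
    Measure.quasiMeasurePreserving_snd.ae h
  filter_upwards [h1, h2] with z hz1 hz2
  simp only [gagliardoDensity, hz1, hz2]

lemma norm_congr {u v : Eu N → ℝ} (h : u =ᵐ[volume] v) :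
    gagliardoNorm D.s D.p u = gagliardoNorm D.s D.p v := by
  have : ∀ t : ℝ, gagliardoModular D.s D.p (fun x => u x / t)
      = gagliardoModular D.s D.p (fun x => v x / t) := fun t =>
    D.modular_congr (by filter_upwards [h] with x hx; rw [hx])
  simp only [gagliardoNorm, this]

lemma abs_rpow_convex {q : ℝ} (hq : 1 ≤ q) {a b : ℝ} (ha : 0 ≤ a) (hb : 0 ≤ b) (hab : a + b = 1)
    (x y : ℝ) : |a * x + b * y| ^ q ≤ a * |x| ^ q + b * |y| ^ q := by
  have h1 : |a * x + b * y| ≤ a * |x| + b * |y| := by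
    refine (abs_add_le _ _).trans ?_
    rw [abs_mul, abs_mul, abs_of_nonneg ha, abs_of_nonneg hb]
  refine (Real.rpow_le_rpow (abs_nonneg _) h1 (by linarith)).trans ?_
  have := (convexOn_rpow hq).2 (abs_nonneg x : |x| ∈ Ici (0 : ℝ))
    (abs_nonneg y : |y| ∈ Ici (0 : ℝ)) ha hb hab
  simpa [smul_eq_mul] using this

lemma modular_convex {u v : Eu N → ℝ} (hu : Measurable u) {a b : ℝ}
    (ha : 0 ≤ a) (hb : 0 ≤ b) (hab : a + b = 1) :
    gagliardoModular D.s D.p (fun x => a * u x + b * v x) ≤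
      ENNReal.ofReal a * gagliardoModular D.s D.p u
        + ENNReal.ofReal b * gagliardoModular D.s D.p v := by
  unfold gagliardoModular
  rw [← lintegral_const_mul' _ _ ENNReal.ofReal_ne_top,
    ← lintegral_const_mul' _ _ ENNReal.ofReal_ne_top,
    ← lintegral_add_left ((D.measurable_density hu).ennreal_ofReal.const_mul _)]
  refine lintegral_mono fun z => ?_
  simp only
  rw [← ENNReal.ofReal_mul ha, ← ENNReal.ofReal_mul hb,
    ← ENNReal.ofReal_add (mul_nonneg ha (D.density_nonneg _ _))
      (mul_nonneg hb (D.density_nonneg _ _))]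
  refine ENNReal.ofReal_le_ofReal ?_
  unfold gagliardoDensity
  have hp := D.p_pos z.1 z.2
  have hw : 0 ≤ D.p z.1 z.2 * ‖z.1 - z.2‖ ^ ((N : ℝ) + D.s * D.p z.1 z.2) := by positivity
  have h := abs_rpow_convex (D.one_lt_p z.1 z.2).le ha hb hab (u z.1 - u z.2) (v z.1 - v z.2)
  have e : a * u z.1 + b * v z.1 - (a * u z.2 + b * v z.2)
      = a * (u z.1 - u z.2) + b * (v z.1 - v z.2) := by ring
  rw [e, ← mul_div_assoc, ← mul_div_assoc, ← add_div]
  exact div_le_div_of_nonneg_right h hw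

lemma modular_zero : gagliardoModular D.s D.p (fun _ => 0) = 0 := by
  unfold gagliardoModular gagliardoDensity
  have : ∀ z : Eu N × Eu N, (0 : ℝ) ^ D.p z.1 z.2 = 0 := fun z =>
    Real.zero_rpow (D.p_pos _ _).ne'
  simp [this]

lemma modular_mul_le {u : Eu N → ℝ} (hu : Measurable u) {a : ℝ} (ha : 0 ≤ a) (ha1 : a ≤ 1) :
    gagliardoModular D.s D.p (fun x => a * u x)
      ≤ ENNReal.ofReal a * gagliardoModular D.s D.p u := by
  have h := D.modular_convex (v := fun _ => 0) hu ha (sub_nonneg.2 ha1) (by ring)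
  rw [D.modular_zero] at h
  simpa using h

/-- `|c a|^q ≤ max(1,|c|)^B |a|^q` for `1 ≤ q ≤ B`. -/
lemma abs_mul_rpow_le {q B : ℝ} (hq : 0 ≤ q) (hB : q ≤ B) (c a : ℝ) :
    |c * a| ^ q ≤ (max 1 |c|) ^ B * |a| ^ q := by
  rw [abs_mul, Real.mul_rpow (abs_nonneg _) (abs_nonneg _)]
  refine mul_le_mul_of_nonneg_right ?_ (by positivity)
  exact (Real.rpow_le_rpow (abs_nonneg _) (le_max_right _ _) hq).trans
    (Real.rpow_le_rpow_of_exponent_le (le_max_left _ _) hB)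

lemma modular_smul_lt_top {u : Eu N → ℝ}
    (h : gagliardoModular D.s D.p u < ∞) (c : ℝ) :
    gagliardoModular D.s D.p (fun x => c * u x) < ∞ := by
  obtain ⟨B, -, hB⟩ := D.sup_p
  have : gagliardoModular D.s D.p (fun x => c * u x)
      ≤ ENNReal.ofReal ((max 1 |c|) ^ B) * gagliardoModular D.s D.p u := by
    unfold gagliardoModular
    rw [← lintegral_const_mul' _ _ ENNReal.ofReal_ne_top]
    refine lintegral_mono fun z => ?_
    simp only
    rw [← ENNReal.ofReal_mul (by positivity)]
    refine ENNReal.ofReal_le_ofReal ?_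
    unfold gagliardoDensity
    have hp := D.p_pos z.1 z.2
    rw [← mul_sub, ← mul_div_assoc]
    exact div_le_div_of_nonneg_right (abs_mul_rpow_le hp.le (hB _ _) _ _) (by positivity)
  exact this.trans_lt (ENNReal.mul_lt_top ENNReal.ofReal_lt_top h)

lemma modular_add_lt_top {u v : Eu N → ℝ} (hu : Measurable u)
    (h : gagliardoModular D.s D.p u < ∞) (h' : gagliardoModular D.s D.p v < ∞) :
    gagliardoModular D.s D.p (fun x => u x + v x) < ∞ := by
  have h1 := D.modular_convex (u := fun x => 2 * u x) (v := fun x => 2 * v x)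
    (hu.const_mul 2) (a := 1 / 2) (b := 1 / 2) (by norm_num) (by norm_num) (by norm_num)
  have e : (fun x => 1 / 2 * (2 * u x) + 1 / 2 * (2 * v x)) = fun x => u x + v x := by
    funext x; ring
  rw [e] at h1
  exact h1.trans_lt (ENNReal.add_lt_top.2
    ⟨ENNReal.mul_lt_top ENNReal.ofReal_lt_top (D.modular_smul_lt_top h 2),
      ENNReal.mul_lt_top ENNReal.ofReal_lt_top (D.modular_smul_lt_top h' 2)⟩)

/-- The modular `∫_{ℝ^N} |u|^{p̄(x)} dx`, whose finiteness defines `L^{p̄}(ℝ^N)`. -/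
def pbarModular (u : Eu N → ℝ) : ℝ≥0∞ := ∫⁻ x, ENNReal.ofReal (|u x| ^ D.pbar x)

lemma pbarModular_congr {u v : Eu N → ℝ} (h : u =ᵐ[volume] v) :
    D.pbarModular u = D.pbarModular v :=
  lintegral_congr_ae (by filter_upwards [h] with x hx; rw [hx])

lemma pbarModular_smul_lt_top {u : Eu N → ℝ} (h : D.pbarModular u < ∞) (c : ℝ) :
    D.pbarModular (fun x => c * u x) < ∞ := by
  obtain ⟨B, -, hB⟩ := D.sup_p
  have : D.pbarModular (fun x => c * u x)
      ≤ ENNReal.ofReal ((max 1 |c|) ^ B) * D.pbarModular u := by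
    unfold pbarModular
    rw [← lintegral_const_mul' _ _ ENNReal.ofReal_ne_top]
    refine lintegral_mono fun x => ?_
    simp only
    rw [← ENNReal.ofReal_mul (by positivity)]
    exact ENNReal.ofReal_le_ofReal (abs_mul_rpow_le (D.p_pos x x).le (hB x x) _ _)
  exact this.trans_lt (ENNReal.mul_lt_top ENNReal.ofReal_lt_top h)

lemma pbarModular_add_lt_top {u v : Eu N → ℝ} (hu : Measurable u)
    (h : D.pbarModular u < ∞) (h' : D.pbarModular v < ∞) :
    D.pbarModular (fun x => u x + v x) < ∞ := by
  have hp : Measurable D.pbar :=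
    (D.continuous_p.comp (continuous_id.prodMk continuous_id)).measurable
  have hm : Measurable fun x => ENNReal.ofReal (|2 * u x| ^ D.pbar x) := by fun_prop
  refine lt_of_le_of_lt (b := D.pbarModular (fun x => 2 * u x) + D.pbarModular (fun x => 2 * v x))
    ?_ (ENNReal.add_lt_top.2 ⟨D.pbarModular_smul_lt_top h 2, D.pbarModular_smul_lt_top h' 2⟩)
  unfold pbarModular
  rw [← lintegral_add_left hm]
  refine lintegral_mono fun x => ?_
  simp only
  rw [← ENNReal.ofReal_add (by positivity) (by positivity)]
  refine ENNReal.ofReal_le_ofReal ?_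
  have h1 := abs_rpow_convex (D.one_lt_p x x).le (a := 1 / 2) (b := 1 / 2) (by norm_num)
    (by norm_num) (by norm_num) (2 * u x) (2 * v x)
  have e : 1 / 2 * (2 * u x) + 1 / 2 * (2 * v x) = u x + v x := by ring
  rw [e] at h1
  have h2 : 0 ≤ |2 * u x| ^ D.p x x := by positivity
  have h3 : 0 ≤ |2 * v x| ^ D.p x x := by positivity
  unfold pbar
  linarith

/-- The space `X` of all (classes of) measurable `u` in `L^{p̄}(ℝ^N)` with finite Gagliardo modular
and `u = 0` a.e. outside `Ω`, as a linear subspace of the space of measurable functions modulo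
a.e. equality. -/
def spaceX : Submodule ℝ (Eu N →ₘ[volume] ℝ) where
  carrier := {u | D.pbarModular u < ∞ ∧ gagliardoModular D.s D.p u < ∞ ∧
    ∀ᵐ x, x ∉ D.Ω → u x = 0}
  zero_mem' := by
    have h0 : ((0 : Eu N →ₘ[volume] ℝ) : Eu N → ℝ) =ᵐ[volume] fun _ => 0 := AEEqFun.coeFn_zero
    refine ⟨?_, ?_, ?_⟩
    · rw [D.pbarModular_congr h0]
      have : ∀ x, (0 : ℝ) ^ D.pbar x = 0 := fun x => Real.zero_rpow (D.p_pos x x).ne'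
      simp [pbarModular, this]
    · rw [D.modular_congr h0, D.modular_zero]
      exact ENNReal.zero_lt_top
    · filter_upwards [h0] with x hx _ using hx
  add_mem' := by
    rintro u v ⟨hu1, hu2, hu3⟩ ⟨hv1, hv2, hv3⟩
    have h : ((u + v : Eu N →ₘ[volume] ℝ) : Eu N → ℝ) =ᵐ[volume] fun x => u x + v x :=
      AEEqFun.coeFn_add u v
    refine ⟨?_, ?_, ?_⟩
    · rw [D.pbarModular_congr h]
      exact D.pbarModular_add_lt_top u.measurable hu1 hv1
    · rw [D.modular_congr h]
      exact D.modular_add_lt_top u.measurable hu2 hv2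
    · filter_upwards [h, hu3, hv3] with x hx h1 h2 h3
      rw [hx, h1 h3, h2 h3, add_zero]
  smul_mem' := by
    rintro c u ⟨hu1, hu2, hu3⟩
    have h : ((c • u : Eu N →ₘ[volume] ℝ) : Eu N → ℝ) =ᵐ[volume] fun x => c * u x :=
      AEEqFun.coeFn_smul c u
    refine ⟨?_, ?_, ?_⟩
    · rw [D.pbarModular_congr h]
      exact D.pbarModular_smul_lt_top hu1 c
    · rw [D.modular_congr h]
      exact D.modular_smul_lt_top hu2 c
    · filter_upwards [h, hu3] with x hx h1 h3
      rw [hx, h1 h3, mul_zero]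

/-- The type of elements of `X`; its topology is that of the norm `K`, see below. -/
def X : Type := D.spaceX

instance : AddCommGroup D.X := inferInstanceAs (AddCommGroup D.spaceX)

instance : Module ℝ D.X := inferInstanceAs (Module ℝ D.spaceX)

/-- Elements of `X` as functions on `ℝ^N` (a measurable representative). -/
instance : CoeFun D.X (fun _ => Eu N → ℝ) := ⟨fun u => ((u.1 : Eu N →ₘ[volume] ℝ) : Eu N → ℝ)⟩

/-- `K` on `X`. -/
def K (u : D.X) : ℝ := gagliardoNorm D.s D.p u

/-- `k(u) = ‖u‖_{p̄,Ω}` on `X`. -/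
def k (u : D.X) : ℝ := lebesgueNorm D.Ω D.pbar u

lemma X_measurable (u : D.X) : Measurable (u : Eu N → ℝ) :=
  AEEqFun.measurable (u.1 : Eu N →ₘ[volume] ℝ)

lemma X_add (u v : D.X) : ((u + v : D.X) : Eu N → ℝ) =ᵐ[volume] fun x => u x + v x :=
  AEEqFun.coeFn_add (u.1 : Eu N →ₘ[volume] ℝ) v.1

lemma X_neg (u : D.X) : ((-u : D.X) : Eu N → ℝ) =ᵐ[volume] fun x => -u x :=
  AEEqFun.coeFn_neg (u.1 : Eu N →ₘ[volume] ℝ)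

lemma X_zero : ((0 : D.X) : Eu N → ℝ) =ᵐ[volume] fun _ => 0 :=
  AEEqFun.coeFn_zero

lemma admissible_nonempty (u : D.X) :
    {t : ℝ | 0 < t ∧ gagliardoModular D.s D.p (fun x => u x / t) < 1}.Nonempty := by
  have hu : gagliardoModular D.s D.p u < ∞ := u.2.2.1
  set m := (gagliardoModular D.s D.p u).toReal with hm
  have hm0 : 0 ≤ m := ENNReal.toReal_nonneg
  have hpos : 0 < m + 1 := by linarith
  refine ⟨m + 1, hpos, ?_⟩
  have h1 := D.modular_mul_le (D.X_measurable u) (a := (m + 1)⁻¹) (by positivity)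
    (inv_le_one_of_one_le₀ (by linarith))
  have e : (fun x => u x / (m + 1)) = fun x => (m + 1)⁻¹ * u x := by
    funext x; rw [div_eq_inv_mul]
  rw [e]
  refine h1.trans_lt ?_
  rw [← ENNReal.ofReal_toReal hu.ne, ← hm, ← ENNReal.ofReal_mul (by positivity),
    ENNReal.ofReal_lt_one, inv_mul_lt_one₀ hpos]
  linarith

lemma admissible_bddBelow (u : Eu N → ℝ) :
    BddBelow {t : ℝ | 0 < t ∧ gagliardoModular D.s D.p (fun x => u x / t) < 1} :=
  ⟨0, fun _ h => h.1.le⟩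

lemma K_zero : D.K 0 = 0 := by
  unfold K
  rw [D.norm_congr D.X_zero]
  have : {t : ℝ | 0 < t ∧ gagliardoModular D.s D.p (fun _ => (0 : ℝ) / t) < 1} = Ioi 0 := by
    ext t
    simp [D.modular_zero]
  unfold gagliardoNorm
  rw [this, csInf_Ioi]

lemma K_neg (u : D.X) : D.K (-u) = D.K u := by
  unfold K
  rw [D.norm_congr (D.X_neg u)]
  have : ∀ t : ℝ, gagliardoModular D.s D.p (fun x => -u x / t)
      = gagliardoModular D.s D.p (fun x => u x / t) := by
    intro t
    unfold gagliardoModular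
    refine lintegral_congr fun z => ?_
    have e : -u z.1 / t - -u z.2 / t = -(u z.1 / t - u z.2 / t) := by ring
    simp only [gagliardoDensity, e, abs_neg]
  simp only [gagliardoNorm, this]

lemma K_add_le (u v : D.X) : D.K (u + v) ≤ D.K u + D.K v := by
  unfold K
  rw [D.norm_congr (D.X_add u v)]
  have key : ∀ a ∈ {t : ℝ | 0 < t ∧ gagliardoModular D.s D.p (fun x => u x / t) < 1},
      ∀ b ∈ {t : ℝ | 0 < t ∧ gagliardoModular D.s D.p (fun x => v x / t) < 1},
      gagliardoNorm D.s D.p (fun x => u x + v x) ≤ a + b := by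
    rintro a ⟨ha, ha1⟩ b ⟨hb, hb1⟩
    have hab : 0 < a + b := add_pos ha hb
    refine csInf_le (D.admissible_bddBelow _) ⟨hab, ?_⟩
    have h := D.modular_convex (u := fun x => u x / a) (v := fun x => v x / b)
      ((D.X_measurable u).div_const a) (a := a / (a + b)) (b := b / (a + b))
      (by positivity) (by positivity) (by field_simp)
    have e : (fun x => a / (a + b) * (u x / a) + b / (a + b) * (v x / b))
        = fun x => (u x + v x) / (a + b) := by
      funext x
      field_simp
    rw [e] at h
    refine h.trans_lt ?_
    have hA : ENNReal.ofReal (a / (a + b)) ≠ 0 := by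
      simpa using div_pos ha hab
    have hB : ENNReal.ofReal (b / (a + b)) ≠ 0 := by
      simpa using div_pos hb hab
    calc _ < ENNReal.ofReal (a / (a + b)) * 1 + ENNReal.ofReal (b / (a + b)) * 1 :=
          ENNReal.add_lt_add (ENNReal.mul_lt_mul_right hA ENNReal.ofReal_ne_top ha1)
            (ENNReal.mul_lt_mul_right hB ENNReal.ofReal_ne_top hb1)
      _ = 1 := by
          rw [mul_one, mul_one, ← ENNReal.ofReal_add (by positivity) (by positivity),
            ← add_div, div_self hab.ne', ENNReal.ofReal_one]
  have h1 : ∀ a ∈ {t : ℝ | 0 < t ∧ gagliardoModular D.s D.p (fun x => u x / t) < 1},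
      gagliardoNorm D.s D.p (fun x => u x + v x) - a ≤ gagliardoNorm D.s D.p v := fun a ha =>
    le_csInf (D.admissible_nonempty v) fun b hb => by linarith [key a ha b hb]
  have h2 : gagliardoNorm D.s D.p (fun x => u x + v x) - gagliardoNorm D.s D.p v
      ≤ gagliardoNorm D.s D.p u :=
    le_csInf (D.admissible_nonempty u) fun a ha => by linarith [h1 a ha]
  linarith

lemma modular_eq_zero_of_K {u : D.X} (h : D.K u = 0) : gagliardoModular D.s D.p u = 0 := by
  refine le_antisymm (le_of_forall_pos_le_add fun ε hε => ?_) zero_le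
  rw [zero_add]
  obtain ⟨δ, hδ, hδε⟩ : ∃ δ : ℝ, 0 < δ ∧ ENNReal.ofReal δ ≤ ε := by
    rcases eq_or_ne ε ∞ with rfl | hε'
    · exact ⟨1, one_pos, le_top⟩
    · exact ⟨ε.toReal, ENNReal.toReal_pos hε.ne' hε', (ENNReal.ofReal_toReal hε').le⟩
  have hlt : D.K u < min δ 1 := by rw [h]; exact lt_min hδ one_pos
  obtain ⟨t, ⟨ht, ht1⟩, hlt⟩ := exists_lt_of_csInf_lt (D.admissible_nonempty u) hlt
  have h1 := D.modular_mul_le ((D.X_measurable u).div_const t) ht.le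
    (hlt.le.trans (min_le_right _ _))
  have e : (fun x => t * (u x / t)) = u := by
    funext x
    field_simp
  rw [e] at h1
  calc _ ≤ ENNReal.ofReal t * 1 := h1.trans (mul_le_mul_right ht1.le _)
    _ ≤ ε := by
      rw [mul_one]
      exact (ENNReal.ofReal_le_ofReal (hlt.le.trans (min_le_left _ _))).trans hδε

lemma volume_compl_ne_zero : volume (D.Ωᶜ) ≠ 0 := by
  have : Nonempty (Fin N) := ⟨⟨0, N_pos D⟩⟩
  have : NoncompactSpace (Eu N) := NormedSpace.noncompactSpace ℝ (Eu N)
  intro h0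
  have h1 : volume (univ : Set (Eu N)) ≤ volume D.Ω + volume (D.Ωᶜ) := by
    rw [← union_compl_self D.Ω]; exact measure_union_le _ _
  rw [h0, add_zero, measure_univ_of_isAddLeftInvariant] at h1
  exact absurd D.isBounded_Ω.measure_lt_top (not_lt.2 h1)

lemma eq_zero_of_K {u : D.X} (h : D.K u = 0) : u = 0 := by
  have h0 := D.modular_eq_zero_of_K h
  unfold gagliardoModular at h0
  rw [lintegral_eq_zero_iff (D.measurable_density (D.X_measurable u)).ennreal_ofReal] at h0
  have h1 : ∀ᵐ z : Eu N × Eu N, u z.1 = u z.2 := by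
    filter_upwards [h0] with z hz
    have hz' : gagliardoDensity D.s D.p u z ≤ 0 := by simpa using hz
    have hz2 := le_antisymm hz' (D.density_nonneg _ _)
    by_contra hne
    have hxy : z.1 ≠ z.2 := fun e => hne (by rw [e])
    have hp := D.p_pos z.1 z.2
    have a1 : 0 < |u z.1 - u z.2| := abs_pos.2 (sub_ne_zero.2 hne)
    have a2 : 0 < ‖z.1 - z.2‖ := norm_pos_iff.2 (sub_ne_zero.2 hxy)
    have : 0 < gagliardoDensity D.s D.p u z := by
      unfold gagliardoDensity
      positivity
    exact this.ne' hz2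
  have h2 : ∀ᵐ x : Eu N, ∀ᵐ y : Eu N, u x = u y := Measure.ae_ae_of_ae_prod h1
  have h3 : ∀ᵐ y : Eu N, y ∉ D.Ω → u y = 0 := u.2.2.2
  have h4 : (u : Eu N → ℝ) =ᵐ[volume] fun _ => 0 := by
    filter_upwards [h2] with x hx
    have hf : ∃ᵐ y : Eu N, y ∈ D.Ωᶜ := by
      rw [frequently_ae_mem_iff]
      exact D.volume_compl_ne_zero
    obtain ⟨y, hy, hy1, hy2⟩ := (hf.and_eventually (hx.and h3)).exists
    rw [hy1, hy2 hy]
  exact Subtype.ext (AEEqFun.ext (h4.trans D.X_zero.symm))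

/-- `X` is normed by `K`. -/
instance : NormedAddCommGroup D.X :=
  AddGroupNorm.toNormedAddCommGroup
    { toFun := D.K
      map_zero' := D.K_zero
      add_le' := D.K_add_le
      neg' := D.K_neg
      eq_zero_of_map_eq_zero' := fun _ h => D.eq_zero_of_K h }

/-- The `s`-difference quotient `(u(x) - u(y)) / |x-y|^s` at `z = (x, y)`. -/
def nablaS (u : D.X) (z : Eu N × Eu N) : ℝ := (u z.1 - u z.2) / ‖z.1 - z.2‖ ^ D.s

/-- The factor `S(u)`. -/
def S (u : D.X) : ℝ :=
  (∫ z : Eu N × Eu N, |D.nablaS u z / D.K u| ^ D.p z.1 z.2 / ‖z.1 - z.2‖ ^ N) /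
    ∫ x in D.Ω, |u x / D.k u| ^ D.pbar x

/-- `u` is an eigenfunction with eigenvalue `L`: a nontrivial weak solution, tested against
all of `X`. -/
def IsEigenpair (L : ℝ) (u : D.X) : Prop :=
  u ≠ 0 ∧ ∀ φ : D.X,
    ∫ z : Eu N × Eu N, |D.nablaS u z / D.K u| ^ (D.p z.1 z.2 - 2) * (D.nablaS u z / D.K u) *
        D.nablaS φ z / ‖z.1 - z.2‖ ^ N
      = L * D.S u * ∫ x in D.Ω, |u x / D.k u| ^ (D.pbar x - 2) * (u x / D.k u) * φ x

/-- The constraint set `M = {u ∈ X : k(u) = 1}`. -/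
def M : Set D.X := {u | D.k u = 1}

end Data

/-- Krasnoselskii genus of a symmetric set `A`: the least `m` for which there is a continuous odd
map `A → ℝ^m ∖ {0}`, and `∞` if there is none (so it is `0` exactly for `A = ∅`). -/
def genus {V : Type*} [TopologicalSpace V] [Neg V] (A : Set V) : ℕ∞ :=
  ⨅ (m : ℕ) (_ : ∃ g : V → EuclideanSpace ℝ (Fin m), ContinuousOn g A ∧
    (∀ u ∈ A, g (-u) = -g u) ∧ ∀ u ∈ A, g u ≠ 0), (m : ℕ∞)

namespace Data

variable {N : ℕ} (D : Data N)

/-- The class of compact symmetric subsets of `M` of genus at least `n`. -/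
def minimaxClass (n : ℕ) : Set (Set D.X) :=
  {A | A ⊆ D.M ∧ IsCompact A ∧ (∀ u ∈ A, -u ∈ A) ∧ (n : ℕ∞) ≤ genus A}

/-- The minimax value `Λ_n`, as an extended real number. -/
def Lam (n : ℕ) : EReal := ⨅ A ∈ D.minimaxClass n, ⨆ u ∈ A, (D.K u : EReal)

end Data

end FracEigen

end

/-! The usual deformation along a gradient flow is replaced by one explicit odd map `T` on `M` that
does not increase `K`. For `u ∈ M` write `⟨u, v⟩` for `pair u v = ∫_Ω |u|^(p̄-2) u v`, which is
linear in `v`. By strict convexity of the modular (`rho_midpoint_lt`) it has a unique maximizer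
`maxi u` over the unit ball of `X`, and `T u` is this maximizer rescaled into `M`. Testing
maximality with `u / K(u)`, and using the tangent inequality in the form `⟨u, v⟩ ≤ k(v) ⟨u, u⟩`,
gives `⟨u, u⟩ / K(u) ≤ k(maxi u) ⟨u, u⟩`, that is `K(T u) ≤ K(u)` (`K_T_le`). In the case of
equality `u / K(u)` is itself the maximizer, and the Lagrange multiplier rule for it is the
eigenvalue equation with eigenvalue `K(u)` (`isEigenpair_of_isPairMax`).

`T` is odd and continuous on `M`, so it maps each minimax class to itself. Applied to a nearly
optimal set it yields points with `K(u) < L + ε` and `K(T u) > L - ε` (`exists_almost_fixed`). Let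
`w` be a limit of such points along a subsequence. Fatou gives `K(w) ≤ L`, while `T` turns a.e.
convergence into norm convergence, so `L ≤ K(T w) ≤ K(w)`. Equality holds throughout and `w` is an
eigenfunction.

Compactness is that of bounded modular with a.e. convergence (`TendstoBdd`), which serves as weak
convergence. Sublevel sets of the modular are totally bounded in `L¹`, by averaging over small cubes
(`totallyBounded_J_image`), and they are bounded with the larger exponent `p̄ + gain`
(`exists_higher_integrability`). Hence all integrals of order `p̄` over `Ω` pass to the limit.

Finiteness of the minimax values needs sets of every genus in `M`. These are images of spheres, by
Borsuk–Ulam, which is derived from a common zero theorem for real forms of odd degree. Divergence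
holds because `{u ∈ M : K(u) ≤ R}` has totally bounded image in `L¹`, bounded away from zero:
finitely many odd bump functions map it into some `ℝ^m ∖ {0}` (`exists_genus_le`). -/

namespace FracEigen

/-! ### Borsuk–Ulam from common zeros of real forms of odd degree -/

section BorsukUlam

open MvPolynomial

lemma exists_root_of_odd_natDegree {P : Polynomial ℝ} (hP : P.Monic) (hodd : Odd P.natDegree) :
    ∃ x, P.IsRoot x := by
  have hdeg : 0 < P.degree := Polynomial.natDegree_pos_iff_degree_pos.1 hodd.pos
  have h1 := P.tendsto_atTop_of_leadingCoeff_nonneg hdeg (by rw [hP.leadingCoeff]; norm_num)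
  have hn : (P.comp (-Polynomial.X)).natDegree = P.natDegree := by
    rw [Polynomial.natDegree_comp, Polynomial.natDegree_neg, Polynomial.natDegree_X, mul_one]
  have h2 := (P.comp (-Polynomial.X)).tendsto_atBot_of_leadingCoeff_nonpos
    (Polynomial.natDegree_pos_iff_degree_pos.1 (by rw [hn]; exact hodd.pos)) (by
      rw [Polynomial.leadingCoeff_comp (by simp), hP.leadingCoeff]
      simp [hodd.neg_one_pow])
  obtain ⟨a, ha⟩ := (h1.eventually_ge_atTop 0).exists
  obtain ⟨b, hb⟩ := (h2.eventually_le_atBot 0).exists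
  simp only [Polynomial.eval_comp, Polynomial.eval_neg, Polynomial.eval_X] at hb
  obtain ⟨x, hx⟩ := mem_range_of_exists_le_of_exists_ge P.continuous ⟨-b, hb⟩ ⟨a, ha⟩
  exact ⟨x, hx⟩

lemma exists_hasEigenvalue_of_odd_finrank {V : Type*} [AddCommGroup V] [Module ℝ V]
    [FiniteDimensional ℝ V] (hV : Odd (Module.finrank ℝ V)) (T : Module.End ℝ V) :
    ∃ a, T.HasEigenvalue a := by
  obtain ⟨a, ha⟩ := exists_root_of_odd_natDegree T.charpoly_monic
    (by rwa [LinearMap.charpoly_natDegree])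
  exact ⟨a, (Module.End.hasEigenvalue_iff_isRoot_charpoly T a).2 ha⟩

/-- Commuting endomorphisms of an odd-dimensional real vector space have a common eigenvector. -/
theorem exists_common_eigenvector {ι : Type*} (d : ℕ) : ∀ {V : Type} [AddCommGroup V] [Module ℝ V]
    [FiniteDimensional ℝ V] (_ : Module.finrank ℝ V = d) (_ : Odd d) (T : ι → Module.End ℝ V)
    (_ : ∀ i j, Commute (T i) (T j)), ∃ v : V, v ≠ 0 ∧ ∀ i, ∃ a : ℝ, T i v = a • v := by
  induction d using Nat.strong_induction_on with
  | _ d ih =>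
    intro V _ _ _ hd hodd T hT
    have restr : ∀ U : Submodule ℝ V, Module.finrank ℝ U < d → Odd (Module.finrank ℝ U) →
        (∀ i, ∀ x ∈ U, T i x ∈ U) → ∃ v : V, v ≠ 0 ∧ ∀ i, ∃ a : ℝ, T i v = a • v := by
      intro U hU hUo hinv
      obtain ⟨v, hv, h⟩ := ih _ hU (V := U) rfl hUo (fun i => (T i).restrict (hinv i)) (by
        intro i j
        ext x
        simpa using congrArg (fun S : Module.End ℝ V => S x) (hT i j).eq)
      refine ⟨v, by simpa using hv, fun i => ?_⟩
      obtain ⟨a, ha⟩ := h i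
      exact ⟨a, by simpa using congrArg Subtype.val ha⟩
    by_cases hall : ∀ i, ∃ a : ℝ, T i = a • 1
    · have : Nontrivial V := Module.nontrivial_of_finrank_pos (R := ℝ) (by rw [hd]; exact hodd.pos)
      obtain ⟨v, hv⟩ := exists_ne (0 : V)
      refine ⟨v, hv, fun i => ?_⟩
      obtain ⟨a, ha⟩ := hall i
      exact ⟨a, by simp [ha]⟩
    · push Not at hall
      obtain ⟨i, hi⟩ := hall
      obtain ⟨a, ha⟩ := exists_hasEigenvalue_of_odd_finrank (by rwa [hd]) (T i)
      set S : Module.End ℝ V := T i - a • 1 with hS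
      have hcomm : ∀ j, Commute (T j) S := fun j =>
        (hT j i).sub_right ((Commute.one_right _).smul_right a)
      have hcx : ∀ j x, T j (S x) = S (T j x) := fun j x =>
        congrArg (fun S : Module.End ℝ V => S x) (hcomm j).eq
      have hsum := LinearMap.finrank_range_add_finrank_ker S
      have hS0 : S ≠ 0 := fun h => hi a (sub_eq_zero.1 h)
      have hker : 0 < Module.finrank ℝ (LinearMap.ker S) := by
        obtain ⟨v, hv⟩ := ha.exists_hasEigenvector
        have hvk : v ∈ LinearMap.ker S := by
          simp [hS, hv.apply_eq_smul]
        have : Nontrivial (LinearMap.ker S) :=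
          ⟨⟨v, hvk⟩, 0, fun h => hv.2 (congrArg Subtype.val h)⟩
        exact Module.finrank_pos
      have hran : 0 < Module.finrank ℝ (LinearMap.range S) := by
        obtain ⟨x, hx⟩ := DFunLike.ne_iff.1 hS0
        have : Nontrivial (LinearMap.range S) :=
          ⟨⟨S x, x, rfl⟩, 0, fun h => hx (by simpa using congrArg Subtype.val h)⟩
        exact Module.finrank_pos
      rw [hd] at hsum
      -- Kernel and range of `S` are nonzero, proper and invariant under every `T j`. Their
      -- dimensions add up to the odd number `d`, so one of them is odd and the induction applies to
      -- it.
      rcases Nat.even_or_odd (Module.finrank ℝ (LinearMap.ker S)) with hk | hk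
      · refine restr (LinearMap.range S) (by omega) ?_ ?_
        · rw [← hsum] at hodd
          exact (Nat.odd_add.1 hodd).2 hk
        · rintro j _ ⟨x, rfl⟩
          exact ⟨T j x, (hcx j x).symm⟩
      · refine restr (LinearMap.ker S) (by omega) hk ?_
        intro j x hx
        rw [LinearMap.mem_ker] at hx ⊢
        rw [← hcx, hx, map_zero]

/-- A locally finite endomorphism `S`: `1 + t S` is bijective for all but countably many `t`. -/
lemma countable_not_bijective {V : Type*} [AddCommGroup V] [Module ℝ V] (S : Module.End ℝ V)
    (W : ℕ → Submodule ℝ V) [∀ d, FiniteDimensional ℝ (W d)] (hW : ∀ d, ∀ x ∈ W d, S x ∈ W d)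
    (hex : ∀ x, ∃ d, x ∈ W d) :
    {t : ℝ | ¬ Function.Bijective (1 + t • S : Module.End ℝ V)}.Countable := by
  have hfin : ∀ d, {a | Module.End.HasEigenvalue (S.restrict (hW d)) a}.Finite :=
    fun d => Module.End.finite_hasEigenvalue _
  have hc : (⋃ d, (fun a : ℝ => -a⁻¹) ''
      {a | Module.End.HasEigenvalue (S.restrict (hW d)) a}).Countable :=
    countable_iUnion fun d => ((hfin d).countable).image _
  refine hc.mono fun t ht => ?_
  by_contra hcon
  apply ht
  have hinj : Function.Injective (1 + t • S : Module.End ℝ V) := by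
    rw [← LinearMap.ker_eq_bot, LinearMap.ker_eq_bot']
    intro x hx
    by_contra hx0
    apply hcon
    obtain ⟨d, hd⟩ := hex x
    have hx' : x + t • S x = 0 := by simpa using hx
    have ht0 : t ≠ 0 := by
      rintro rfl
      exact hx0 (by simpa using hx')
    -- A kernel vector of `1 + t S` satisfies `S x = -t⁻¹ x`, and on the finite-dimensional `W d`
    -- there are only finitely many eigenvalues.
    refine mem_iUnion.2 ⟨d, -t⁻¹, ?_, by simp⟩
    refine Module.End.hasEigenvalue_of_hasEigenvector (x := ⟨x, hd⟩)
      (Module.End.hasEigenvector_iff.2 ⟨Module.End.mem_eigenspace_iff.2 ?_, ?_⟩)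
    · ext
      have : S x = t⁻¹ • (t • S x) := by rw [smul_smul, inv_mul_cancel₀ ht0, one_smul]
      simp only [LinearMap.coe_restrict_apply, Submodule.coe_smul]
      rw [this, eq_neg_of_add_eq_zero_right hx', smul_neg, neg_smul]
    · exact fun h => hx0 (congrArg Subtype.val h)
  -- Surjectivity follows inside a finite-dimensional invariant `W d` containing `y`, where
  -- injectivity suffices.
  refine ⟨hinj, fun y => ?_⟩
  obtain ⟨d, hd⟩ := hex y
  have hW' : ∀ x ∈ W d, (1 + t • S : Module.End ℝ V) x ∈ W d := fun x hx => by
    simpa using (W d).add_mem hx ((W d).smul_mem t (hW d x hx))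
  have hs : Function.Surjective ((1 + t • S : Module.End ℝ V).restrict hW') := by
    refine LinearMap.injective_iff_surjective.1 fun a b hab => ?_
    exact Subtype.ext (hinj (by simpa using congrArg Subtype.val hab))
  obtain ⟨x, hx⟩ := hs ⟨y, hd⟩
  exact ⟨x, by simpa using congrArg Subtype.val hx⟩

variable {n : ℕ}

/-- Exponents all of whose first `k` entries are `< e`. -/
def reducedExp (n e k : ℕ) : Set (Fin n →₀ ℕ) := {β | ∀ i : Fin n, (i : ℕ) < k → β i < e}

lemma exists_first_index {e k : ℕ} {β : Fin n →₀ ℕ} (h : β ∉ reducedExp n e k) :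
    ∃ i : Fin n, (i : ℕ) < k ∧ e ≤ β i ∧ ∀ j < i, β j < e := by
  classical
  have hne : (Finset.univ.filter fun i : Fin n => (i : ℕ) < k ∧ e ≤ β i).Nonempty := by
    by_contra hcon
    rw [Finset.not_nonempty_iff_eq_empty, Finset.filter_eq_empty_iff] at hcon
    exact h fun i hi => not_le.1 fun hle => hcon (Finset.mem_univ i) ⟨hi, hle⟩
  have hmin := Finset.min'_mem _ hne
  rw [Finset.mem_filter] at hmin
  refine ⟨_, hmin.2.1, hmin.2.2, fun j hj => not_le.1 fun hle => ?_⟩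
  refine absurd (Finset.min'_le _ j ?_) (not_le.2 hj)
  exact Finset.mem_filter.2 ⟨Finset.mem_univ _,
    (show (j : ℕ) < _ from hj).trans hmin.2.1, hle⟩

open scoped Classical in
/-- The rewriting operator `x^β ↦ x^(β - e·1_i) g_i`, with `i < k` the first index with
`e ≤ β i`. -/
noncomputable def rewriteOp (g : Fin n → MvPolynomial (Fin n) ℝ) (e k : ℕ) :
    Module.End ℝ (MvPolynomial (Fin n) ℝ) :=
  (basisMonomials (Fin n) ℝ).constr ℝ fun β =>
    if h : β ∉ reducedExp n e k then
      monomial (β - Finsupp.single (exists_first_index h).choose e) 1 *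
        g (exists_first_index h).choose
    else 0

open scoped Classical in
lemma rewriteOp_monomial_of_mem (g : Fin n → MvPolynomial (Fin n) ℝ) {e k : ℕ} {β : Fin n →₀ ℕ}
    (h : β ∈ reducedExp n e k) : rewriteOp g e k (monomial β 1) = 0 := by
  have := (basisMonomials (Fin n) ℝ).constr_basis ℝ (fun β =>
    if h : β ∉ reducedExp n e k then
      monomial (β - Finsupp.single (exists_first_index h).choose e) 1 *
        g (exists_first_index h).choose
    else 0) β
  rw [coe_basisMonomials] at this
  rw [rewriteOp, this, dif_neg (by simpa using h)]

open scoped Classical in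
lemma rewriteOp_monomial (g : Fin n → MvPolynomial (Fin n) ℝ) {e k : ℕ} {β : Fin n →₀ ℕ}
    {i : Fin n} (hik : (i : ℕ) < k) (hi : e ≤ β i) (hlt : ∀ j < i, β j < e) :
    rewriteOp g e k (monomial β 1) = monomial (β - Finsupp.single i e) 1 * g i := by
  have h : β ∉ reducedExp n e k := fun h => absurd (h i hik) (not_lt.2 hi)
  have := (basisMonomials (Fin n) ℝ).constr_basis ℝ (fun β =>
    if h : β ∉ reducedExp n e k then
      monomial (β - Finsupp.single (exists_first_index h).choose e) 1 *
        g (exists_first_index h).choose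
    else 0) β
  rw [coe_basisMonomials] at this
  have hs := (exists_first_index h).choose_spec
  have he : (exists_first_index h).choose = i := by
    rcases lt_trichotomy (exists_first_index h).choose i with hc | hc | hc
    · exact absurd (hlt _ hc) (not_lt.2 hs.2.1)
    · exact hc
    · exact absurd (hs.2.2 _ hc) (not_lt.2 hi)
  rw [rewriteOp, this, dif_pos h, he]

/-- Trading `X_i^e` for `g i` does not raise the degree. The polynomials of bounded total degree are
thus invariant, which is the local finiteness required by `countable_not_bijective`. -/
lemma rewriteOp_mem (g : Fin n → MvPolynomial (Fin n) ℝ) {e : ℕ}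
    (hg : ∀ i, (g i).totalDegree ≤ e) (k d : ℕ) (x : MvPolynomial (Fin n) ℝ)
    (hx : x ∈ restrictTotalDegree (Fin n) ℝ d) :
    rewriteOp g e k x ∈ restrictTotalDegree (Fin n) ℝ d := by
  have hle : restrictTotalDegree (Fin n) ℝ d ≤
      (restrictTotalDegree (Fin n) ℝ d).comap (rewriteOp g e k) := by
    conv_lhs => rw [restrictTotalDegree, restrictSupport_eq_span]
    rw [Submodule.span_le]
    rintro _ ⟨β, hβ, rfl⟩
    simp only [SetLike.mem_coe, Submodule.mem_comap]
    by_cases h : β ∈ reducedExp n e k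
    · rw [rewriteOp_monomial_of_mem g h]; exact Submodule.zero_mem _
    · obtain ⟨i, hik, hi, hlt⟩ := exists_first_index h
      rw [rewriteOp_monomial g hik hi hlt, mem_restrictTotalDegree]
      refine (totalDegree_mul _ _).trans ?_
      rw [totalDegree_monomial _ one_ne_zero]
      have h1 : (β - Finsupp.single i e) + Finsupp.single i e = β :=
        tsub_add_cancel_of_le (by simpa using hi)
      have h2 : (β - Finsupp.single i e).degree + e = β.degree := by
        conv_rhs => rw [← h1]
        simp
      have h3 : β.degree ≤ d := by
        exact hβ
      have h4 := hg i
      have h5 : ((β - Finsupp.single i e).sum fun _ e => e) = (β - Finsupp.single i e).degree := rfl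
      rw [h5]
      omega
  exact hle hx

/-- The perturbed pure powers `X_i^e + t g_i`. -/
noncomputable def perturbedPow (g : Fin n → MvPolynomial (Fin n) ℝ) (e : ℕ) (t : ℝ) (i : Fin n) :
    MvPolynomial (Fin n) ℝ := X i ^ e + C t * g i

/-- In `x^β = x^(β - e·1_i) X_i^e` the operator replaces the factor `X_i^e` by `X_i^e + t g_i`, so
non-reduced monomials land in the ideal of the perturbed powers. -/
lemma one_add_rewriteOp_monomial (g : Fin n → MvPolynomial (Fin n) ℝ) {e k : ℕ} (t : ℝ)
    {β : Fin n →₀ ℕ} {i : Fin n} (hik : (i : ℕ) < k) (hi : e ≤ β i) (hlt : ∀ j < i, β j < e) :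
    (1 + t • rewriteOp g e k : Module.End ℝ (MvPolynomial (Fin n) ℝ)) (monomial β 1)
      = monomial (β - Finsupp.single i e) 1 * perturbedPow g e t i := by
  have h1 : (β - Finsupp.single i e) + Finsupp.single i e = β :=
    tsub_add_cancel_of_le (by simpa using hi)
  have h2 : (monomial β (1 : ℝ)) = monomial (β - Finsupp.single i e) 1 * X i ^ e := by
    rw [X_pow_eq_monomial, monomial_mul, h1, one_mul]
  rw [LinearMap.add_apply, LinearMap.smul_apply, rewriteOp_monomial g hik hi hlt, Module.End.one_apply,
    perturbedPow, mul_add, ← h2, smul_eq_C_mul]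
  ring

lemma one_add_rewriteOp_of_mem (g : Fin n → MvPolynomial (Fin n) ℝ) {e k : ℕ} (t : ℝ)
    {x : MvPolynomial (Fin n) ℝ} (hx : x ∈ restrictSupport ℝ (reducedExp n e k)) :
    (1 + t • rewriteOp g e k : Module.End ℝ (MvPolynomial (Fin n) ℝ)) x = x := by
  have hle : restrictSupport ℝ (reducedExp n e k) ≤ LinearMap.ker (rewriteOp g e k) := by
    rw [restrictSupport_eq_span, Submodule.span_le]
    rintro _ ⟨β, hβ, rfl⟩
    exact rewriteOp_monomial_of_mem g hβ
  have := hle hx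
  rw [LinearMap.mem_ker] at this
  simp [this]

lemma countable_bad_param (g : Fin n → MvPolynomial (Fin n) ℝ) {e : ℕ}
    (hg : ∀ i, (g i).totalDegree ≤ e) :
    {t : ℝ | ∃ k : ℕ, ¬ Function.Bijective
      (1 + t • rewriteOp g e k : Module.End ℝ (MvPolynomial (Fin n) ℝ))}.Countable := by
  have h : ∀ k, {t : ℝ | ¬ Function.Bijective
      (1 + t • rewriteOp g e k : Module.End ℝ (MvPolynomial (Fin n) ℝ))}.Countable := fun k =>
    countable_not_bijective _ (fun d => restrictTotalDegree (Fin n) ℝ d)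
      (rewriteOp_mem g hg k) fun x => ⟨x.totalDegree, (mem_restrictTotalDegree _ _ _).2 le_rfl⟩
  refine (countable_iUnion h).mono ?_
  rintro t ⟨k, hk⟩
  exact mem_iUnion.2 ⟨k, hk⟩

lemma isCompl_restrictSupport (s : Set (Fin n →₀ ℕ)) :
    IsCompl (restrictSupport ℝ s) (restrictSupport ℝ sᶜ) := by
  constructor
  · rw [Submodule.disjoint_def]
    intro x hx hx'
    rw [mem_restrictSupport_iff] at hx hx'
    rw [← support_eq_empty, ← Finset.coe_eq_empty]
    exact subset_empty_iff.1 fun b hb => hx' hb (hx hb)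
  · rw [codisjoint_iff_le_sup]
    intro x _
    rw [x.as_sum]
    refine Submodule.sum_mem _ fun b _ => ?_
    by_cases hb : b ∈ s
    · exact Submodule.mem_sup_left (by simp [hb])
    · exact Submodule.mem_sup_right (by simp [hb])

/-- For a generic parameter, the ideal of the perturbed powers is the image of the span of the
non-reduced monomials under the bijection `1 + t · rewriteOp`. -/
lemma ideal_perturbedPow_eq (g : Fin n → MvPolynomial (Fin n) ℝ) {e : ℕ} {t : ℝ}
    (ht : ∀ k : ℕ, Function.Bijective
      (1 + t • rewriteOp g e k : Module.End ℝ (MvPolynomial (Fin n) ℝ))) :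
    (Ideal.span (range (perturbedPow g e t))).restrictScalars ℝ =
      (restrictSupport ℝ (reducedExp n e n)ᶜ).map
        (1 + t • rewriteOp g e n : Module.End ℝ (MvPolynomial (Fin n) ℝ)) := by
  set F := perturbedPow g e t with hF
  set Q := (restrictSupport ℝ (reducedExp n e n)ᶜ).map
        (1 + t • rewriteOp g e n : Module.End ℝ (MvPolynomial (Fin n) ℝ)) with hQ
  have key : ∀ k : ℕ, ∀ i : Fin n, (i : ℕ) = k → ∀ q, q * F i ∈ Q := by
    intro k
    induction k using Nat.strong_induction_on with
    | _ k ih =>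
      intro i hik q
      -- Since the operator truncated at `k = i` is onto, `q` may be taken as the image of a
      -- monomial `x^β`. If `β` is reduced below `k`, then `q = x^β` and `q F_i` is the image of
      -- `x^β X_i^e` under the full operator, `i` being the first index with a large exponent.
      -- Otherwise `q` is a multiple of some `F_j` with `j < i`, hence so is `q F_i`, and the
      -- induction hypothesis covers it.
      have hle : (⊤ : Submodule ℝ (MvPolynomial (Fin n) ℝ)) ≤
          Q.comap (LinearMap.mulRight ℝ (F i)) := by
        rw [← LinearMap.range_eq_top.2 (ht k).2, LinearMap.range_eq_map,
          ← (basisMonomials (Fin n) ℝ).span_eq, Submodule.map_span, Submodule.span_le]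
        rintro _ ⟨_, ⟨β, rfl⟩, rfl⟩
        rw [coe_basisMonomials]
        simp only [SetLike.mem_coe, Submodule.mem_comap, LinearMap.mulRight_apply]
        by_cases h : β ∈ reducedExp n e k
        · rw [one_add_rewriteOp_of_mem g t (by simp [h])]
          have h1 := one_add_rewriteOp_monomial g (e := e) (k := n) t
            (β := β + Finsupp.single i e) (i := i) i.2 (by simp) (by
              intro j hj
              simpa [Finsupp.single_apply, hj.ne'] using h j (by rw [← hik]; exact hj))
          rw [add_tsub_cancel_right] at h1
          rw [← h1]
          refine Submodule.mem_map_of_mem ?_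
          simp only [monomial_mem_restrictSupport]
          left
          intro hcon
          have := hcon i i.2
          simp at this
        · obtain ⟨j, hjk, hj, hlt⟩ := exists_first_index h
          rw [one_add_rewriteOp_monomial g t hjk hj hlt, mul_right_comm]
          exact ih j hjk j rfl _
      exact hle (show q ∈ ⊤ from trivial)
  apply le_antisymm
  · intro x hx
    rw [Submodule.restrictScalars_mem, Ideal.mem_span_range_iff_exists_fun] at hx
    obtain ⟨c, rfl⟩ := hx
    exact Submodule.sum_mem _ fun i _ => key i i rfl _
  · rw [hQ, restrictSupport_eq_span, Submodule.map_span, Submodule.span_le]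
    rintro _ ⟨_, ⟨β, hβ, rfl⟩, rfl⟩
    obtain ⟨i, hik, hi, hlt⟩ := exists_first_index hβ
    rw [one_add_rewriteOp_monomial g t hik hi hlt]
    exact Ideal.mul_mem_left _ _ (Ideal.subset_span ⟨i, rfl⟩)

/-- Each of the `n` exponents ranges freely over `e` values. For odd `e` this dimension is odd,
which is what forces a real common eigenvector. -/
lemma finrank_reducedExp (n e : ℕ) :
    Module.finrank ℝ (restrictSupport ℝ (reducedExp n e n)) = e ^ n := by
  rw [Module.finrank_eq_nat_card_basis (basisRestrictSupport ℝ (reducedExp n e n))]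
  have E : (reducedExp n e n) ≃ (Fin n → Fin e) :=
    { toFun := fun β i => ⟨β.1 i, β.2 i i.2⟩
      invFun := fun f => ⟨Finsupp.equivFunOnFinite.symm fun i => f i, fun i _ => by simp⟩
      left_inv := fun β => by ext; simp
      right_inv := fun f => by ext; simp }
  rw [Nat.card_congr E]
  simp

/-- For `e` odd and `deg g_i ≤ e`, the system `X_i^e + t g_i = 0` has a real solution for all but
countably many `t`. -/
theorem exists_zero_perturbedPow (g : Fin n → MvPolynomial (Fin n) ℝ) {e : ℕ} (he : Odd e) {t : ℝ}
    (ht : ∀ k : ℕ, Function.Bijective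
      (1 + t • rewriteOp g e k : Module.End ℝ (MvPolynomial (Fin n) ℝ))) :
    ∃ a : Fin n → ℝ, ∀ i, eval a (perturbedPow g e t i) = 0 := by
  set I := Ideal.span (range (perturbedPow g e t)) with hI
  have hIQ := ideal_perturbedPow_eq g ht
  rw [← hI] at hIQ
  let Ψ : MvPolynomial (Fin n) ℝ ≃ₗ[ℝ] MvPolynomial (Fin n) ℝ := LinearEquiv.ofBijective _ (ht n)
  let q1 : (MvPolynomial (Fin n) ℝ ⧸ restrictSupport ℝ (reducedExp n e n)ᶜ) ≃ₗ[ℝ]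
      (MvPolynomial (Fin n) ℝ ⧸ I.restrictScalars ℝ) := Submodule.Quotient.equiv _ _ Ψ hIQ.symm
  let q2 : (MvPolynomial (Fin n) ℝ ⧸ restrictSupport ℝ (reducedExp n e n)ᶜ) ≃ₗ[ℝ]
      restrictSupport ℝ (reducedExp n e n) :=
    Submodule.quotientEquivOfIsCompl _ _ (isCompl_restrictSupport _).symm
  let V := MvPolynomial (Fin n) ℝ ⧸ I.restrictScalars ℝ
  have hfr : Module.finrank ℝ V = e ^ n := by
    rw [← finrank_reducedExp, ← LinearEquiv.finrank_eq (q1.symm.trans q2)]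
  have hodd : Odd (e ^ n) := he.pow
  have : FiniteDimensional ℝ V := Module.finite_of_finrank_pos (by rw [hfr]; exact hodd.pos)
  have hmul : ∀ i : Fin n, I.restrictScalars ℝ ≤
      (I.restrictScalars ℝ).comap (LinearMap.mulLeft ℝ (X i : MvPolynomial (Fin n) ℝ)) :=
    fun i x hx => Ideal.mul_mem_left I _ hx
  let T : Fin n → Module.End ℝ V := fun i => (I.restrictScalars ℝ).mapQ _ _ (hmul i)
  have hTmk : ∀ i x, T i (Submodule.Quotient.mk x) = Submodule.Quotient.mk (X i * x) :=
    fun _ _ => rfl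
  -- On a common eigenvector of the multiplications by the variables, with eigenvalues `a`, every
  -- polynomial `q` acts as the scalar `q(a)`. The generators of the ideal act as zero, so `a` is a
  -- common zero.
  obtain ⟨v, hv, hT⟩ := exists_common_eigenvector (e ^ n) hfr hodd T (by
    intro i j
    refine LinearMap.ext fun x => ?_
    obtain ⟨x, rfl⟩ := Submodule.Quotient.mk_surjective _ x
    rw [Module.End.mul_apply, Module.End.mul_apply, hTmk, hTmk, hTmk, hTmk, mul_left_comm])
  choose a ha using hT
  obtain ⟨v, rfl⟩ := Submodule.Quotient.mk_surjective _ v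
  have hev : ∀ q : MvPolynomial (Fin n) ℝ, (Submodule.Quotient.mk (q * v) : V) =
      eval a q • (Submodule.Quotient.mk v : V) := by
    intro q
    induction q using MvPolynomial.induction_on with
    | C r =>
      rw [eval_C, ← Submodule.Quotient.mk_smul, smul_eq_C_mul]
    | add p q hp hq => rw [add_mul, Submodule.Quotient.mk_add, hp, hq, map_add, add_smul]
    | mul_X p i hp =>
      have h1 : (Submodule.Quotient.mk (p * X i * v) : V) = T i (Submodule.Quotient.mk (p * v)) := by
        rw [hTmk, mul_comm p, mul_assoc]
      rw [h1, hp, map_smul, ha, smul_smul, map_mul, eval_X]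
  refine ⟨a, fun i => ?_⟩
  have h0 : (Submodule.Quotient.mk (perturbedPow g e t i * v) : V) = 0 :=
    (Submodule.Quotient.mk_eq_zero _).2
      (Ideal.mul_mem_right _ I (Ideal.subset_span ⟨i, rfl⟩))
  rw [hev] at h0
  exact (smul_eq_zero.1 h0).resolve_right hv

lemma eval_smul_of_isHomogeneous {σ : Type*} {f : MvPolynomial σ ℝ} {e : ℕ}
    (hf : f.IsHomogeneous e) (c : ℝ) (x : σ → ℝ) : eval (c • x) f = c ^ e * eval x f := by
  rw [eval_eq, eval_eq, Finset.mul_sum]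
  refine Finset.sum_congr rfl fun b hb => ?_
  have h : b.degree = e := by
    by_contra hne
    exact mem_support_iff.1 hb (hf.coeff_eq_zero hne)
  have h2 : ∏ i ∈ b.support, c ^ b i = c ^ e := by
    rw [Finset.prod_pow_eq_pow_sum, ← h]; rfl
  simp only [Pi.smul_apply, smul_eq_mul, mul_pow, Finset.prod_mul_distrib, h2]
  ring

lemma totalDegree_aeval_cons_le {f : MvPolynomial (Fin (n + 1)) ℝ} {e : ℕ}
    (hf : f.IsHomogeneous e) :
    (aeval (Fin.cons 1 X : Fin (n + 1) → MvPolynomial (Fin n) ℝ) f).totalDegree ≤ e := by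
  rw [aeval_def, eval₂_eq]
  refine totalDegree_finsetSum_le fun b hb => ?_
  have h : b.degree = e := by
    by_contra hne
    exact mem_support_iff.1 hb (hf.coeff_eq_zero hne)
  refine (totalDegree_mul _ _).trans ?_
  rw [algebraMap_eq, totalDegree_C, zero_add]
  refine (totalDegree_finsetProd _ _).trans ?_
  rw [← h]
  refine Finset.sum_le_sum fun j _ => ?_
  refine (totalDegree_pow _ _).trans ?_
  refine (Nat.mul_le_mul_left _ ?_).trans_eq (mul_one _)
  refine Fin.cases ?_ (fun i => ?_) j
  · simp
  · simp

/-- `n` real forms of the same odd degree in `n + 1` variables have a common nontrivial zero. -/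
theorem exists_common_zero_forms (f : Fin n → MvPolynomial (Fin (n + 1)) ℝ) {e : ℕ} (he : Odd e)
    (hf : ∀ i, (f i).IsHomogeneous e) : ∃ x : Fin (n + 1) → ℝ, x ≠ 0 ∧ ∀ i, eval x (f i) = 0 := by
  -- Dehomogenize by setting the first variable to one. A zero `a` of all `X_i^e + t g_i` gives
  -- `f_i(1, a) = -a_i^e / t`, which becomes at most `1 / t` in absolute value once `(1, a)` is
  -- scaled to sup norm one. As only countably many `t` are excluded, `t` can be arbitrarily large,
  -- and the minimum of `∑ |f_i|` on the sphere is zero.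
  set g : Fin n → MvPolynomial (Fin n) ℝ := fun i =>
    aeval (Fin.cons 1 X : Fin (n + 1) → MvPolynomial (Fin n) ℝ) (f i) with hg
  have heval : ∀ (a : Fin n → ℝ) i, eval a (g i) = eval (Fin.cons 1 a : Fin (n + 1) → ℝ) (f i) := by
    intro a i
    rw [hg]
    simp only
    rw [← coe_aeval_eq_eval, ← coe_aeval_eq_eval, RingHom.coe_coe, RingHom.coe_coe,
      ← AlgHom.comp_apply, comp_aeval]
    congr 2
    funext j
    refine Fin.cases ?_ (fun i => ?_) j
    · simp
    · simp
  have hcount := countable_bad_param g fun i => totalDegree_aeval_cons_le (hf i)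
  set S := Metric.sphere (0 : Fin (n + 1) → ℝ) 1
  have hcont : Continuous fun x : Fin (n + 1) → ℝ => ∑ i, |eval x (f i)| :=
    continuous_finsetSum _ fun i _ => (MvPolynomial.continuous_eval (f i)).abs
  have hSne : S.Nonempty := NormedSpace.sphere_nonempty.2 zero_le_one
  obtain ⟨y, hyS, hy⟩ := (isCompact_sphere (0 : Fin (n + 1) → ℝ) 1).exists_isMinOn hSne
    hcont.continuousOn
  have hsmall : ∀ k : ℕ, ∑ i, |eval y (f i)| ≤ n * (1 / ((k : ℝ) + 1)) := by
    intro k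
    obtain ⟨t, htk, ht⟩ := (hcount.dense_compl ℝ).exists_mem_open (isOpen_Ioi (a := (k : ℝ) + 1))
      ⟨(k : ℝ) + 1 + 1, lt_add_one ((k : ℝ) + 1)⟩
    simp only [mem_compl_iff, mem_ofPred_eq, not_exists, not_not] at htk
    obtain ⟨a, ha⟩ := exists_zero_perturbedPow g he htk
    set z : Fin (n + 1) → ℝ := Fin.cons 1 a with hz
    have hz1 : 1 ≤ ‖z‖ := by simpa [hz] using norm_le_pi_norm z 0
    have hz0 : 0 < ‖z‖ := by linarith
    have hyz : ‖z‖⁻¹ • z ∈ S := by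
      simp [S, norm_smul, hz0.ne']
    refine (hy hyz).trans ?_
    have hk : (0 : ℝ) < (k : ℝ) + 1 := by positivity
    have ht' : (k : ℝ) + 1 < t := ht
    have ht0 : 0 < t := hk.trans ht'
    calc ∑ i, |eval (‖z‖⁻¹ • z) (f i)| ≤ ∑ i : Fin n, 1 / ((k : ℝ) + 1) := by
          refine Finset.sum_le_sum fun i _ => ?_
          have h1 := ha i
          rw [perturbedPow, map_add, map_mul, eval_C, heval, map_pow, eval_X] at h1
          have h2 : eval z (f i) = -(a i ^ e) / t := by
            field_simp
            linarith
          rw [eval_smul_of_isHomogeneous (hf i), h2]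
          have h3 : |a i| ≤ ‖z‖ := by simpa [hz] using norm_le_pi_norm z i.succ
          have h4 : |‖z‖⁻¹ ^ e * (-(a i ^ e) / t)| = (|a i| / ‖z‖) ^ e / t := by
            rw [abs_mul, abs_div, abs_neg, abs_pow, abs_pow, abs_inv, abs_norm, abs_of_pos ht0,
              div_pow, inv_pow]
            ring
          rw [h4]
          have h5 : (|a i| / ‖z‖) ^ e ≤ 1 :=
            pow_le_one₀ (by positivity) ((div_le_one hz0).2 h3)
          gcongr
      _ = n * (1 / ((k : ℝ) + 1)) := by simp
  have hle : ∑ i, |eval y (f i)| ≤ 0 := by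
    have hlim := (tendsto_one_div_add_atTop_nhds_zero_nat (𝕜 := ℝ)).const_mul (n : ℝ)
    rw [mul_zero] at hlim
    exact ge_of_tendsto' hlim hsmall
  refine ⟨y, ?_, fun i => ?_⟩
  · rintro rfl
    simp at hyS
  · have h1 := Finset.single_le_sum (f := fun i => |eval y (f i)|) (fun i _ => abs_nonneg _)
      (Finset.mem_univ i)
    exact abs_nonpos_iff.1 (h1.trans hle)

/-- On the unit sphere the odd part of a polynomial agrees with a form of odd degree. -/
lemma exists_form_eq_odd_part {m : ℕ} (P : MvPolynomial (Fin m) ℝ) {D : ℕ} (hD : Odd D)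
    (hP : P.totalDegree ≤ D) : ∃ Q : MvPolynomial (Fin m) ℝ, Q.IsHomogeneous D ∧
      ∀ x : Fin m → ℝ, ∑ j, x j ^ 2 = 1 → eval x Q = (eval x P - eval (-x) P) / 2 := by
  classical
  -- The odd components are padded to degree `D` by powers of `∑ x_j²`, which is one on the sphere;
  -- `D - k` is even.
  refine ⟨∑ k ∈ (Finset.range (D + 1)).filter Odd,
    homogeneousComponent k P * (∑ j, X j ^ 2) ^ ((D - k) / 2), ?_, ?_⟩
  · refine IsHomogeneous.sum _ _ _ fun k hk => ?_
    rw [Finset.mem_filter, Finset.mem_range] at hk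
    have h1 : (∑ j : Fin m, (X j : MvPolynomial (Fin m) ℝ) ^ 2).IsHomogeneous 2 :=
      IsHomogeneous.sum _ _ _ fun j _ => by simpa using isHomogeneous_X_pow j 2
    have h2 := (homogeneousComponent_isHomogeneous k P).mul (h1.pow ((D - k) / 2))
    have h3 : k + 2 * ((D - k) / 2) = D := by
      obtain ⟨a, ha⟩ := hD
      obtain ⟨b, hb⟩ := hk.2
      omega
    rwa [h3] at h2
  · intro x hx
    have hsum : ∑ k ∈ Finset.range (D + 1), homogeneousComponent k P = P := by
      conv_rhs => rw [← sum_homogeneousComponent P]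
      refine (Finset.sum_subset (Finset.range_mono (by omega)) fun k _ hk => ?_).symm
      exact homogeneousComponent_eq_zero _ _ (by simpa using hk)
    have h1 : ∀ k, eval (-x) (homogeneousComponent k P)
        = (-1) ^ k * eval x (homogeneousComponent k P) := by
      intro k
      rw [← eval_smul_of_isHomogeneous (homogeneousComponent_isHomogeneous k P), neg_one_smul]
    have e1 : eval x P = ∑ k ∈ Finset.range (D + 1), eval x (homogeneousComponent k P) := by
      conv_lhs => rw [← hsum]
      rw [map_sum]
    have e2 : eval (-x) P
        = ∑ k ∈ Finset.range (D + 1), (-1) ^ k * eval x (homogeneousComponent k P) := by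
      conv_lhs => rw [← hsum]
      rw [map_sum]
      exact Finset.sum_congr rfl fun k _ => h1 k
    rw [e1, e2, ← Finset.sum_sub_distrib, map_sum, Finset.sum_filter, Finset.sum_div]
    refine Finset.sum_congr rfl fun k _ => ?_
    split_ifs with hk
    · simp only [map_mul, map_pow, map_sum, eval_X, hx, one_pow, hk.neg_one_pow]
      ring
    · rw [(Nat.not_odd_iff_even.1 hk).neg_one_pow]
      ring

/-- The Borsuk–Ulam theorem: an odd continuous map from the unit sphere of `ℝ^(n+1)` to `ℝ^n`
vanishes somewhere. -/
theorem borsuk_ulam (f : EuclideanSpace ℝ (Fin (n + 1)) → Fin n → ℝ)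
    (hf : ContinuousOn f (Metric.sphere 0 1))
    (hodd : ∀ x ∈ Metric.sphere (0 : EuclideanSpace ℝ (Fin (n + 1))) 1, f (-x) = -f x) :
    ∃ x ∈ Metric.sphere (0 : EuclideanSpace ℝ (Fin (n + 1))) 1, f x = 0 := by
  by_contra! hne
  set S := Metric.sphere (0 : EuclideanSpace ℝ (Fin (n + 1))) 1 with hS
  have hSc : IsCompact S := isCompact_sphere _ _
  have hSne : S.Nonempty := NormedSpace.sphere_nonempty.2 zero_le_one
  obtain ⟨x₀, hx₀, hmin⟩ := hSc.exists_isMinOn hSne hf.norm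
  set δ := ‖f x₀‖ with hδ
  have hδ0 : 0 < δ := norm_pos_iff.2 (hne x₀ hx₀)
  have : CompactSpace S := isCompact_iff_compactSpace.1 hSc
  let coord : Fin (n + 1) → C(S, ℝ) := fun j => ⟨fun x => x.1 j, by fun_prop⟩
  have happ : ∀ (P : MvPolynomial (Fin (n + 1)) ℝ) (x : S), aeval coord P x = eval (x : _).1.ofLp P := by
    intro P x
    induction P using MvPolynomial.induction_on with
    | C r => simp
    | add p q hp hq => simp [hp, hq]
    | mul_X p i hp => simp [hp, coord]
  have hsep : (aeval coord : MvPolynomial (Fin (n + 1)) ℝ →ₐ[ℝ] C(S, ℝ)).range.SeparatesPoints := by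
    intro x y hxy
    have : ∃ j, x.1 j ≠ y.1 j := by
      by_contra! h
      exact hxy (Subtype.ext (by ext j; exact h j))
    obtain ⟨j, hj⟩ := this
    exact ⟨_, ⟨coord j, ⟨X j, by simp⟩, rfl⟩, hj⟩
  have hP : ∀ i : Fin n, ∃ P : MvPolynomial (Fin (n + 1)) ℝ, ∀ x ∈ S, |eval x.ofLp P - f x i| < δ := by
    intro i
    have hc : ContinuousOn (fun x => f x i) S := (continuous_apply i).comp_continuousOn hf
    obtain ⟨⟨g, P, rfl⟩, hg⟩ := ContinuousMap.exists_mem_subalgebra_near_continuousMap_of_separatesPoints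
      _ hsep ⟨_, hc.domRestrict⟩ δ hδ0
    refine ⟨P, fun x hx => ?_⟩
    have h1 := (ContinuousMap.norm_coe_le_norm _ (⟨x, hx⟩ : S)).trans_lt hg
    have h2 := happ P ⟨x, hx⟩
    rw [← h2]
    simpa using h1
  choose P hP using hP
  -- A common odd bound for the degrees, so that all the odd parts become forms of the same degree.
  set D := 2 * (∑ i, (P i).totalDegree) + 1 with hD
  have hdeg : ∀ i, (P i).totalDegree ≤ D := fun i => by
    have := Finset.single_le_sum (f := fun i => (P i).totalDegree) (fun _ _ => Nat.zero_le _)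
      (Finset.mem_univ i)
    omega
  have hDodd : Odd D := ⟨_, rfl⟩
  choose Q hQ hQe using fun i => exists_form_eq_odd_part (P i) hDodd (hdeg i)
  obtain ⟨y, hy, hy0⟩ := exists_common_zero_forms Q hDodd hQ
  set z : EuclideanSpace ℝ (Fin (n + 1)) := WithLp.toLp 2 y with hz
  have hz0 : z ≠ 0 := fun h => hy (by simpa [hz] using congrArg WithLp.ofLp h)
  set x := ‖z‖⁻¹ • z with hx
  have hxS : x ∈ S := by simp [hS, hx, norm_smul, hz0]
  have hxsum : ∑ j, x.ofLp j ^ 2 = 1 := by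
    have h1 : ‖x‖ = 1 := by simpa [hS] using hxS
    have h2 := EuclideanSpace.real_norm_sq_eq x
    rw [h1] at h2
    simpa using h2.symm
  -- At a common zero of the odd parts, `P i` takes the same value at `x` and `-x`, within `δ` of
  -- both `f x i` and `-f x i`. Hence `|f x i| < δ`, although `δ` is the minimum of `‖f‖`.
  have hlt : ‖f x‖ < δ := by
    rw [pi_norm_lt_iff hδ0]
    intro i
    have h0 : eval x.ofLp (Q i) = 0 := by
      have : x.ofLp = ‖z‖⁻¹ • y := rfl
      rw [this, eval_smul_of_isHomogeneous (hQ i), hy0, mul_zero]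
    rw [hQe i _ hxsum] at h0
    have hnS : -x ∈ S := by simpa [hS] using hxS
    have h1 := abs_lt.1 (hP i x hxS)
    have h2 := abs_lt.1 (hP i (-x) hnS)
    rw [hodd x hxS, WithLp.ofLp_neg, Pi.neg_apply] at h2
    rw [Real.norm_eq_abs, abs_lt]
    constructor <;> linarith
  exact absurd (hmin hxS) (not_le.2 hlt)

end BorsukUlam

/-! ### Luxemburg functionals along a ray -/

section Luxemburg

variable {f : ℝ → ℝ} {b : ℝ} {A : Set ℝ}

/-- Here `f c` stands for the modular of `c • u`. The set `A` need only lie between `{f t⁻¹ < 1}`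
and `{f t⁻¹ ≤ 1}`, which covers the strict inequality in `K` and the weak one in `k` together. The
growth bound gives `f t⁻¹ ≤ r^b` for every `r > 1`, and `r` tends to one. -/
lemma luxemburg_le_iff (hf0 : ∀ c, 0 ≤ f c)
    (h1 : ∀ c a, 0 ≤ c → 0 ≤ a → a ≤ 1 → f (a * c) ≤ a * f c)
    (h2 : ∀ c a, 0 ≤ c → 1 ≤ a → f (a * c) ≤ a ^ b * f c)
    (hA : ∀ t, 0 < t → f t⁻¹ < 1 → t ∈ A) (hA' : ∀ t ∈ A, 0 < t ∧ f t⁻¹ ≤ 1)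
    {t : ℝ} (ht : 0 < t) : sInf A ≤ t ↔ f t⁻¹ ≤ 1 := by
  have hbdd : BddBelow A := ⟨0, fun t ht => (hA' t ht).1.le⟩
  have hscale : ∀ r, 1 < r → (r * t)⁻¹ = r⁻¹ * t⁻¹ := fun r _ => mul_inv _ _
  constructor
  · intro h
    have hne : A.Nonempty := by
      refine ⟨f 1 + 1, hA _ (by linarith [hf0 1]) ?_⟩
      have hp : 0 < f 1 + 1 := by linarith [hf0 1]
      have := h1 1 (f 1 + 1)⁻¹ zero_le_one (by positivity)
        (inv_le_one_of_one_le₀ (by linarith [hf0 1]))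
      rw [mul_one] at this
      refine this.trans_lt ?_
      rw [inv_mul_lt_one₀ hp]
      linarith
    have h3 : ∀ r : ℝ, 1 < r → f t⁻¹ ≤ r ^ b := by
      intro r hr
      have hr0 : 0 < r := by linarith
      obtain ⟨q, hq, hqr⟩ := exists_lt_of_csInf_lt hne (h.trans_lt (lt_mul_of_one_lt_left ht hr))
      obtain ⟨hq0, hq1⟩ := hA' q hq
      have h4 : f (r * t)⁻¹ ≤ 1 := by
        have := h1 q⁻¹ (q / (r * t)) (by positivity) (by positivity)
          ((div_le_one (by positivity)).2 hqr.le)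
        have e : q / (r * t) * q⁻¹ = (r * t)⁻¹ := by field_simp
        rw [e] at this
        refine this.trans (mul_le_one₀ ((div_le_one (by positivity)).2 hqr.le) (hf0 _) hq1)
      have h5 := h2 (r * t)⁻¹ r (by positivity) hr.le
      have e : r * (r * t)⁻¹ = t⁻¹ := by field_simp
      rw [e] at h5
      exact h5.trans (mul_le_of_le_one_right (by positivity) h4)
    have hlim : Tendsto (fun r : ℝ => r ^ b) (𝓝[>] 1) (𝓝 1) := by
      have := (Real.continuousAt_rpow_const 1 b (Or.inl one_ne_zero)).tendsto
      rw [Real.one_rpow] at this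
      exact this.mono_left nhdsWithin_le_nhds
    exact ge_of_tendsto hlim (by filter_upwards [self_mem_nhdsWithin] with r hr using h3 r hr)
  · intro h
    refine le_of_forall_gt_imp_ge_of_dense fun q hq => ?_
    refine csInf_le hbdd (hA q (ht.trans hq) ?_)
    have hq0 := ht.trans hq
    have hlt : t / q < 1 := (div_lt_one hq0).2 hq
    have := h1 t⁻¹ (t / q) (by positivity) (by positivity) hlt.le
    have e : t / q * t⁻¹ = q⁻¹ := by field_simp
    rw [e] at this
    exact (this.trans (mul_le_of_le_one_right (by positivity) h)).trans_lt hlt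

/-- If the value at the infimum were below one, the growth bound would allow dividing `sInf A` by
some `r > 1`. The infimum is positive because `f t⁻¹ ≥ f 1 / t` for small `t`. -/
lemma luxemburg_spec (hf0 : ∀ c, 0 ≤ f c)
    (h1 : ∀ c a, 0 ≤ c → 0 ≤ a → a ≤ 1 → f (a * c) ≤ a * f c)
    (h2 : ∀ c a, 0 ≤ c → 1 ≤ a → f (a * c) ≤ a ^ b * f c)
    (hA : ∀ t, 0 < t → f t⁻¹ < 1 → t ∈ A) (hA' : ∀ t ∈ A, 0 < t ∧ f t⁻¹ ≤ 1)
    (hne : f 1 ≠ 0) : 0 < sInf A ∧ f (sInf A)⁻¹ = 1 := by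
  have hiff := fun {t : ℝ} (ht : 0 < t) => luxemburg_le_iff hf0 h1 h2 hA hA' ht
  have hf1 : 0 < f 1 := lt_of_le_of_ne (hf0 1) hne.symm
  have hpos : 0 < sInf A := by
    by_contra hcon
    have ht : 0 < min (f 1 / 2) 1 := by positivity
    have h3 := (hiff ht).1 ((not_lt.1 hcon).trans ht.le)
    have h4 := h1 (min (f 1 / 2) 1)⁻¹ (min (f 1 / 2) 1) (by positivity) ht.le (min_le_right _ _)
    rw [mul_inv_cancel₀ ht.ne'] at h4
    have h5 := mul_le_of_le_one_right ht.le h3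
    have h6 := min_le_left (f 1 / 2) 1
    linarith
  refine ⟨hpos, le_antisymm ((hiff hpos).1 le_rfl) ?_⟩
  by_contra hcon
  rw [not_le] at hcon
  have hlim : Tendsto (fun r : ℝ => r ^ b * f (sInf A)⁻¹) (𝓝[>] 1) (𝓝 (1 * f (sInf A)⁻¹)) := by
    have := (Real.continuousAt_rpow_const 1 b (Or.inl one_ne_zero)).tendsto
    rw [Real.one_rpow] at this
    exact (this.mono_left nhdsWithin_le_nhds).mul_const _
  rw [one_mul] at hlim
  obtain ⟨r, hr, hr1⟩ := ((hlim.eventually_lt_const hcon).and self_mem_nhdsWithin).exists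
  have hr1 : 1 < r := hr1
  have hr0 : 0 < r := by linarith
  have h3 := (h2 (sInf A)⁻¹ r (by positivity) hr1.le).trans hr.le
  have e : r * (sInf A)⁻¹ = (sInf A / r)⁻¹ := by field_simp
  rw [e] at h3
  have h4 := (hiff (by positivity)).2 h3
  exact absurd (div_lt_self hpos hr1) (not_lt.2 h4)

end Luxemburg

/-! ### The modulars `rho` and `sig`, and the norms `K` and `k` they define -/

namespace Data

variable {N : ℕ} (D : Data N)

/-- An upper bound of the exponent. -/
noncomputable def pmax : ℝ := D.sup_p.choose

lemma p_le_pmax (x y : Eu N) : D.p x y ≤ D.pmax := D.sup_p.choose_spec.2 x y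

lemma one_lt_pmax : 1 < D.pmax := (D.one_lt_p 0 0).trans_le (D.p_le_pmax 0 0)

lemma pmax_pos : 0 < D.pmax := one_pos.trans D.one_lt_pmax

lemma one_lt_pbar (x : Eu N) : 1 < D.pbar x := D.one_lt_p x x

lemma pbar_pos (x : Eu N) : 0 < D.pbar x := D.p_pos x x

lemma pbar_le_pmax (x : Eu N) : D.pbar x ≤ D.pmax := D.p_le_pmax x x

lemma continuous_pbar : Continuous D.pbar :=
  D.continuous_p.comp (continuous_id.prodMk continuous_id)

lemma measurable_pbar : Measurable D.pbar := D.continuous_pbar.measurable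

lemma measurable_p : Measurable (fun z : Eu N × Eu N => D.p z.1 z.2) := D.continuous_p.measurable

lemma X_smul (c : ℝ) (u : D.X) : ((c • u : D.X) : Eu N → ℝ) =ᵐ[volume] fun x => c * u x :=
  AEEqFun.coeFn_smul c (u.1 : Eu N →ₘ[volume] ℝ)

lemma X_sub (u v : D.X) : ((u - v : D.X) : Eu N → ℝ) =ᵐ[volume] fun x => u x - v x :=
  AEEqFun.coeFn_sub (u.1 : Eu N →ₘ[volume] ℝ) v.1

lemma X_ext {u v : D.X} (h : (u : Eu N → ℝ) =ᵐ[volume] v) : u = v := Subtype.ext (AEEqFun.ext h)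

lemma X_ae_zero (u : D.X) : ∀ᵐ x, x ∉ D.Ω → u x = 0 := u.2.2.2

lemma X_modular_lt_top (u : D.X) : gagliardoModular D.s D.p u < ∞ := u.2.2.1

lemma X_pbarModular_lt_top (u : D.X) : D.pbarModular u < ∞ := u.2.1

/-- The element of `X` given by a function. -/
noncomputable def mkX (f : Eu N → ℝ) (hf : Measurable f) (h1 : D.pbarModular f < ∞)
    (h2 : gagliardoModular D.s D.p f < ∞) (h3 : ∀ᵐ x, x ∉ D.Ω → f x = 0) : D.X :=
  ⟨AEEqFun.mk f hf.aestronglyMeasurable, by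
    have h : ((AEEqFun.mk f hf.aestronglyMeasurable : Eu N →ₘ[volume] ℝ) : Eu N → ℝ)
      =ᵐ[volume] f := AEEqFun.coeFn_mk _ _
    refine ⟨?_, ?_, ?_⟩
    · rwa [D.pbarModular_congr h]
    · rwa [D.modular_congr h]
    · filter_upwards [h, h3] with x hx h3 hxΩ
      rw [hx, h3 hxΩ]⟩

lemma mkX_coe (f : Eu N → ℝ) (hf : Measurable f) (h1 : D.pbarModular f < ∞)
    (h2 : gagliardoModular D.s D.p f < ∞) (h3 : ∀ᵐ x, x ∉ D.Ω → f x = 0) :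
    (D.mkX f hf h1 h2 h3 : Eu N → ℝ) =ᵐ[volume] f := AEEqFun.coeFn_mk _ _

/-- The Gagliardo modular as a real number. -/
noncomputable def rho (u : D.X) : ℝ := (gagliardoModular D.s D.p u).toReal

/-- The modular of `L^{p̄}(Ω)` with weight `1 / p̄`. -/
noncomputable def sig (u : D.X) : ℝ := ∫ x in D.Ω, |u x| ^ D.pbar x / D.pbar x

lemma rho_nonneg (u : D.X) : 0 ≤ D.rho u := ENNReal.toReal_nonneg

lemma sig_nonneg (u : D.X) : 0 ≤ D.sig u :=
  integral_nonneg fun x => div_nonneg (by positivity) (D.pbar_pos x).le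

lemma ofReal_rho (u : D.X) : ENNReal.ofReal (D.rho u) = gagliardoModular D.s D.p u :=
  ENNReal.ofReal_toReal (D.X_modular_lt_top u).ne

lemma abs_mul_rpow_le_of_le_one {q a : ℝ} (hq : 1 ≤ q) (ha : 0 ≤ a) (ha1 : a ≤ 1) (x : ℝ) :
    |a * x| ^ q ≤ a * |x| ^ q := by
  rw [abs_mul, abs_of_nonneg ha, Real.mul_rpow ha (abs_nonneg _)]
  refine mul_le_mul_of_nonneg_right ?_ (by positivity)
  simpa using Real.rpow_le_rpow_of_exponent_ge' ha ha1 zero_le_one hq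

lemma abs_mul_rpow_le_of_one_le {q B a : ℝ} (hq : 0 ≤ q) (hB : q ≤ B) (ha : 1 ≤ a) (x : ℝ) :
    |a * x| ^ q ≤ a ^ B * |x| ^ q := by
  have := abs_mul_rpow_le hq hB a x
  rwa [abs_of_nonneg (zero_le_one.trans ha), max_eq_right ha] at this

lemma modular_mul_le_of_one_le (u : Eu N → ℝ) {a : ℝ} (ha : 1 ≤ a) :
    gagliardoModular D.s D.p (fun x => a * u x)
      ≤ ENNReal.ofReal (a ^ D.pmax) * gagliardoModular D.s D.p u := by
  unfold gagliardoModular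
  rw [← lintegral_const_mul' _ _ ENNReal.ofReal_ne_top]
  refine lintegral_mono fun z => ?_
  have ha0 : 0 ≤ a := zero_le_one.trans ha
  simp only
  rw [← ENNReal.ofReal_mul (by positivity)]
  refine ENNReal.ofReal_le_ofReal ?_
  unfold gagliardoDensity
  have hp := D.p_pos z.1 z.2
  rw [← mul_sub, ← mul_div_assoc]
  exact div_le_div_of_nonneg_right
    (abs_mul_rpow_le_of_one_le hp.le (D.p_le_pmax _ _) ha _) (by positivity)

lemma rho_smul_le {u : D.X} {a : ℝ} (ha : 0 ≤ a) (ha1 : a ≤ 1) : D.rho (a • u) ≤ a * D.rho u := by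
  have h := D.modular_mul_le (D.X_measurable u) ha ha1
  rw [← D.modular_congr (D.X_smul a u), ← ofReal_rho, ← ofReal_rho, ← ENNReal.ofReal_mul ha] at h
  exact (ENNReal.ofReal_le_ofReal_iff (mul_nonneg ha (D.rho_nonneg u))).1 h

lemma rho_smul_le' {u : D.X} {a : ℝ} (ha : 1 ≤ a) : D.rho (a • u) ≤ a ^ D.pmax * D.rho u := by
  have ha0 : 0 ≤ a := zero_le_one.trans ha
  have h := D.modular_mul_le_of_one_le u ha
  rw [← D.modular_congr (D.X_smul a u), ← ofReal_rho, ← ofReal_rho,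
    ← ENNReal.ofReal_mul (by positivity)] at h
  exact (ENNReal.ofReal_le_ofReal_iff (mul_nonneg (by positivity) (D.rho_nonneg u))).1 h

lemma integrable_rpow_pbar (u : D.X) : Integrable (fun x => |u x| ^ D.pbar x) := by
  have hm : Measurable fun x => |u x| ^ D.pbar x := by
    have := D.X_measurable u
    have := D.measurable_pbar
    fun_prop
  refine ⟨hm.aestronglyMeasurable, ?_⟩
  rw [hasFiniteIntegral_iff_ofReal (Eventually.of_forall fun x => by positivity)]
  exact D.X_pbarModular_lt_top u

lemma integrable_rpow_pbar_div (u : D.X) : Integrable (fun x => |u x| ^ D.pbar x / D.pbar x) := by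
  have hm : Measurable fun x => |u x| ^ D.pbar x / D.pbar x := by
    have := D.X_measurable u
    have := D.measurable_pbar
    fun_prop
  refine (D.integrable_rpow_pbar u).mono' hm.aestronglyMeasurable (Eventually.of_forall fun x => ?_)
  have := D.one_lt_pbar x
  rw [Real.norm_of_nonneg (by positivity)]
  exact div_le_self (by positivity) this.le

lemma sig_smul_le {u : D.X} {a : ℝ} (ha : 0 ≤ a) (ha1 : a ≤ 1) : D.sig (a • u) ≤ a * D.sig u := by
  unfold sig
  rw [← integral_const_mul]
  refine integral_mono_ae (D.integrable_rpow_pbar_div _).integrableOn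
    ((D.integrable_rpow_pbar_div _).integrableOn.const_mul _) (ae_restrict_of_ae ?_)
  filter_upwards [D.X_smul a u] with x hx
  rw [hx, ← mul_div_assoc]
  exact div_le_div_of_nonneg_right (abs_mul_rpow_le_of_le_one (D.one_lt_pbar x).le ha ha1 _)
    (D.pbar_pos x).le

lemma sig_smul_le' {u : D.X} {a : ℝ} (ha : 1 ≤ a) : D.sig (a • u) ≤ a ^ D.pmax * D.sig u := by
  unfold sig
  rw [← integral_const_mul]
  refine integral_mono_ae (D.integrable_rpow_pbar_div _).integrableOn
    ((D.integrable_rpow_pbar_div _).integrableOn.const_mul _) (ae_restrict_of_ae ?_)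
  filter_upwards [D.X_smul a u] with x hx
  rw [hx, ← mul_div_assoc]
  exact div_le_div_of_nonneg_right
    (abs_mul_rpow_le_of_one_le (D.pbar_pos x).le (D.pbar_le_pmax x) ha _) (D.pbar_pos x).le

lemma modular_div_lt_one_iff (u : D.X) (t : ℝ) :
    gagliardoModular D.s D.p (fun x => u x / t) < 1 ↔ D.rho (t⁻¹ • u) < 1 := by
  have e : (fun x => u x / t) = fun x => t⁻¹ * u x := by
    funext x; rw [div_eq_inv_mul]
  rw [e, ← D.modular_congr (D.X_smul t⁻¹ u), ← ofReal_rho, ENNReal.ofReal_lt_one]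

lemma lintegral_div_le_one_iff (u : D.X) (t : ℝ) :
    ∫⁻ x in D.Ω, ENNReal.ofReal (|u x / t| ^ D.pbar x / D.pbar x) ≤ 1 ↔ D.sig (t⁻¹ • u) ≤ 1 := by
  have h : ∫⁻ x in D.Ω, ENNReal.ofReal (|u x / t| ^ D.pbar x / D.pbar x)
      = ENNReal.ofReal (D.sig (t⁻¹ • u)) := by
    unfold sig
    rw [ofReal_integral_eq_lintegral_ofReal (D.integrable_rpow_pbar_div _).integrableOn
      (Eventually.of_forall fun x => div_nonneg (by positivity) (D.pbar_pos x).le)]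
    refine lintegral_congr_ae (ae_restrict_of_ae ?_)
    filter_upwards [D.X_smul t⁻¹ u] with x hx
    rw [hx, div_eq_inv_mul (u x)]
  rw [h, ENNReal.ofReal_le_one]

lemma K_le_iff (u : D.X) {t : ℝ} (ht : 0 < t) : D.K u ≤ t ↔ D.rho (t⁻¹ • u) ≤ 1 := by
  refine luxemburg_le_iff (f := fun c => D.rho (c • u))
    (A := {t : ℝ | 0 < t ∧ gagliardoModular D.s D.p (fun x => u x / t) < 1})
    (b := D.pmax) (fun _ => D.rho_nonneg _)
    (fun c a _ ha ha1 => ?_) (fun c a _ ha => ?_) (fun t ht h => ⟨ht, ?_⟩) (fun t h => ⟨h.1, ?_⟩) ht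
  · rw [mul_smul]; exact D.rho_smul_le ha ha1
  · rw [mul_smul]; exact D.rho_smul_le' ha
  · exact (D.modular_div_lt_one_iff u t).2 h
  · exact ((D.modular_div_lt_one_iff u t).1 h.2).le

lemma K_nonneg (u : D.X) : 0 ≤ D.K u := norm_nonneg u

lemma norm_eq_K (u : D.X) : ‖u‖ = D.K u := rfl

lemma K_pos {u : D.X} (hu : u ≠ 0) : 0 < D.K u := norm_pos_iff.2 hu

lemma rho_ne_zero {u : D.X} (hu : u ≠ 0) : D.rho u ≠ 0 := by
  intro h
  refine (D.K_pos hu).ne' (le_antisymm (le_of_forall_gt_imp_ge_of_dense fun t ht => ?_)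
    (D.K_nonneg u))
  rw [K_le_iff _ _ ht]
  rcases le_total 1 t⁻¹ with h1 | h1
  · exact (D.rho_smul_le' h1).trans (by rw [h]; simp)
  · exact (D.rho_smul_le (by positivity) h1).trans (by rw [h]; simp)

lemma rho_inv_K_smul {u : D.X} (hu : u ≠ 0) : D.rho ((D.K u)⁻¹ • u) = 1 := by
  refine (luxemburg_spec (f := fun c => D.rho (c • u))
    (A := {t : ℝ | 0 < t ∧ gagliardoModular D.s D.p (fun x => u x / t) < 1})
    (b := D.pmax) (fun _ => D.rho_nonneg _)
    (fun c a _ ha ha1 => ?_) (fun c a _ ha => ?_) (fun t ht h => ⟨ht, ?_⟩)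
    (fun t h => ⟨h.1, ?_⟩) ?_).2
  · rw [mul_smul]; exact D.rho_smul_le ha ha1
  · rw [mul_smul]; exact D.rho_smul_le' ha
  · exact (D.modular_div_lt_one_iff u t).2 h
  · exact ((D.modular_div_lt_one_iff u t).1 h.2).le
  · simpa using D.rho_ne_zero hu

lemma K_le_one_iff (u : D.X) : D.K u ≤ 1 ↔ D.rho u ≤ 1 := by
  simpa using D.K_le_iff u one_pos

lemma K_smul_le (a : ℝ) (u : D.X) : D.K (a • u) ≤ |a| * D.K u := by
  have key : ∀ a : ℝ, 0 < a → D.K (a • u) ≤ a * D.K u := by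
    intro a ha
    by_cases hu : u = 0
    · subst hu; rw [smul_zero, K_zero, mul_zero]
    · have hK := D.K_pos hu
      rw [D.K_le_iff _ (by positivity), smul_smul]
      have e : (a * D.K u)⁻¹ * a = (D.K u)⁻¹ := by field_simp
      rw [e, D.rho_inv_K_smul hu]
  rcases lt_trichotomy a 0 with h | h | h
  · rw [abs_of_neg h, ← K_neg, ← neg_smul]
    exact key _ (neg_pos.2 h)
  · simp [h, K_zero]
  · rw [abs_of_pos h]; exact key a h

noncomputable instance : NormedSpace ℝ D.X where
  norm_smul_le a u := D.K_smul_le a u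

lemma K_smul (a : ℝ) (u : D.X) : D.K (a • u) = |a| * D.K u := norm_smul a u

lemma rho_le_of_K_le {u : D.X} {R : ℝ} (hR : 1 ≤ R) (h : D.K u ≤ R) : D.rho u ≤ R ^ D.pmax := by
  have hR0 : 0 < R := by linarith
  have h1 := (D.K_le_iff u hR0).1 h
  have h2 := D.rho_smul_le' (u := R⁻¹ • u) hR
  rw [smul_smul, mul_inv_cancel₀ hR0.ne', one_smul] at h2
  exact h2.trans (mul_le_of_le_one_right (by positivity) h1)

/-- Scaling by `t⁻¹ ≥ 1` costs at most the factor `t^(-pmax)`. Through this, convergence to zero in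
norm can be read off the modular. -/
lemma K_le_of_rho_le {u : D.X} {t : ℝ} (ht : 0 < t) (ht1 : t ≤ 1) (h : D.rho u ≤ t ^ D.pmax) :
    D.K u ≤ t := by
  rw [D.K_le_iff u ht]
  have h1 := D.rho_smul_le' (u := u) ((one_le_inv₀ ht).2 ht1)
  refine h1.trans ?_
  rw [Real.inv_rpow ht.le, inv_mul_le_one₀ (by positivity)]
  exact h

lemma tendsto_of_rho_tendsto {ι : Type*} {l : Filter ι} {u : ι → D.X}
    (h : Tendsto (fun i => D.rho (u i)) l (𝓝 0)) : Tendsto u l (𝓝 0) := by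
  rw [tendsto_zero_iff_norm_tendsto_zero, Metric.tendsto_nhds]
  intro ε hε
  set t := min (ε / 2) 1 with ht
  have ht0 : 0 < t := by positivity
  filter_upwards [h.eventually_lt_const (show 0 < t ^ D.pmax by positivity)] with i hi
  have := D.K_le_of_rho_le ht0 (min_le_right _ _) hi.le
  rw [Real.dist_eq, sub_zero, abs_norm, norm_eq_K]
  have := min_le_left (ε / 2) 1
  linarith

lemma k_le_iff (u : D.X) {t : ℝ} (ht : 0 < t) : D.k u ≤ t ↔ D.sig (t⁻¹ • u) ≤ 1 := by
  refine luxemburg_le_iff (f := fun c => D.sig (c • u))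
    (A := {t : ℝ | 0 < t ∧ ∫⁻ x in D.Ω, ENNReal.ofReal (|u x / t| ^ D.pbar x / D.pbar x) ≤ 1})
    (b := D.pmax) (fun _ => D.sig_nonneg _)
    (fun c a _ ha ha1 => ?_) (fun c a _ ha => ?_) (fun t ht h => ⟨ht, ?_⟩) (fun t h => ⟨h.1, ?_⟩) ht
  · rw [mul_smul]; exact D.sig_smul_le ha ha1
  · rw [mul_smul]; exact D.sig_smul_le' ha
  · exact (D.lintegral_div_le_one_iff u t).2 h.le
  · exact (D.lintegral_div_le_one_iff u t).1 h.2

lemma integral_rpow_pbar_pos {u : D.X} (hu : u ≠ 0) : 0 < ∫ x in D.Ω, |u x| ^ D.pbar x := by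
  refine lt_of_le_of_ne (integral_nonneg fun x => by positivity) fun h => hu ?_
  have h0 := (integral_eq_zero_iff_of_nonneg (fun x => by positivity)
    (D.integrable_rpow_pbar u).integrableOn).1 h.symm
  rw [Filter.EventuallyEq, ae_restrict_iff' D.isOpen_Ω.measurableSet] at h0
  refine D.X_ext ?_
  filter_upwards [h0, D.X_ae_zero u, D.X_zero] with x h1 h2 h3
  rw [h3]
  by_cases hx : x ∈ D.Ω
  · have := h1 hx
    rw [Pi.zero_apply, Real.rpow_eq_zero_iff_of_nonneg (abs_nonneg _)] at this
    exact abs_eq_zero.1 this.1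
  · exact h2 hx

lemma integral_le_sig (u : D.X) : (∫ x in D.Ω, |u x| ^ D.pbar x) ≤ D.pmax * D.sig u := by
  unfold sig
  rw [← integral_const_mul]
  refine integral_mono (D.integrable_rpow_pbar u).integrableOn
    ((D.integrable_rpow_pbar_div _).integrableOn.const_mul _) fun x => ?_
  have := D.pbar_pos x
  simp only
  rw [mul_div_assoc', le_div_iff₀ this, mul_comm]
  exact mul_le_mul_of_nonneg_right (D.pbar_le_pmax x) (by positivity)

lemma sig_pos {u : D.X} (hu : u ≠ 0) : 0 < D.sig u := by
  have h1 := D.integral_rpow_pbar_pos hu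
  have h2 := D.integral_le_sig u
  have h3 := D.pmax_pos
  by_contra h
  nlinarith

lemma sig_zero : D.sig 0 = 0 := by
  have h := D.sig_smul_le (u := 0) le_rfl zero_le_one
  rw [smul_zero, zero_mul] at h
  exact le_antisymm h (D.sig_nonneg _)

lemma k_zero : D.k 0 ≤ 0 := by
  refine le_of_forall_gt_imp_ge_of_dense fun t ht => ?_
  rw [D.k_le_iff _ ht, smul_zero, sig_zero]
  exact zero_le_one

lemma k_spec {u : D.X} (hu : u ≠ 0) : 0 < D.k u ∧ D.sig ((D.k u)⁻¹ • u) = 1 := by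
  refine luxemburg_spec (f := fun c => D.sig (c • u))
    (A := {t : ℝ | 0 < t ∧ ∫⁻ x in D.Ω, ENNReal.ofReal (|u x / t| ^ D.pbar x / D.pbar x) ≤ 1})
    (b := D.pmax) (fun _ => D.sig_nonneg _)
    (fun c a _ ha ha1 => ?_) (fun c a _ ha => ?_) (fun t ht h => ⟨ht, ?_⟩)
    (fun t h => ⟨h.1, ?_⟩) ?_
  · rw [mul_smul]; exact D.sig_smul_le ha ha1
  · rw [mul_smul]; exact D.sig_smul_le' ha
  · exact (D.lintegral_div_le_one_iff u t).2 h.le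
  · exact (D.lintegral_div_le_one_iff u t).1 h.2
  · simpa using (D.sig_pos hu).ne'

lemma k_pos {u : D.X} (hu : u ≠ 0) : 0 < D.k u := (D.k_spec hu).1

lemma ne_zero_of_mem_M {u : D.X} (hu : u ∈ D.M) : u ≠ 0 := by
  rintro rfl
  have h1 : D.k 0 = 1 := hu
  have := D.k_zero
  linarith

lemma sig_eq_one {u : D.X} (hu : u ∈ D.M) : D.sig u = 1 := by
  have h1 : D.k u = 1 := hu
  have := (D.k_spec (D.ne_zero_of_mem_M hu)).2
  rwa [h1, inv_one, one_smul] at this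

lemma k_eq_of_sig_eq {u : D.X} {t : ℝ} (ht : 0 < t) (h : D.sig (t⁻¹ • u) = 1) : D.k u = t := by
  have hu : u ≠ 0 := by
    rintro rfl
    rw [smul_zero, sig_zero] at h
    exact zero_ne_one h
  obtain ⟨h0, h1⟩ := D.k_spec hu
  refine le_antisymm ((D.k_le_iff u ht).2 h.le) ?_
  by_contra hlt
  rw [not_le] at hlt
  have h2 := D.sig_smul_le (u := (D.k u)⁻¹ • u) (a := D.k u / t) (by positivity)
    ((div_le_one ht).2 hlt.le)
  have e : D.k u / t * (D.k u)⁻¹ = t⁻¹ := by field_simp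
  rw [smul_smul, e, h, h1, mul_one, le_div_iff₀ ht] at h2
  linarith

lemma mem_M_of_sig_eq_one {u : D.X} (h : D.sig u = 1) : u ∈ D.M :=
  D.k_eq_of_sig_eq one_pos (by simpa using h)

lemma inv_k_smul_mem_M {u : D.X} (hu : u ≠ 0) : (D.k u)⁻¹ • u ∈ D.M :=
  D.mem_M_of_sig_eq_one (D.k_spec hu).2

lemma sig_neg (u : D.X) : D.sig (-u) = D.sig u := by
  unfold sig
  refine integral_congr_ae (ae_restrict_of_ae ?_)
  filter_upwards [D.X_neg u] with x hx
  simp only [hx, abs_neg]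

lemma k_neg {u : D.X} (hu : u ≠ 0) : D.k (-u) = D.k u := by
  refine D.k_eq_of_sig_eq (D.k_pos hu) ?_
  rw [smul_neg, sig_neg, (D.k_spec hu).2]

/-! ### Integrability estimates from the Gagliardo modular -/

/-- The inner integral `∫ density(x, y) dy` of the Gagliardo modular. -/
noncomputable def slice (u : Eu N → ℝ) (x : Eu N) : ℝ≥0∞ :=
  ∫⁻ y, ENNReal.ofReal (gagliardoDensity D.s D.p u (x, y))

lemma lintegral_slice {u : Eu N → ℝ} (hu : Measurable u) :
    ∫⁻ x, D.slice u x = gagliardoModular D.s D.p u := by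
  unfold slice gagliardoModular
  rw [Measure.volume_eq_prod, lintegral_prod _ (D.measurable_density hu).ennreal_ofReal.aemeasurable]

lemma lintegral_eq_setLIntegral {f : Eu N → ℝ≥0∞} (hf : ∀ᵐ x, x ∉ D.Ω → f x = 0) :
    ∫⁻ x, f x = ∫⁻ x in D.Ω, f x := by
  rw [← lintegral_add_compl f D.isOpen_Ω.measurableSet]
  have : ∫⁻ x in D.Ωᶜ, f x = 0 := by
    rw [lintegral_congr_ae (g := fun _ => 0), lintegral_zero]
    rw [Filter.EventuallyEq, ae_restrict_iff' D.isOpen_Ω.measurableSet.compl]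
    exact hf
  rw [this, add_zero]

lemma exists_subset_ball : ∃ r : ℝ, 1 ≤ r ∧ D.Ω ⊆ Metric.ball 0 r := by
  obtain ⟨r, hr⟩ := D.isBounded_Ω.subset_ball 0
  exact ⟨max 1 r, le_max_left _ _, hr.trans (Metric.ball_subset_ball (le_max_right _ _))⟩

lemma nontrivial_Eu (D : Data N) : Nontrivial (Eu N) := by
  have : Nonempty (Fin N) := ⟨⟨0, D.N_pos⟩⟩
  infer_instance

/-- The density lower bound for a jump of size at least one at bounded distance. -/
lemma le_density_of_dist_le {u : Eu N → ℝ} {x y : Eu N} {d : ℝ} (hd : 1 ≤ d) (hxy : ‖x - y‖ ≤ d)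
    (hne : x ≠ y) (hy : u y = 0) :
    |u x| ≤ 1 + D.pmax * d ^ ((N : ℝ) + D.s * D.pmax) * gagliardoDensity D.s D.p u (x, y) := by
  have hp := D.p_pos x y
  have hp1 := D.one_lt_p x y
  have hpm := D.p_le_pmax x y
  have hs := D.s_pos
  have hn : 0 < ‖x - y‖ := norm_pos_iff.2 (sub_ne_zero.2 hne)
  rcases le_total |u x| 1 with h | h
  · have := mul_nonneg (mul_nonneg D.pmax_pos.le (Real.rpow_nonneg (zero_le_one.trans hd)
      ((N : ℝ) + D.s * D.pmax))) (D.density_nonneg u (x, y))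
    linarith
  · have h1 : |u x| ≤ |u x| ^ D.p x y := by
      simpa using Real.rpow_le_rpow_of_exponent_le h hp1.le
    have h2 : ‖x - y‖ ^ ((N : ℝ) + D.s * D.p x y) ≤ d ^ ((N : ℝ) + D.s * D.pmax) :=
      (Real.rpow_le_rpow hn.le hxy (by positivity)).trans
        (Real.rpow_le_rpow_of_exponent_le hd (by gcongr))
    have h3 : D.p x y * ‖x - y‖ ^ ((N : ℝ) + D.s * D.p x y)
        ≤ D.pmax * d ^ ((N : ℝ) + D.s * D.pmax) :=
      mul_le_mul hpm h2 (by positivity) D.pmax_pos.le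
    have h4 : |u x| ^ D.p x y ≤
        D.pmax * d ^ ((N : ℝ) + D.s * D.pmax) * gagliardoDensity D.s D.p u (x, y) := by
      have hq : 0 < D.p x y * ‖x - y‖ ^ ((N : ℝ) + D.s * D.p x y) := by positivity
      simp only [gagliardoDensity, hy, sub_zero]
      rw [mul_div_assoc', le_div_iff₀ hq, mul_comm]
      exact mul_le_mul_of_nonneg_right h3 (by positivity)
    linarith

/-- The `L¹` norm is controlled by the modular. -/
lemma exists_lintegral_abs_le : ∃ C : ℝ, 0 < C ∧ ∀ u : D.X,
    ∫⁻ x, ENNReal.ofReal |u x| ≤ ENNReal.ofReal (C * (1 + D.rho u)) := by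
  obtain ⟨r, hr1, hr⟩ := D.exists_subset_ball
  have := D.nontrivial_Eu
  obtain ⟨y₀, hy₀⟩ := (NormedSpace.sphere_nonempty (E := Eu N) (x := 0) (r := r + 1)).2 (by linarith)
  rw [mem_sphere_zero_iff_norm] at hy₀
  -- The centre has norm `r + 1`, so this ball misses `Ω` and `u` vanishes on it. Averaging the
  -- density bound over `y ∈ E` then controls `|u x|`, as in a Poincaré inequality; `d = 2 r + 2`
  -- bounds the distance between points of `Ω` and `E`.
  set E := Metric.ball y₀ 1 with hE
  set d := 2 * r + 2 with hd
  set A := D.pmax * d ^ ((N : ℝ) + D.s * D.pmax) with hA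
  have hd0 : 0 < d := by linarith
  have hA0 : 0 < A := mul_pos D.pmax_pos (by positivity)
  have hV0 : volume E ≠ 0 := (Metric.measure_ball_pos volume y₀ one_pos).ne'
  have hVt : volume E ≠ ∞ := measure_ball_lt_top.ne
  have hΩt : volume D.Ω ≠ ∞ := D.isBounded_Ω.measure_lt_top.ne
  have hEball : ∀ y ∈ E, r < ‖y‖ ∧ ‖y‖ < r + 2 := by
    intro y hy
    rw [hE, Metric.mem_ball, dist_eq_norm] at hy
    have h1 : ‖y₀‖ ≤ ‖y‖ + ‖y - y₀‖ := by
      have := norm_sub_le y (y - y₀); simpa using this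
    have h2 : ‖y‖ ≤ ‖y₀‖ + ‖y - y₀‖ := by
      have := norm_add_le y₀ (y - y₀); simpa using this
    constructor <;> linarith
  set v := (volume E).toReal with hv
  have hv0 : 0 < v := ENNReal.toReal_pos hV0 hVt
  set w := (volume D.Ω).toReal with hw
  have hw0 : 0 ≤ w := ENNReal.toReal_nonneg
  refine ⟨w + A / v, by positivity, fun u => ?_⟩
  have hae : ∀ᵐ y, y ∈ E → u y = 0 := by
    filter_upwards [D.X_ae_zero u] with y hy hyE
    refine hy fun hyΩ => ?_
    have := hr hyΩ
    rw [mem_ball_zero_iff] at this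
    linarith [(hEball y hyE).1]
  have hpt : ∀ x ∈ D.Ω, ENNReal.ofReal |u x| ≤ 1 + ENNReal.ofReal (A / v) * D.slice u x := by
    intro x hx
    have hxr := hr hx
    rw [mem_ball_zero_iff] at hxr
    have h1 : ENNReal.ofReal |u x| * volume E ≤
        volume E + ENNReal.ofReal A * D.slice u x := by
      calc ENNReal.ofReal |u x| * volume E = ∫⁻ _ in E, ENNReal.ofReal |u x| := by
            rw [setLIntegral_const]
        _ ≤ ∫⁻ y in E, (1 + ENNReal.ofReal A *
              ENNReal.ofReal (gagliardoDensity D.s D.p u (x, y))) := by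
            refine lintegral_mono_ae ?_
            rw [ae_restrict_iff' Metric.isOpen_ball.measurableSet]
            filter_upwards [hae] with y hy hyE
            have hyn := hEball y hyE
            have h2 := D.le_density_of_dist_le (d := d) (x := x) (by linarith)
              ((norm_sub_le _ _).trans (by linarith)) (by rintro rfl; linarith) (hy hyE)
            rw [← ENNReal.ofReal_mul hA0.le, ← ENNReal.ofReal_one,
              ← ENNReal.ofReal_add zero_le_one (mul_nonneg hA0.le (D.density_nonneg _ _))]
            exact ENNReal.ofReal_le_ofReal h2
        _ = volume E + ENNReal.ofReal A *
              ∫⁻ y in E, ENNReal.ofReal (gagliardoDensity D.s D.p u (x, y)) := by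
            rw [lintegral_add_left measurable_const, setLIntegral_const, one_mul,
              lintegral_const_mul' _ _ ENNReal.ofReal_ne_top]
        _ ≤ _ := by
            gcongr
            exact setLIntegral_le_lintegral _ _
    rw [← ENNReal.le_div_iff_mul_le (Or.inl hV0) (Or.inl hVt)] at h1
    refine h1.trans_eq ?_
    rw [ENNReal.add_div, ENNReal.div_self hV0 hVt, ENNReal.ofReal_div_of_pos hv0, hv,
      ENNReal.ofReal_toReal hVt, ENNReal.div_eq_inv_mul, ENNReal.div_eq_inv_mul, mul_assoc]
  rw [D.lintegral_eq_setLIntegral (by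
    filter_upwards [D.X_ae_zero u] with x hx hxΩ
    rw [hx hxΩ]; simp)]
  calc ∫⁻ x in D.Ω, ENNReal.ofReal |u x|
      ≤ ∫⁻ x in D.Ω, (1 + ENNReal.ofReal (A / v) * D.slice u x) :=
        setLIntegral_mono' D.isOpen_Ω.measurableSet hpt
    _ ≤ volume D.Ω + ENNReal.ofReal (A / v) * gagliardoModular D.s D.p u := by
        rw [lintegral_add_left measurable_const, setLIntegral_const, one_mul,
          lintegral_const_mul' _ _ ENNReal.ofReal_ne_top, ← D.lintegral_slice (D.X_measurable u)]
        gcongr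
        exact Measure.restrict_le_self
    _ = ENNReal.ofReal (w + A / v * D.rho u) := by
        rw [← ofReal_rho, ← ENNReal.ofReal_mul (by positivity), ← ENNReal.ofReal_toReal hΩt,
          ← ENNReal.ofReal_add hw0 (mul_nonneg (by positivity) (D.rho_nonneg u))]
    _ ≤ _ := by
        refine ENNReal.ofReal_le_ofReal ?_
        have h1 := D.rho_nonneg u
        have h2 : 0 ≤ A / v := by positivity
        nlinarith

/-- Uniform closeness of `p` to its diagonal values near `Ω`. -/
lemma exists_radius {δ : ℝ} (hδ : 0 < δ) : ∃ r : ℝ, 0 < r ∧ r ≤ 1 ∧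
    ∀ x ∈ D.Ω, ∀ y, ‖x - y‖ < r → D.pbar x - δ ≤ D.p x y := by
  obtain ⟨r₀, hr1, hr⟩ := D.exists_subset_ball
  have hc : IsCompact (Metric.closedBall (0 : Eu N) (r₀ + 1) ×ˢ Metric.closedBall (0 : Eu N) (r₀ + 1)) :=
    (isCompact_closedBall _ _).prod (isCompact_closedBall _ _)
  have hu := hc.uniformContinuousOn_of_continuous D.continuous_p.continuousOn
  rw [Metric.uniformContinuousOn_iff] at hu
  obtain ⟨ε, hε, h⟩ := hu δ hδ
  refine ⟨min ε 1, by positivity, min_le_right _ _, fun x hx y hxy => ?_⟩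
  have hxr := hr hx
  rw [mem_ball_zero_iff] at hxr
  have hyr : ‖y‖ ≤ ‖x‖ + ‖x - y‖ := by
    have := norm_sub_le x (x - y); simpa using this
  have h1 := h (x, x) ⟨by simp; linarith, by simp; linarith⟩ (x, y)
    ⟨by simp; linarith, by simp; linarith [min_le_right ε 1]⟩ (by
      rw [Prod.dist_eq]
      simp only [dist_self, dist_eq_norm]
      exact max_lt hε (hxy.trans_le (min_le_left _ _)))
  rw [Real.dist_eq, abs_lt] at h1
  have := h1.2
  simp only at this
  unfold pbar
  linarith

/-- The base `l / (2 h^s)` is at least one, so lowering the exponent from `p x y` to `q` only lowers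
the power. -/
lemma le_density_of_jump {u : Eu N → ℝ} {x y : Eu N} {l h q : ℝ} (hl : 2 ≤ l) (hh : 0 < h)
    (hh1 : h ≤ 1) (hxy : ‖x - y‖ < h) (hx : |u x| = l) (hy : |u y| ≤ l / 2) (hq : q ≤ D.p x y) :
    D.pmax⁻¹ * (h ^ N)⁻¹ * (l / (2 * h ^ D.s)) ^ q ≤ gagliardoDensity D.s D.p u (x, y) := by
  have hp := D.p_pos x y
  have hpm := D.p_le_pmax x y
  have hs := D.s_pos
  have hpm0 := D.pmax_pos
  have hne : x ≠ y := by
    rintro rfl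
    linarith
  have hn : 0 < ‖x - y‖ := norm_pos_iff.2 (sub_ne_zero.2 hne)
  have hjump : l / 2 ≤ |u x - u y| := by
    have := abs_sub_abs_le_abs_sub (u x) (u y)
    linarith
  have hhs : h ^ D.s ≤ 1 := Real.rpow_le_one hh.le hh1 hs.le
  have hhs0 : 0 < h ^ D.s := by positivity
  have hge : 1 ≤ l / (2 * h ^ D.s) := by
    rw [le_div_iff₀ (by positivity)]
    linarith
  calc D.pmax⁻¹ * (h ^ N)⁻¹ * (l / (2 * h ^ D.s)) ^ q
      ≤ D.pmax⁻¹ * (h ^ N)⁻¹ * (l / (2 * h ^ D.s)) ^ D.p x y := by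
        gcongr
    _ = (l / 2) ^ D.p x y / (D.pmax * h ^ ((N : ℝ) + D.s * D.p x y)) := by
        rw [Real.rpow_add hh, Real.rpow_natCast, Real.rpow_mul hh.le, ← div_div,
          Real.div_rpow (by positivity) hhs0.le]
        field_simp
    _ ≤ |u x - u y| ^ D.p x y / (D.p x y * ‖x - y‖ ^ ((N : ℝ) + D.s * D.p x y)) := by
        gcongr

/-- The gain of integrability. -/
noncomputable def gain : ℝ := D.s / N / 2

lemma natCast_pos (D : Data N) : (0 : ℝ) < N := Nat.cast_pos.2 D.N_pos

lemma gain_pos : 0 < D.gain := by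
  have := D.natCast_pos
  have := D.s_pos
  unfold gain
  positivity

lemma gain_lt_one : D.gain < 1 := by
  have h1 : (1 : ℝ) ≤ N := by exact_mod_cast D.N_pos
  have := D.s_pos
  have h2 := D.s_lt_one
  have h3 : D.s / N ≤ D.s := div_le_self this.le h1
  unfold gain
  linarith

/-- A pointwise bound of `|u|^{p̄ + gain}` by the inner Gagliardo integral. -/
lemma exists_pointwise_bound (R : ℝ) : ∃ C₁ C₂ : ℝ, 0 ≤ C₁ ∧ 0 ≤ C₂ ∧ ∀ u : D.X, D.rho u ≤ R →
    ∀ x ∈ D.Ω, ENNReal.ofReal (|u x| ^ (D.pbar x + D.gain))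
      ≤ ENNReal.ofReal C₁ + ENNReal.ofReal C₂ * D.slice u x := by
  obtain ⟨C, hC, hCu⟩ := D.exists_lintegral_abs_le
  have := D.nontrivial_Eu
  have hN := D.natCast_pos
  have hN1 : (1 : ℝ) ≤ N := by exact_mod_cast D.N_pos
  have hs := D.s_pos
  have hs1 := D.s_lt_one
  have hpm := D.pmax_pos
  set θ := D.s / N with hθ
  have hθ0 : 0 < θ := by positivity
  have hθ1 : θ < 1 := (div_le_self hs.le hN1).trans_lt hs1
  have hgain : D.gain = θ / 2 := rfl
  obtain ⟨r, hr0, hr1, hr⟩ := D.exists_radius (δ := θ / 4) (by positivity)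
  set M := C * (1 + max R 0) with hM
  have hM0 : 0 < M := by positivity
  set v := (volume (Metric.ball (0 : Eu N) 1)).toReal with hv
  have hv0 : 0 < v :=
    ENNReal.toReal_pos (Metric.measure_ball_pos volume _ one_pos).ne' measure_ball_lt_top.ne
  -- Above this level the radius `h` chosen below is at most `r`, where `p x y ≥ p̄ x - θ / 4`.
  set l₀ := max 2 (4 * M / (v * r ^ N)) with hl₀
  have hl₀2 : 2 ≤ l₀ := le_max_left _ _
  set c₀ := (v / (4 * M)) ^ θ / 2 with hc₀
  have hc₀0 : 0 < c₀ := by positivity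
  set m := (min 1 c₀) ^ D.pmax with hm
  have hm0 : 0 < m := by positivity
  refine ⟨l₀ ^ (D.pmax + 1), 2 * D.pmax / (v * m), by positivity, by positivity,
    fun u hu x hx => ?_⟩
  have hpb := D.one_lt_pbar x
  have hpbm := D.pbar_le_pmax x
  have hg := D.gain_pos
  rcases le_total |u x| l₀ with hsmall | hbig
  · refine le_add_right (ENNReal.ofReal_le_ofReal ?_)
    calc |u x| ^ (D.pbar x + D.gain) ≤ l₀ ^ (D.pbar x + D.gain) := by gcongr
      _ ≤ l₀ ^ (D.pmax + 1) :=
        Real.rpow_le_rpow_of_exponent_le (by linarith) (by linarith [D.gain_lt_one])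
  · refine le_add_left ?_
    set l := |u x| with hl
    have hl2 : 2 ≤ l := hl₀2.trans hbig
    have hl0 : 0 < l := by linarith
    -- With `h^N = t` the ball of radius `h` about `x` has volume `4 M / l`. By Chebyshev `|u| ≥ l /
    -- 2` on a set of measure at most `2 M / l`, so on at least half of the ball `u` differs from `u
    -- x` by at least `l / 2`. As `h^s` is of order `l^(-θ)`, integrating the density over that half
    -- gives a quantity of order `l^((1+θ) q)`.
    set t := 4 * M / (v * l) with ht
    have ht0 : 0 < t := by positivity
    set h := t ^ (N : ℝ)⁻¹ with hh
    have hh0 : 0 < h := by positivity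
    have hhN : h ^ N = t := by
      rw [hh, ← Real.rpow_natCast, ← Real.rpow_mul ht0.le, inv_mul_cancel₀ hN.ne', Real.rpow_one]
    have htr : t ≤ r ^ N := by
      have h1 : 4 * M / (v * r ^ N) ≤ l := (le_max_right _ _).trans hbig
      rw [div_le_iff₀ (by positivity)] at h1
      rw [ht, div_le_iff₀ (by positivity)]
      linarith
    have hhr : h ≤ r := by
      have := Real.rpow_le_rpow ht0.le htr (inv_nonneg.2 hN.le)
      rwa [← Real.rpow_natCast, ← Real.rpow_mul hr0.le, mul_inv_cancel₀ hN.ne', Real.rpow_one] at this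
    have hhs : h ^ D.s = t ^ θ := by
      rw [hh, ← Real.rpow_mul ht0.le, hθ, div_eq_inv_mul]
    set q := D.pbar x - θ / 4 with hq
    have hq0 : 0 < q := by linarith
    set c := D.pmax⁻¹ * (h ^ N)⁻¹ * (l / (2 * h ^ D.s)) ^ q with hc
    have hc0 : 0 ≤ c := by positivity
    set Z := {y | ENNReal.ofReal (l / 2) ≤ ENNReal.ofReal |u y|} with hZ
    have hum := D.X_measurable u
    have hZm : MeasurableSet Z := measurableSet_le measurable_const (by fun_prop)
    have hZle : volume Z ≤ ENNReal.ofReal (2 * M / l) := by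
      have h1 := mul_meas_ge_le_lintegral (μ := volume) (f := fun y => ENNReal.ofReal |u y|)
        (by fun_prop) (ENNReal.ofReal (l / 2))
      have h2 := h1.trans ((hCu u).trans (ENNReal.ofReal_le_ofReal (q := M) (by
        rw [hM]; gcongr; exact hu.trans (le_max_left _ _))))
      rw [mul_comm, ← ENNReal.le_div_iff_mul_le (Or.inl (by simpa using hl0)) (Or.inl (by simp)),
        ← ENNReal.ofReal_div_of_pos (by positivity)] at h2
      refine h2.trans_eq ?_
      congr 1
      field_simp
    have hball : volume (Metric.ball x h) = ENNReal.ofReal (4 * M / l) := by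
      rw [Measure.addHaar_ball_of_pos _ _ hh0, finrank_euclideanSpace_fin, hhN,
        ← ENNReal.ofReal_toReal (measure_ball_lt_top (μ := volume) (x := (0 : Eu N)) (r := 1)).ne,
        ← ENNReal.ofReal_mul ht0.le, ← hv, ht]
      congr 1
      field_simp
    have hY : ENNReal.ofReal (2 * M / l) ≤ volume (Metric.ball x h \ Z) := by
      refine le_trans ?_ le_measure_sdiff
      rw [hball]
      refine le_trans ?_ (tsub_le_tsub_left hZle _)
      rw [← ENNReal.ofReal_sub _ (by positivity)]
      refine ENNReal.ofReal_le_ofReal (le_of_eq ?_)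
      ring
    have hslice : ENNReal.ofReal (c * (2 * M / l)) ≤ D.slice u x := by
      calc ENNReal.ofReal (c * (2 * M / l)) = ENNReal.ofReal c * ENNReal.ofReal (2 * M / l) :=
            ENNReal.ofReal_mul hc0
        _ ≤ ENNReal.ofReal c * volume (Metric.ball x h \ Z) := by gcongr
        _ = ∫⁻ _ in Metric.ball x h \ Z, ENNReal.ofReal c := by rw [setLIntegral_const]
        _ ≤ ∫⁻ y in Metric.ball x h \ Z, ENNReal.ofReal (gagliardoDensity D.s D.p u (x, y)) := by
            refine setLIntegral_mono' (Metric.isOpen_ball.measurableSet.diff hZm) fun y hy => ?_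
            refine ENNReal.ofReal_le_ofReal ?_
            have hxy : ‖x - y‖ < h := by
              have := hy.1
              rwa [Metric.mem_ball, dist_comm, dist_eq_norm] at this
            refine D.le_density_of_jump hl2 hh0 (hhr.trans hr1) hxy rfl ?_
              (hr x hx y (hxy.trans_le hhr))
            have h1 : ¬ ENNReal.ofReal (l / 2) ≤ ENNReal.ofReal |u y| := hy.2
            rw [ENNReal.ofReal_le_ofReal_iff (abs_nonneg _)] at h1
            exact (not_le.1 h1).le
        _ ≤ _ := setLIntegral_le_lintegral _ _
    have hmain : l ^ (D.pbar x + D.gain) ≤ 2 * D.pmax / (v * m) * (c * (2 * M / l)) := by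
      have e1 : l / (2 * h ^ D.s) = l ^ (1 + θ) * c₀ := by
        rw [hhs, ht, Real.rpow_add hl0, Real.rpow_one, hc₀, Real.div_rpow (by positivity)
          (by positivity), Real.div_rpow (by positivity) (by positivity), Real.mul_rpow (by positivity)
          (by positivity) (x := v)]
        field_simp
      have e2 : c * (2 * M / l) = v / (2 * D.pmax) * (l ^ (1 + θ) * c₀) ^ q := by
        rw [hc, hhN, e1, ht]
        field_simp
        ring
      have h3 : m ≤ c₀ ^ q := by
        calc m ≤ (min 1 c₀) ^ q :=
              Real.rpow_le_rpow_of_exponent_ge (by positivity) (min_le_left _ _) (by linarith)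
          _ ≤ c₀ ^ q := by
              gcongr
              exact min_le_right _ _
      have h4 : l ^ (D.pbar x + D.gain) ≤ (l ^ (1 + θ)) ^ q := by
        rw [← Real.rpow_mul hl0.le]
        refine Real.rpow_le_rpow_of_exponent_le (by linarith) ?_
        -- The gain: `(1 + θ)(p̄ - θ/4) ≥ p̄ + θ/2`, because `p̄ > 1` and `θ < 1`.
        rw [hgain, hq]
        nlinarith
      rw [e2, Real.mul_rpow (by positivity) hc₀0.le]
      have e3 : 2 * D.pmax / (v * m) * (v / (2 * D.pmax) * ((l ^ (1 + θ)) ^ q * c₀ ^ q))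
          = (l ^ (1 + θ)) ^ q * (c₀ ^ q / m) := by
        field_simp
      rw [e3]
      have h5 : 1 ≤ c₀ ^ q / m := (one_le_div hm0).2 h3
      calc l ^ (D.pbar x + D.gain) ≤ (l ^ (1 + θ)) ^ q * 1 := by rw [mul_one]; exact h4
        _ ≤ _ := by gcongr
    calc ENNReal.ofReal (l ^ (D.pbar x + D.gain))
        ≤ ENNReal.ofReal (2 * D.pmax / (v * m) * (c * (2 * M / l))) :=
          ENNReal.ofReal_le_ofReal hmain
      _ = ENNReal.ofReal (2 * D.pmax / (v * m)) * ENNReal.ofReal (c * (2 * M / l)) :=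
          ENNReal.ofReal_mul (by positivity)
      _ ≤ _ := by gcongr

/-- Higher integrability of functions with bounded Gagliardo modular. -/
lemma exists_higher_integrability (R : ℝ) : ∃ C : ℝ, 0 ≤ C ∧ ∀ u : D.X, D.rho u ≤ R →
    ∫⁻ x in D.Ω, ENNReal.ofReal (|u x| ^ (D.pbar x + D.gain)) ≤ ENNReal.ofReal C := by
  obtain ⟨C₁, C₂, h1, h2, h⟩ := D.exists_pointwise_bound R
  have hΩt : volume D.Ω ≠ ∞ := D.isBounded_Ω.measure_lt_top.ne
  refine ⟨C₁ * (volume D.Ω).toReal + C₂ * max R 0, by positivity, fun u hu => ?_⟩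
  calc ∫⁻ x in D.Ω, ENNReal.ofReal (|u x| ^ (D.pbar x + D.gain))
      ≤ ∫⁻ x in D.Ω, (ENNReal.ofReal C₁ + ENNReal.ofReal C₂ * D.slice u x) :=
        setLIntegral_mono' D.isOpen_Ω.measurableSet (h u hu)
    _ ≤ ENNReal.ofReal C₁ * volume D.Ω + ENNReal.ofReal C₂ * gagliardoModular D.s D.p u := by
        rw [lintegral_add_left measurable_const, setLIntegral_const,
          lintegral_const_mul' _ _ ENNReal.ofReal_ne_top, ← D.lintegral_slice (D.X_measurable u)]
        gcongr
        exact Measure.restrict_le_self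
    _ ≤ ENNReal.ofReal (C₁ * (volume D.Ω).toReal + C₂ * max R 0) := by
        rw [ENNReal.ofReal_add (by positivity) (by positivity), ENNReal.ofReal_mul h1,
          ENNReal.ofReal_mul h2, ENNReal.ofReal_toReal hΩt, ← ofReal_rho]
        gcongr
        exact hu.trans (le_max_left _ _)

end Data

/-! ### Step functions on a grid of cubes -/

section Grid

variable {N : ℕ}

/-- The index of the cube of side `1 / n` containing `x`. -/
noncomputable def cubeIndex (n : ℕ) (x : Eu N) : Fin N → ℤ := fun i => ⌊n * x i⌋

lemma measurable_cubeIndex (n : ℕ) : Measurable (cubeIndex n : Eu N → Fin N → ℤ) := by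
  refine measurable_pi_lambda _ fun i => Int.measurable_floor.comp ?_
  fun_prop

lemma measurableSet_cube (n : ℕ) (m : Fin N → ℤ) :
    MeasurableSet (cubeIndex n ⁻¹' {m} : Set (Eu N)) :=
  measurable_cubeIndex n (measurableSet_singleton m)

lemma volume_cube {n : ℕ} (hn : 0 < n) (m : Fin N → ℤ) :
    volume (cubeIndex n ⁻¹' {m} : Set (Eu N)) = ENNReal.ofReal (((n : ℝ) ^ N)⁻¹) := by
  have hn0 : (0 : ℝ) < n := Nat.cast_pos.2 hn
  have h : (cubeIndex n ⁻¹' {m} : Set (Eu N)) = (@WithLp.ofLp 2 (Fin N → ℝ)) ⁻¹'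
      (Set.pi univ fun i => Ico (m i / n : ℝ) ((m i + 1) / n)) := by
    ext x
    simp only [mem_preimage, mem_singleton_iff, Set.mem_pi, mem_univ, true_imp_iff, funext_iff,
      cubeIndex, Int.floor_eq_iff, mem_Ico]
    refine forall_congr' fun i => ?_
    rw [div_le_iff₀ hn0, lt_div_iff₀ hn0, mul_comm]
  rw [h, (PiLp.volume_preserving_ofLp (Fin N)).measure_preimage
    (MeasurableSet.univ_pi fun _ => measurableSet_Ico).nullMeasurableSet, Real.volume_pi_Ico,
    ← ENNReal.ofReal_prod_of_nonneg]
  · congr 1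
    have : ∀ i, ((m i + 1) / n : ℝ) - m i / n = (n : ℝ)⁻¹ := fun i => by field_simp; ring
    simp [this]
  · intro i _
    rw [sub_nonneg]
    gcongr
    linarith

lemma norm_sub_le_of_cubeIndex_eq {n : ℕ} (hn : 0 < n) {x y : Eu N}
    (h : cubeIndex n x = cubeIndex n y) : ‖x - y‖ ≤ N / n := by
  have hn0 : (0 : ℝ) < n := Nat.cast_pos.2 hn
  rw [EuclideanSpace.norm_eq]
  refine Real.sqrt_le_iff.2 ⟨by positivity, ?_⟩
  have h1 : ∀ i, ‖(x - y) i‖ ^ 2 ≤ ((n : ℝ)⁻¹) ^ 2 := by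
    intro i
    have h2 := congrFun h i
    simp only [cubeIndex] at h2
    have h3 := Int.abs_sub_lt_one_of_floor_eq_floor h2
    rw [← mul_sub, abs_mul, abs_of_pos hn0, ← lt_div_iff₀' hn0, one_div] at h3
    rw [Real.norm_eq_abs]
    exact pow_le_pow_left₀ (abs_nonneg _) h3.le 2
  refine (Finset.sum_le_sum fun i _ => h1 i).trans ?_
  simp only [Finset.sum_const, Finset.card_univ, Fintype.card_fin, nsmul_eq_mul]
  rw [div_eq_mul_inv, mul_pow]
  refine mul_le_mul_of_nonneg_right ?_ (by positivity)
  have : (N : ℝ) ≤ (N : ℝ) ^ 2 := by exact_mod_cast Nat.le_self_pow two_ne_zero N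
  exact this

lemma finite_cubeIndex_image (n : ℕ) (r : ℝ) :
    (cubeIndex n '' (Metric.ball (0 : Eu N) r)).Finite := by
  refine (Set.finite_Icc (fun _ : Fin N => ⌊-(n * r)⌋) (fun _ => ⌊n * r⌋)).subset ?_
  rintro _ ⟨x, hx, rfl⟩
  rw [mem_ball_zero_iff] at hx
  have h : ∀ i, |x i| ≤ r := fun i => by
    have := PiLp.norm_apply_le x i
    rw [Real.norm_eq_abs] at this
    linarith
  refine ⟨fun i => Int.floor_le_floor ?_, fun i => Int.floor_le_floor ?_⟩
  · have := (abs_le.1 (h i)).1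
    rw [← mul_neg]
    gcongr
  · have := (abs_le.1 (h i)).2
    gcongr

/-- The step function with values `c` on the cubes indexed by `I`. -/
noncomputable def stepFun (n : ℕ) (I : Finset (Fin N → ℤ)) (c : I → ℝ) (x : Eu N) : ℝ :=
  if h : cubeIndex n x ∈ I then c ⟨cubeIndex n x, h⟩ else 0

lemma measurable_stepFun (n : ℕ) (I : Finset (Fin N → ℤ)) (c : I → ℝ) :
    Measurable (stepFun n I c) := by
  have : stepFun n I c =
      (fun m : Fin N → ℤ => if h : m ∈ I then c ⟨m, h⟩ else 0) ∘ (cubeIndex n : Eu N → _) := rfl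
  rw [this]
  exact (Measurable.of_discrete).comp (measurable_cubeIndex n)

lemma volume_cubes_lt_top {n : ℕ} (hn : 0 < n) (I : Finset (Fin N → ℤ)) :
    volume (cubeIndex n ⁻¹' (I : Set (Fin N → ℤ)) : Set (Eu N)) < ∞ := by
  rw [← biUnion_preimage_singleton]
  refine measure_biUnion_lt_top I.finite_toSet fun m _ => ?_
  rw [volume_cube hn]
  exact ENNReal.ofReal_lt_top

lemma memLp_stepFun {n : ℕ} (hn : 0 < n) (I : Finset (Fin N → ℤ)) (c : I → ℝ) :
    MemLp (stepFun n I c) 1 volume := by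
  rw [memLp_one_iff_integrable]
  have hS : MeasurableSet (cubeIndex n ⁻¹' (I : Set (Fin N → ℤ)) : Set (Eu N)) :=
    measurable_cubeIndex n I.measurableSet
  have h1 : Integrable ((cubeIndex n ⁻¹' (I : Set (Fin N → ℤ)) : Set (Eu N)).indicator
      fun _ => ‖c‖) := by
    rw [integrable_indicator_iff hS]
    exact integrableOn_const (volume_cubes_lt_top hn I).ne
  refine h1.mono' (measurable_stepFun n I c).aestronglyMeasurable (Eventually.of_forall fun x => ?_)
  by_cases h : cubeIndex n x ∈ I
  · rw [indicator_of_mem (by simpa using h), stepFun, dif_pos h]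
    exact norm_le_pi_norm c _
  · rw [indicator_of_notMem (by simpa using h), stepFun, dif_neg h, norm_zero]

/-- Step functions as a linear map into `L¹`. -/
noncomputable def stepLp {n : ℕ} (hn : 0 < n) (I : Finset (Fin N → ℤ)) :
    (I → ℝ) →ₗ[ℝ] Lp ℝ 1 (volume : Measure (Eu N)) where
  toFun c := (memLp_stepFun hn I c).toLp
  map_add' c d := by
    rw [← MemLp.toLp_add]
    congr 1
    funext x
    simp only [stepFun, Pi.add_apply]
    split_ifs <;> simp
  map_smul' a c := by
    rw [RingHom.id_apply, ← MemLp.toLp_const_smul]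
    congr 1
    funext x
    simp only [stepFun, Pi.smul_apply]
    split_ifs <;> simp

end Grid

/-! ### The inclusion of `X` into `L¹` and its compactness -/

namespace Data

variable {N : ℕ} (D : Data N)

lemma memLp_one (u : D.X) : MemLp (u : Eu N → ℝ) 1 volume := by
  obtain ⟨C, -, hC⟩ := D.exists_lintegral_abs_le
  rw [memLp_one_iff_integrable]
  refine ⟨(D.X_measurable u).aestronglyMeasurable, ?_⟩
  rw [hasFiniteIntegral_iff_norm]
  exact (hC u).trans_lt ENNReal.ofReal_lt_top

/-- The inclusion of `X` into `L¹`. -/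
noncomputable def J : D.X →ₗ[ℝ] Lp ℝ 1 (volume : Measure (Eu N)) where
  toFun u := (D.memLp_one u).toLp
  map_add' u v := by
    rw [← MemLp.toLp_add, MemLp.toLp_eq_toLp_iff]
    exact D.X_add u v
  map_smul' a u := by
    rw [RingHom.id_apply, ← MemLp.toLp_const_smul, MemLp.toLp_eq_toLp_iff]
    exact D.X_smul a u

lemma J_coe (u : D.X) : (D.J u : Eu N → ℝ) =ᵐ[volume] u := MemLp.coeFn_toLp (D.memLp_one u)

lemma enorm_J (u : D.X) : ‖D.J u‖ₑ = ∫⁻ x, ENNReal.ofReal |u x| := by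
  change ‖(D.memLp_one u).toLp‖ₑ = _
  rw [Lp.enorm_toLp, eLpNorm_one_eq_lintegral_enorm]
  simp only [Real.enorm_eq_ofReal_abs]

lemma exists_norm_J_le : ∃ C : ℝ, 0 < C ∧ ∀ u : D.X, ‖D.J u‖ ≤ C * (1 + D.rho u) := by
  obtain ⟨C, hC0, hC⟩ := D.exists_lintegral_abs_le
  refine ⟨C, hC0, fun u => ?_⟩
  have h := hC u
  rw [← enorm_J, ← ofReal_norm] at h
  have := D.rho_nonneg u
  exact (ENNReal.ofReal_le_ofReal_iff (by positivity)).1 h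

/-- The affine bound in `rho` becomes a linear one after normalizing to `K = 1`, where `rho = 1`. -/
lemma continuous_J : Continuous D.J := by
  obtain ⟨C, hC0, hC⟩ := D.exists_norm_J_le
  refine AddMonoidHomClass.continuous_of_bound D.J (2 * C) fun u => ?_
  by_cases hu : u = 0
  · simp [hu]
  · have hK := D.K_pos hu
    have h1 := hC ((D.K u)⁻¹ • u)
    rw [D.rho_inv_K_smul hu, map_smul, norm_smul, norm_inv, Real.norm_of_nonneg hK.le,
      inv_mul_le_iff₀ hK] at h1
    rw [norm_eq_K]
    linarith

/-- Oscillation at distance at most `d` is controlled by the density. -/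
lemma abs_sub_le_density (u : Eu N → ℝ) (x y : Eu N) {d : ℝ} (hd : 0 < d) (hxy : ‖x - y‖ ≤ d) :
    |u x - u y| ≤ d ^ D.s + D.pmax * d ^ N * d ^ D.s * gagliardoDensity D.s D.p u (x, y) := by
  have hp := D.p_pos x y
  have hp1 := D.one_lt_p x y
  have hpm := D.p_le_pmax x y
  have hs := D.s_pos
  have hpm0 := D.pmax_pos
  have hdn := D.density_nonneg u (x, y)
  by_cases hne : x = y
  · subst hne
    rw [sub_self, abs_zero]
    positivity
  have hn : 0 < ‖x - y‖ := norm_pos_iff.2 (sub_ne_zero.2 hne)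
  set q := ‖x - y‖ with hq
  set a := |u x - u y| with ha
  have ha0 : 0 ≤ a := abs_nonneg _
  have hqs : q ^ D.s ≤ d ^ D.s := by gcongr
  -- Once the quotient `a / q^s` exceeds one it is bounded by its `p`-th power, which is the density
  -- up to the factor `p q^N`.
  rcases le_total a (q ^ D.s) with h | h
  · have : 0 ≤ D.pmax * d ^ N * d ^ D.s * gagliardoDensity D.s D.p u (x, y) := by positivity
    linarith
  · have hqs0 : 0 < q ^ D.s := by positivity
    have h1 : a / q ^ D.s ≤ (a / q ^ D.s) ^ D.p x y := by
      simpa using Real.rpow_le_rpow_of_exponent_le ((one_le_div hqs0).2 h) hp1.le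
    have h2 : (a / q ^ D.s) ^ D.p x y = D.p x y * q ^ N * gagliardoDensity D.s D.p u (x, y) := by
      simp only [gagliardoDensity]
      rw [← hq, ← ha, Real.div_rpow ha0 hqs0.le, Real.rpow_add hn, Real.rpow_natCast,
        Real.rpow_mul hn.le]
      field_simp
    have h3 : a ≤ q ^ D.s * (D.p x y * q ^ N * gagliardoDensity D.s D.p u (x, y)) := by
      rw [← h2, ← div_le_iff₀' hqs0]
      exact h1
    calc a ≤ q ^ D.s * (D.p x y * q ^ N * gagliardoDensity D.s D.p u (x, y)) := h3
      _ ≤ d ^ D.s * (D.pmax * d ^ N * gagliardoDensity D.s D.p u (x, y)) := by gcongr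
      _ ≤ _ := by
        have : 0 < d ^ D.s := by positivity
        linarith

/-- Pointwise error of the averages over cubes of side `1 / n`. -/
lemma abs_sub_average_le (u : D.X) {n : ℕ} (hn : 0 < n) (x : Eu N) :
    ENNReal.ofReal |u x - (n : ℝ) ^ N * ∫ y in cubeIndex n ⁻¹' {cubeIndex n x}, u y| ≤
      ENNReal.ofReal ((N / n : ℝ) ^ D.s) +
        ENNReal.ofReal (D.pmax * (N : ℝ) ^ N * (N / n : ℝ) ^ D.s) * D.slice u x := by
  have hn0 : (0 : ℝ) < n := Nat.cast_pos.2 hn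
  have hN := D.natCast_pos
  have hpm0 := D.pmax_pos
  set Q : Set (Eu N) := cubeIndex n ⁻¹' {cubeIndex n x} with hQ
  have hQm : MeasurableSet Q := measurableSet_cube n _
  have hQv : volume Q = ENNReal.ofReal (((n : ℝ) ^ N)⁻¹) := volume_cube hn _
  have hQt : volume Q ≠ ∞ := by rw [hQv]; exact ENNReal.ofReal_ne_top
  have hint : Integrable u := memLp_one_iff_integrable.1 (D.memLp_one u)
  have e1 : u x - (n : ℝ) ^ N * ∫ y in Q, u y = (n : ℝ) ^ N * ∫ y in Q, (u x - u y) := by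
    have hcst : Integrable (fun _ : Eu N => u x) (volume.restrict Q) := integrableOn_const hQt
    rw [integral_sub hcst hint.integrableOn, setIntegral_const, measureReal_def,
      hQv, ENNReal.toReal_ofReal (by positivity), smul_eq_mul]
    field_simp
  set d : ℝ := N / n with hd
  have hd0 : 0 < d := by positivity
  rw [e1, abs_mul, abs_of_pos (by positivity : (0 : ℝ) < (n : ℝ) ^ N),
    ENNReal.ofReal_mul (by positivity)]
  calc ENNReal.ofReal ((n : ℝ) ^ N) * ENNReal.ofReal |∫ y in Q, (u x - u y)|
      ≤ ENNReal.ofReal ((n : ℝ) ^ N) * ∫⁻ y in Q, ENNReal.ofReal |u x - u y| := by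
        gcongr
        have := enorm_integral_le_lintegral_enorm (μ := volume.restrict Q) fun y => u x - u y
        simpa only [Real.enorm_eq_ofReal_abs] using this
    _ ≤ ENNReal.ofReal ((n : ℝ) ^ N) * ∫⁻ y in Q, (ENNReal.ofReal (d ^ D.s) +
          ENNReal.ofReal (D.pmax * d ^ N * d ^ D.s) *
            ENNReal.ofReal (gagliardoDensity D.s D.p u (x, y))) := by
        gcongr _ * ?_
        refine setLIntegral_mono' hQm fun y hy => ?_
        rw [← ENNReal.ofReal_mul (by positivity), ← ENNReal.ofReal_add (by positivity)
          (mul_nonneg (by positivity) (D.density_nonneg _ _))]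
        refine ENNReal.ofReal_le_ofReal (D.abs_sub_le_density u x y hd0 ?_)
        exact norm_sub_le_of_cubeIndex_eq hn (by simpa [hQ, eq_comm] using hy)
    _ ≤ ENNReal.ofReal ((n : ℝ) ^ N) * (ENNReal.ofReal (d ^ D.s) * volume Q +
          ENNReal.ofReal (D.pmax * d ^ N * d ^ D.s) * D.slice u x) := by
        rw [lintegral_add_left measurable_const, setLIntegral_const,
          lintegral_const_mul' _ _ ENNReal.ofReal_ne_top]
        gcongr
        exact setLIntegral_le_lintegral _ _
    _ = _ := by
        rw [mul_add, hQv, ← ENNReal.ofReal_mul (by positivity), ← ENNReal.ofReal_mul (by positivity),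
          ← mul_assoc (ENNReal.ofReal ((n : ℝ) ^ N)) _ (D.slice u x),
          ← ENNReal.ofReal_mul (by positivity)]
        congr 3
        · field_simp
        · rw [hd, div_pow]
          field_simp

/-- Sublevel sets of the modular are totally bounded in `L¹`. -/
lemma totallyBounded_J_image (R : ℝ) : TotallyBounded (D.J '' {u | D.rho u ≤ R}) := by
  obtain ⟨C, hC0, hC⟩ := D.exists_norm_J_le
  obtain ⟨r, hr1, hr⟩ := D.exists_subset_ball
  have hN := D.natCast_pos
  have hpm0 := D.pmax_pos
  set W := (volume (Metric.ball (0 : Eu N) (r + N))).toReal with hW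
  have hW0 : 0 ≤ W := ENNReal.toReal_nonneg
  set B := W + D.pmax * (N : ℝ) ^ N * max R 0 with hB
  have hB0 : 0 ≤ B := by positivity
  rw [Metric.totallyBounded_iff]
  intro ε hε
  -- Replacing `u` by its averages over cubes of side `1 / n` costs at most `(N / n)^s B` in `L¹`,
  -- uniformly over the sublevel set. The averages form a bounded subset of a finite-dimensional
  -- space, which is covered by finitely many balls of radius `ε / 2`.
  obtain ⟨n, hn, hnε⟩ : ∃ n : ℕ, 0 < n ∧ (N / n : ℝ) ^ D.s * B < ε / 2 := by
    have h1 : Tendsto (fun n : ℕ => (N / n : ℝ) ^ D.s * B) atTop (𝓝 (0 ^ D.s * B)) :=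
      (((tendsto_const_div_atTop_nhds_zero_nat (N : ℝ)).rpow_const
        (Or.inr D.s_pos.le))).mul_const B
    rw [Real.zero_rpow D.s_pos.ne', zero_mul] at h1
    obtain ⟨n, h2, h3⟩ := ((h1.eventually_lt_const (half_pos hε)).and (eventually_gt_atTop 0)).exists
    exact ⟨n, h3, h2⟩
  have hn0 : (0 : ℝ) < n := Nat.cast_pos.2 hn
  have hn1 : (1 : ℝ) ≤ n := by exact_mod_cast hn
  set I := (finite_cubeIndex_image (N := N) n r).toFinset with hI
  set c : D.X → I → ℝ := fun u m => (n : ℝ) ^ N * ∫ y in cubeIndex n ⁻¹' {m.1}, u y with hc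
  have hcb : ∀ u, D.rho u ≤ R → c u ∈ Metric.closedBall (0 : I → ℝ)
      ((n : ℝ) ^ N * (C * (1 + max R 0))) := by
    intro u hu
    rw [mem_closedBall_zero_iff, pi_norm_le_iff_of_nonneg (by positivity)]
    intro m
    rw [hc, norm_mul, norm_pow, Real.norm_natCast]
    gcongr
    have hint : Integrable u := memLp_one_iff_integrable.1 (D.memLp_one u)
    refine (norm_integral_le_integral_norm _).trans
      ((setIntegral_le_integral hint.norm (Eventually.of_forall fun _ => norm_nonneg _)).trans ?_)
    have h1 : ‖D.J u‖ = ∫ y, ‖u y‖ := by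
      rw [L1.norm_eq_integral_norm]
      refine integral_congr_ae ?_
      filter_upwards [D.J_coe u] with y hy
      rw [hy]
    rw [← h1]
    refine (hC u).trans ?_
    gcongr
    exact hu.trans (le_max_left _ _)
  have happrox : ∀ u, D.rho u ≤ R → dist (D.J u) (stepLp hn I (c u)) < ε / 2 := by
    intro u hu
    refine lt_of_le_of_lt ?_ hnε
    rw [dist_eq_norm]
    have h0 : ‖D.J u - stepLp hn I (c u)‖ₑ ≤ ENNReal.ofReal ((N / n : ℝ) ^ D.s * B) := by
      change ‖(D.memLp_one u).toLp - (memLp_stepFun hn I (c u)).toLp‖ₑ ≤ _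
      rw [← MemLp.toLp_sub, Lp.enorm_toLp, eLpNorm_one_eq_lintegral_enorm]
      set S : Set (Eu N) := cubeIndex n ⁻¹' (I : Set (Fin N → ℤ)) with hS
      have hSm : MeasurableSet S := measurable_cubeIndex n I.measurableSet
      have hSsub : S ⊆ Metric.ball 0 (r + N) := by
        intro x hx
        rw [hS, mem_preimage, hI, Finite.coe_toFinset] at hx
        obtain ⟨y, hy, hxy⟩ := hx
        rw [mem_ball_zero_iff] at hy ⊢
        have h1 := norm_sub_le_of_cubeIndex_eq hn hxy
        have h2 : (N / n : ℝ) ≤ N := div_le_self hN.le hn1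
        have h3 : ‖x‖ ≤ ‖y‖ + ‖y - x‖ := by
          have := norm_sub_le y (y - x); simpa using this
        linarith
      calc ∫⁻ x, ‖(⇑(u : D.X) - stepFun n I (c u)) x‖ₑ
          ≤ ∫⁻ x, (S.indicator (fun _ => ENNReal.ofReal ((N / n : ℝ) ^ D.s)) x +
            ENNReal.ofReal (D.pmax * (N : ℝ) ^ N * (N / n : ℝ) ^ D.s) * D.slice u x) := by
            refine lintegral_mono_ae ?_
            filter_upwards [D.X_ae_zero u] with x hx
            rw [Pi.sub_apply, Real.enorm_eq_ofReal_abs]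
            by_cases hxS : cubeIndex n x ∈ I
            · rw [indicator_of_mem (by simpa [hS] using hxS), stepFun, dif_pos hxS]
              exact D.abs_sub_average_le u hn x
            · have hxΩ : x ∉ D.Ω := fun h => hxS (by
                rw [hI, Finite.mem_toFinset]
                exact ⟨x, hr h, rfl⟩)
              rw [stepFun, dif_neg hxS, hx hxΩ, sub_self, abs_zero, ENNReal.ofReal_zero]
              exact zero_le
        _ = ENNReal.ofReal ((N / n : ℝ) ^ D.s) * volume S +
            ENNReal.ofReal (D.pmax * (N : ℝ) ^ N * (N / n : ℝ) ^ D.s) *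
              gagliardoModular D.s D.p u := by
            rw [lintegral_add_left (measurable_const.indicator hSm),
              lintegral_indicator_const hSm, lintegral_const_mul' _ _ ENNReal.ofReal_ne_top,
              D.lintegral_slice (D.X_measurable u)]
        _ ≤ ENNReal.ofReal ((N / n : ℝ) ^ D.s) * ENNReal.ofReal W +
            ENNReal.ofReal (D.pmax * (N : ℝ) ^ N * (N / n : ℝ) ^ D.s) *
              ENNReal.ofReal (max R 0) := by
            rw [← ofReal_rho, hW, ENNReal.ofReal_toReal measure_ball_lt_top.ne]
            gcongr
            exact hu.trans (le_max_left _ _)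
        _ = _ := by
            rw [← ENNReal.ofReal_mul (by positivity), ← ENNReal.ofReal_mul (by positivity),
              ← ENNReal.ofReal_add (by positivity) (by positivity), hB]
            congr 1
            ring
    rw [← ofReal_norm] at h0
    exact (ENNReal.ofReal_le_ofReal_iff (by positivity)).1 h0
  have htb : TotallyBounded (stepLp hn I '' Metric.closedBall (0 : I → ℝ)
      ((n : ℝ) ^ N * (C * (1 + max R 0)))) :=
    ((isCompact_closedBall _ _).image
      (LinearMap.continuous_of_finiteDimensional (stepLp hn I))).totallyBounded
  obtain ⟨t, ht, hts⟩ := Metric.totallyBounded_iff.1 htb (ε / 2) (half_pos hε)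
  refine ⟨t, ht, ?_⟩
  rintro _ ⟨u, hu, rfl⟩
  obtain ⟨y, hy, hyd⟩ := mem_iUnion₂.1 (hts ⟨c u, hcb u hu, rfl⟩)
  refine mem_iUnion₂.2 ⟨y, hy, ?_⟩
  rw [Metric.mem_ball] at hyd ⊢
  have := dist_triangle (D.J u) (stepLp hn I (c u)) y
  linarith [happrox u hu]

end Data

/-! ### Limits of integrals under a.e. convergence -/

section Limits

variable {α : Type*} [MeasurableSpace α] {μ : Measure α}

/-- Convergence of integrals under a.e. convergence and a bound in `L^{1+κ}`. -/
lemma tendsto_integral_of_rpow_bound [IsFiniteMeasure μ] {f : ℕ → α → ℝ} {g : α → ℝ} {κ B : ℝ}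
    (hκ : 0 < κ) (hf : ∀ j, AEStronglyMeasurable (f j) μ)
    (hfg : ∀ᵐ x ∂μ, Tendsto (fun j => f j x) atTop (𝓝 (g x)))
    (hB : ∀ j, ∫⁻ x, ENNReal.ofReal (|f j x| ^ (1 + κ)) ∂μ ≤ ENNReal.ofReal B) :
    Tendsto (fun j => ∫ x, f j x ∂μ) atTop (𝓝 (∫ x, g x ∂μ)) := by
  have hg : AEStronglyMeasurable g μ := aestronglyMeasurable_of_tendsto_ae atTop hf hfg
  have hint : ∀ h : α → ℝ, AEStronglyMeasurable h μ →
      ∫⁻ x, ENNReal.ofReal (|h x| ^ (1 + κ)) ∂μ ≤ ENNReal.ofReal B → Integrable h μ := by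
    intro h hm hh
    refine ⟨hm, ?_⟩
    rw [hasFiniteIntegral_iff_norm]
    calc ∫⁻ x, ENNReal.ofReal ‖h x‖ ∂μ ≤ ∫⁻ x, (1 + ENNReal.ofReal (|h x| ^ (1 + κ))) ∂μ := by
          refine lintegral_mono fun x => ?_
          rw [← ENNReal.ofReal_one, ← ENNReal.ofReal_add zero_le_one (by positivity)]
          refine ENNReal.ofReal_le_ofReal ?_
          rw [Real.norm_eq_abs]
          rcases le_total |h x| 1 with h1 | h1
          · have : 0 ≤ |h x| ^ (1 + κ) := by positivity
            linarith
          · have : |h x| ≤ |h x| ^ (1 + κ) := by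
              simpa using Real.rpow_le_rpow_of_exponent_le h1 (by linarith : (1 : ℝ) ≤ 1 + κ)
            linarith
      _ < ∞ := by
          rw [lintegral_add_left measurable_const]
          refine ENNReal.add_lt_top.2 ⟨?_, hh.trans_lt ENNReal.ofReal_lt_top⟩
          simp
  have hgB : ∫⁻ x, ENNReal.ofReal (|g x| ^ (1 + κ)) ∂μ ≤ ENNReal.ofReal B := by
    calc ∫⁻ x, ENNReal.ofReal (|g x| ^ (1 + κ)) ∂μ
        = ∫⁻ x, liminf (fun j => ENNReal.ofReal (|f j x| ^ (1 + κ))) atTop ∂μ := by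
          refine lintegral_congr_ae ?_
          filter_upwards [hfg] with x hx
          exact (ENNReal.tendsto_ofReal (hx.abs.rpow_const (Or.inr (by positivity)))).liminf_eq.symm
      _ ≤ liminf (fun j => ∫⁻ x, ENNReal.ofReal (|f j x| ^ (1 + κ)) ∂μ) atTop :=
          lintegral_liminf_le' fun j => by
            have := (hf j).aemeasurable
            fun_prop
      _ ≤ ENNReal.ofReal B :=
          liminf_le_of_frequently_le' (Frequently.of_forall hB)
  have hui : UnifIntegrable f 1 μ := by
    -- Where `|f j| ≥ C` one has `|f j| ≤ C^(-κ) |f j|^(1+κ)`, so the tails are uniformly small and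
    -- Vitali's theorem applies.
    refine unifIntegrable_of le_rfl ENNReal.one_ne_top hf fun ε hε => ?_
    have hlim : Tendsto (fun C : ℝ => C ^ (-κ) * B) atTop (𝓝 (0 * B)) :=
      (tendsto_rpow_neg_atTop hκ).mul_const B
    rw [zero_mul] at hlim
    obtain ⟨C, hC, hC1⟩ := ((hlim.eventually_lt_const hε).and (eventually_ge_atTop 1)).exists
    have hC0 : 0 < C := by linarith
    refine ⟨⟨C, hC0.le⟩, fun j => ?_⟩
    rw [eLpNorm_one_eq_lintegral_enorm]
    calc ∫⁻ x, ‖({x | (⟨C, hC0.le⟩ : NNReal) ≤ ‖f j x‖₊}.indicator (f j)) x‖ₑ ∂μ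
        ≤ ∫⁻ x, ENNReal.ofReal (C ^ (-κ)) * ENNReal.ofReal (|f j x| ^ (1 + κ)) ∂μ := by
          refine lintegral_mono fun x => ?_
          by_cases hx : x ∈ {x | (⟨C, hC0.le⟩ : NNReal) ≤ ‖f j x‖₊}
          · rw [indicator_of_mem hx, Real.enorm_eq_ofReal_abs, ← ENNReal.ofReal_mul (by positivity)]
            refine ENNReal.ofReal_le_ofReal ?_
            have hx' : C ≤ |f j x| := hx
            have h0 : 0 < |f j x| := hC0.trans_le hx'
            rw [Real.rpow_add h0, Real.rpow_one, Real.rpow_neg hC0.le]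
            have h1 : 1 ≤ (C ^ κ)⁻¹ * |f j x| ^ κ := by
              rw [← div_eq_inv_mul, one_le_div (by positivity)]
              gcongr
            nlinarith
          · rw [indicator_of_notMem hx, enorm_zero]
            exact zero_le
      _ ≤ ENNReal.ofReal (C ^ (-κ)) * ENNReal.ofReal B := by
          rw [lintegral_const_mul' _ _ ENNReal.ofReal_ne_top]
          gcongr
          exact hB j
      _ ≤ ENNReal.ofReal ε := by
          rw [← ENNReal.ofReal_mul (by positivity)]
          exact ENNReal.ofReal_le_ofReal hC.le
  exact tendsto_integral_of_L1' g hg (Eventually.of_forall fun j => hint _ (hf j) (hB j))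
    (tendsto_Lp_finite_of_tendsto_ae le_rfl ENNReal.one_ne_top hf
      (memLp_one_iff_integrable.2 (hint g hg hgB)) hui hfg)

/-- A Brezis–Lieb type lemma: domination by an a.e. convergent sequence with convergent
integrals. -/
lemma tendsto_integral_zero_of_dominated {f h : ℕ → α → ℝ} {g : α → ℝ} {C : ℝ} (hC : 0 ≤ C)
    (hf : ∀ j, Integrable (f j) μ) (hg : Integrable g μ) (hf0 : ∀ j x, 0 ≤ f j x)
    (hg0 : ∀ x, 0 ≤ g x) (hfg : ∀ᵐ x ∂μ, Tendsto (fun j => f j x) atTop (𝓝 (g x)))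
    (hlim : Tendsto (fun j => ∫ x, f j x ∂μ) atTop (𝓝 (∫ x, g x ∂μ)))
    (hm : ∀ j, AEStronglyMeasurable (h j) μ) (hh0 : ∀ j, ∀ᵐ x ∂μ, 0 ≤ h j x)
    (hle : ∀ j, ∀ᵐ x ∂μ, h j x ≤ C * (f j x + g x))
    (hhl : ∀ᵐ x ∂μ, Tendsto (fun j => h j x) atTop (𝓝 0)) :
    Tendsto (fun j => ∫ x, h j x ∂μ) atTop (𝓝 0) := by
  -- The part `(g - f j)⁺` is dominated by `g`, and `∫ f j → ∫ g` transfers its vanishing to `(f j -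
  -- g)⁺`. Writing `C (f j + g) = 2 C g + C (f j - g)` yields `h j ≤ min (h j) (2 C g) + C (f j -
  -- g)⁺`, whose first term is dominated.
  have h1 : Tendsto (fun j => ∫ x, max (g x - f j x) 0 ∂μ) atTop (𝓝 (∫ _, (0 : ℝ) ∂μ)) := by
    refine tendsto_integral_of_dominated_convergence g
      (fun j => ((hg.sub (hf j)).pos_part).aestronglyMeasurable) hg
      (fun j => Eventually.of_forall fun x => ?_) ?_
    · rw [Real.norm_of_nonneg (le_max_right _ _)]
      exact max_le (by linarith [hf0 j x]) (hg0 x)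
    · filter_upwards [hfg] with x hx
      simpa using (hx.const_sub (g x)).max (tendsto_const_nhds (x := (0 : ℝ)))
  have h2 : ∀ j, ∫ x, max (f j x - g x) 0 ∂μ
      = (∫ x, f j x ∂μ) - (∫ x, g x ∂μ) + ∫ x, max (g x - f j x) 0 ∂μ := by
    intro j
    have hA : Integrable (fun x => f j x - g x) μ := (hf j).sub hg
    have hB : Integrable (fun x => max (g x - f j x) 0) μ := (hg.sub (hf j)).pos_part
    rw [← integral_sub (hf j) hg, ← integral_add hA hB]
    refine integral_congr_ae (Eventually.of_forall fun x => ?_)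
    simp only
    rcases le_total (f j x) (g x) with h | h
    · rw [max_eq_right (by linarith), max_eq_left (by linarith)]; ring
    · rw [max_eq_left (by linarith), max_eq_right (by linarith)]; ring
  have h3 : Tendsto (fun j => ∫ x, max (f j x - g x) 0 ∂μ) atTop (𝓝 0) := by
    simp only [h2]
    simpa using (hlim.sub_const (∫ x, g x ∂μ)).add h1
  have hb : Integrable (fun x => 2 * C * g x) μ := hg.const_mul _
  have h4 : Tendsto (fun j => ∫ x, min (h j x) (2 * C * g x) ∂μ) atTop
      (𝓝 (∫ _, (0 : ℝ) ∂μ)) := by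
    refine tendsto_integral_of_dominated_convergence (fun x => 2 * C * g x)
      (fun j => (hm j).inf hb.aestronglyMeasurable) hb (fun j => ?_) ?_
    · filter_upwards [hh0 j] with x hx
      have := hg0 x
      rw [Real.norm_of_nonneg (le_min hx (by positivity))]
      exact min_le_right _ _
    · filter_upwards [hhl] with x hx
      have := hg0 x
      simpa [min_eq_left (show 0 ≤ 2 * C * g x by positivity)] using
        hx.min (tendsto_const_nhds (x := 2 * C * g x))
  have h5 : Tendsto (fun j => (∫ x, min (h j x) (2 * C * g x) ∂μ) +
      C * ∫ x, max (f j x - g x) 0 ∂μ) atTop (𝓝 0) := by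
    simpa using h4.add (h3.const_mul C)
  refine squeeze_zero (fun j => integral_nonneg_of_ae (hh0 j)) (fun j => ?_) h5
  have hi1 : Integrable (fun x => min (h j x) (2 * C * g x)) μ := by
    refine hb.mono' ((hm j).inf hb.aestronglyMeasurable) ?_
    filter_upwards [hh0 j] with x hx
    have := hg0 x
    rw [Real.norm_of_nonneg (le_min hx (by positivity))]
    exact min_le_right _ _
  have hi2 : Integrable (fun x => C * max (f j x - g x) 0) μ := ((hf j).sub hg).pos_part.const_mul C
  have hi3 : Integrable (h j) μ := by
    refine (((hf j).add hg).const_mul C).mono' (hm j) ?_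
    filter_upwards [hh0 j, hle j] with x hx hx'
    rw [Real.norm_of_nonneg hx]
    exact hx'
  rw [← integral_const_mul, ← integral_add hi1 hi2]
  refine integral_mono_ae hi3 (hi1.add hi2) ?_
  filter_upwards [hle j] with x hx
  rcases le_total (h j x) (2 * C * g x) with h | h
  · rw [min_eq_left h]
    have := mul_nonneg hC (le_max_right (f j x - g x) 0)
    linarith
  · rw [min_eq_right h]
    have := mul_le_mul_of_nonneg_left (le_max_left (f j x - g x) 0) hC
    linarith

end Limits

/-! ### A.e. convergence with bounded modulars -/

namespace Data

variable {N : ℕ} (D : Data N)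

/-- Almost everywhere convergence with bounded modulars. -/
structure TendstoBdd (u : ℕ → D.X) (w : D.X) : Prop where
  bdd : ∃ R, ∀ j, D.rho (u j) ≤ R
  ae : ∀ᵐ x, Tendsto (fun j => u j x) atTop (𝓝 (w x))

variable {D}

lemma TendstoBdd.comp {u : ℕ → D.X} {w : D.X} (h : D.TendstoBdd u w) {φ : ℕ → ℕ}
    (hφ : Tendsto φ atTop atTop) : D.TendstoBdd (u ∘ φ) w := by
  obtain ⟨R, hR⟩ := h.bdd
  refine ⟨⟨R, fun j => hR _⟩, ?_⟩
  filter_upwards [h.ae] with x hx using hx.comp hφ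

lemma TendstoBdd.smul {u : ℕ → D.X} {w : D.X} (h : D.TendstoBdd u w) (c : ℝ) :
    D.TendstoBdd (fun j => c • u j) (c • w) := by
  obtain ⟨R, hR⟩ := h.bdd
  refine ⟨⟨(max 1 |c|) ^ D.pmax * R, fun j => ?_⟩, ?_⟩
  · have h1 : D.rho (c • u j) ≤ (max 1 |c|) ^ D.pmax * D.rho (u j) := by
      have hle : gagliardoModular D.s D.p (fun x => c * u j x)
          ≤ ENNReal.ofReal ((max 1 |c|) ^ D.pmax) * gagliardoModular D.s D.p (u j) := by
        unfold gagliardoModular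
        rw [← lintegral_const_mul' _ _ ENNReal.ofReal_ne_top]
        refine lintegral_mono fun z => ?_
        simp only
        rw [← ENNReal.ofReal_mul (by positivity)]
        refine ENNReal.ofReal_le_ofReal ?_
        unfold gagliardoDensity
        have hp := D.p_pos z.1 z.2
        rw [← mul_sub, ← mul_div_assoc]
        exact div_le_div_of_nonneg_right (abs_mul_rpow_le hp.le (D.p_le_pmax _ _) _ _)
          (by positivity)
      rw [← D.modular_congr (D.X_smul c (u j)), ← ofReal_rho, ← ofReal_rho,
        ← ENNReal.ofReal_mul (by positivity)] at hle
      exact (ENNReal.ofReal_le_ofReal_iff (mul_nonneg (by positivity) (D.rho_nonneg _))).1 hle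
    exact h1.trans (by gcongr; exact hR j)
  · filter_upwards [h.ae, ae_all_iff.2 fun j => D.X_smul c (u j), D.X_smul c w] with x hx h1 h2
    simp only [h1, h2]
    exact hx.const_mul c

variable (D)

lemma tendstoBdd_const (w : D.X) : D.TendstoBdd (fun _ => w) w :=
  ⟨⟨D.rho w, fun _ => le_rfl⟩, Eventually.of_forall fun _ => tendsto_const_nhds⟩

lemma tendsto_density {u : ℕ → Eu N → ℝ} {w : Eu N → ℝ}
    (h : ∀ᵐ x, Tendsto (fun j => u j x) atTop (𝓝 (w x))) :
    ∀ᵐ z : Eu N × Eu N, Tendsto (fun j => gagliardoDensity D.s D.p (u j) z) atTop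
      (𝓝 (gagliardoDensity D.s D.p w z)) := by
  have h1 : ∀ᵐ z : Eu N × Eu N, Tendsto (fun j => u j z.1) atTop (𝓝 (w z.1)) :=
    Measure.quasiMeasurePreserving_fst.ae h
  have h2 : ∀ᵐ z : Eu N × Eu N, Tendsto (fun j => u j z.2) atTop (𝓝 (w z.2)) :=
    Measure.quasiMeasurePreserving_snd.ae h
  filter_upwards [h1, h2] with z hz1 hz2
  exact ((hz1.sub hz2).abs.rpow_const (Or.inr (D.p_pos _ _).le)).div_const _

/-- Fatou's lemma for the Gagliardo modular. -/
lemma modular_le_of_tendsto {u : ℕ → Eu N → ℝ} {w : Eu N → ℝ} (hu : ∀ j, Measurable (u j))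
    (h : ∀ᵐ x, Tendsto (fun j => u j x) atTop (𝓝 (w x))) {R : ℝ≥0∞}
    (hR : ∀ᶠ j in atTop, gagliardoModular D.s D.p (u j) ≤ R) : gagliardoModular D.s D.p w ≤ R := by
  calc gagliardoModular D.s D.p w
      = ∫⁻ z : Eu N × Eu N, liminf (fun j => ENNReal.ofReal (gagliardoDensity D.s D.p (u j) z)) atTop := by
        refine lintegral_congr_ae ?_
        filter_upwards [D.tendsto_density h] with z hz
        exact (ENNReal.tendsto_ofReal hz).liminf_eq.symm
    _ ≤ liminf (fun j => gagliardoModular D.s D.p (u j)) atTop :=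
        lintegral_liminf_le fun j => (D.measurable_density (hu j)).ennreal_ofReal
    _ ≤ R := liminf_le_of_frequently_le' hR.frequently

lemma TendstoBdd.rho_le {D : Data N} {u : ℕ → D.X} {w : D.X} (h : D.TendstoBdd u w) {R : ℝ}
    (hR : ∀ᶠ j in atTop, D.rho (u j) ≤ R) : D.rho w ≤ R := by
  have hR0 : 0 ≤ R := by
    obtain ⟨j, hj⟩ := hR.exists
    exact (D.rho_nonneg _).trans hj
  have := D.modular_le_of_tendsto (fun j => D.X_measurable (u j)) h.ae (R := ENNReal.ofReal R) (by
    filter_upwards [hR] with j hj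
    rw [← ofReal_rho]
    exact ENNReal.ofReal_le_ofReal hj)
  rw [← ofReal_rho] at this
  exact (ENNReal.ofReal_le_ofReal_iff hR0).1 this

lemma TendstoBdd.K_le {D : Data N} {u : ℕ → D.X} {w : D.X} (h : D.TendstoBdd u w) {t : ℝ}
    (ht : 0 < t) (hK : ∀ᶠ j in atTop, D.K (u j) ≤ t) : D.K w ≤ t := by
  rw [D.K_le_iff _ ht]
  refine (h.smul t⁻¹).rho_le ?_
  filter_upwards [hK] with j hj
  exact (D.K_le_iff _ ht).1 hj

lemma rpow_le_one_add {a q r : ℝ} (ha : 0 ≤ a) (hq : 0 ≤ q) (hr : q ≤ r) : a ^ q ≤ 1 + a ^ r := by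
  rcases le_total a 1 with h | h
  · have h1 := Real.rpow_le_one ha h hq
    have : 0 ≤ a ^ r := by positivity
    linarith
  · have := Real.rpow_le_rpow_of_exponent_le h hr
    linarith

lemma exists_integral_rpow_pbar_le (R : ℝ) : ∃ C : ℝ, 0 ≤ C ∧ ∀ u : D.X, D.rho u ≤ R →
    ∫⁻ x in D.Ω, ENNReal.ofReal (|u x| ^ D.pbar x) ≤ ENNReal.ofReal C := by
  obtain ⟨C, hC0, hC⟩ := D.exists_higher_integrability R
  have hΩt : volume D.Ω ≠ ∞ := D.isBounded_Ω.measure_lt_top.ne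
  refine ⟨(volume D.Ω).toReal + C, by positivity, fun u hu => ?_⟩
  rw [ENNReal.ofReal_add (by positivity) hC0, ENNReal.ofReal_toReal hΩt]
  refine le_trans ?_ (add_le_add_right (hC u hu) _)
  rw [← one_mul (volume D.Ω), ← setLIntegral_const, ← lintegral_add_left measurable_const]
  refine lintegral_mono fun x => ?_
  have h := rpow_le_one_add (abs_nonneg (u x)) (D.pbar_pos x).le
    (le_add_of_nonneg_right D.gain_pos.le : D.pbar x ≤ D.pbar x + D.gain)
  rw [← ENNReal.ofReal_one, ← ENNReal.ofReal_add zero_le_one (by positivity)]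
  exact ENNReal.ofReal_le_ofReal h

/-- Sequences with bounded modulars have a.e. convergent subsequences, with limit in `X`. -/
theorem exists_subseq_tendstoBdd {u : ℕ → D.X} {R : ℝ} (hR : ∀ j, D.rho (u j) ≤ R) :
    ∃ φ : ℕ → ℕ, StrictMono φ ∧ ∃ w : D.X, D.TendstoBdd (u ∘ φ) w := by
  have hc : IsCompact (closure (D.J '' {u | D.rho u ≤ R})) :=
    (D.totallyBounded_J_image R).closure.isCompact_of_isClosed isClosed_closure
  obtain ⟨g, -, φ, hφ, hg⟩ := hc.tendsto_subseq (x := fun j => D.J (u j))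
    fun j => subset_closure ⟨u j, hR j, rfl⟩
  obtain ⟨ψ, hψ, hae⟩ := (tendstoInMeasure_of_tendsto_Lp hg).exists_seq_tendsto_ae
  set g' : Eu N → ℝ := ⇑g with hg'
  have hgm : Measurable g' := (Lp.stronglyMeasurable g).measurable
  have hlim : ∀ᵐ x, Tendsto (fun j => u (φ (ψ j)) x) atTop (𝓝 (g' x)) := by
    filter_upwards [hae, ae_all_iff.2 fun j => D.J_coe (u j)] with x hx hJ
    simpa only [Function.comp_apply, hJ] using hx
  have hzero : ∀ᵐ x, x ∉ D.Ω → g' x = 0 := by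
    filter_upwards [hlim, ae_all_iff.2 fun j => D.X_ae_zero (u j)] with x hx h0 hxΩ
    simp only [h0 _ hxΩ] at hx
    exact tendsto_nhds_unique hx tendsto_const_nhds
  have hmod : gagliardoModular D.s D.p g' ≤ ENNReal.ofReal R := by
    refine D.modular_le_of_tendsto (fun j => D.X_measurable _) hlim (Eventually.of_forall fun j => ?_)
    rw [← ofReal_rho]
    exact ENNReal.ofReal_le_ofReal (hR _)
  obtain ⟨C, -, hC⟩ := D.exists_integral_rpow_pbar_le R
  have hp : Measurable D.pbar := D.measurable_pbar
  have hpb : D.pbarModular g' ≤ ENNReal.ofReal C := by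
    unfold pbarModular
    rw [D.lintegral_eq_setLIntegral (by
      filter_upwards [hzero] with x hx hxΩ
      rw [hx hxΩ, abs_zero, Real.zero_rpow (D.pbar_pos x).ne', ENNReal.ofReal_zero])]
    calc ∫⁻ x in D.Ω, ENNReal.ofReal (|g' x| ^ D.pbar x)
        = ∫⁻ x in D.Ω, liminf (fun j => ENNReal.ofReal (|u (φ (ψ j)) x| ^ D.pbar x)) atTop := by
          refine lintegral_congr_ae (ae_restrict_of_ae ?_)
          filter_upwards [hlim] with x hx
          exact (ENNReal.tendsto_ofReal
            (hx.abs.rpow_const (Or.inr (D.pbar_pos x).le))).liminf_eq.symm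
      _ ≤ liminf (fun j => ∫⁻ x in D.Ω, ENNReal.ofReal (|u (φ (ψ j)) x| ^ D.pbar x)) atTop :=
          lintegral_liminf_le fun j => by
            have := D.X_measurable (u (φ (ψ j)))
            fun_prop
      _ ≤ ENNReal.ofReal C :=
          liminf_le_of_frequently_le' (Frequently.of_forall fun j => hC _ (hR _))
  refine ⟨φ ∘ ψ, hφ.comp hψ, D.mkX g' hgm (hpb.trans_lt ENNReal.ofReal_lt_top)
    (hmod.trans_lt ENNReal.ofReal_lt_top) hzero, ⟨R, fun j => hR _⟩, ?_⟩
  filter_upwards [hlim, D.mkX_coe g' hgm (hpb.trans_lt ENNReal.ofReal_lt_top)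
    (hmod.trans_lt ENNReal.ofReal_lt_top) hzero] with x hx h1
  rw [h1]
  exact hx

/-- Norm convergence implies `TendstoBdd` along a subsequence. -/
lemma exists_subseq_of_tendsto {u : ℕ → D.X} {w : D.X} (h : Tendsto u atTop (𝓝 w)) :
    ∃ φ : ℕ → ℕ, StrictMono φ ∧ D.TendstoBdd (u ∘ φ) w := by
  obtain ⟨ψ, hψ, hae⟩ := (tendstoInMeasure_of_tendsto_Lp
    ((D.continuous_J.tendsto w).comp h)).exists_seq_tendsto_ae
  obtain ⟨R, hR⟩ := h.norm.bddAbove_range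
  refine ⟨ψ, hψ, ⟨(max R 1) ^ D.pmax, fun j => D.rho_le_of_K_le (le_max_right _ _)
    ((hR ⟨ψ j, rfl⟩).trans (le_max_left _ _))⟩, ?_⟩
  filter_upwards [hae, ae_all_iff.2 fun j => D.J_coe (u j), D.J_coe w] with x hx hJ hJw
  simpa only [Function.comp_apply, hJ, hJw] using hx

/-- Convergence of lower-order integrals. -/
theorem TendstoBdd.tendsto_integral {D : Data N} {u v : ℕ → D.X} {w z : D.X} (hu : D.TendstoBdd u w)
    (hv : D.TendstoBdd v z) {f : ℕ → Eu N → ℝ} {g : Eu N → ℝ} (hf : ∀ j, Measurable (f j))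
    (hle : ∀ j x, |f j x| ≤ |u j x| ^ D.pbar x + |v j x| ^ D.pbar x)
    (hfg : ∀ᵐ x, Tendsto (fun j => f j x) atTop (𝓝 (g x))) :
    Tendsto (fun j => ∫ x in D.Ω, f j x) atTop (𝓝 (∫ x in D.Ω, g x)) := by
  obtain ⟨R₁, hR₁⟩ := hu.bdd
  obtain ⟨R₂, hR₂⟩ := hv.bdd
  obtain ⟨C₁, hC₁0, hC₁⟩ := D.exists_higher_integrability R₁
  obtain ⟨C₂, hC₂0, hC₂⟩ := D.exists_higher_integrability R₂
  have hΩt : volume D.Ω ≠ ∞ := D.isBounded_Ω.measure_lt_top.ne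
  have : IsFiniteMeasure (volume.restrict D.Ω) :=
    ⟨by rw [Measure.restrict_apply_univ]; exact hΩt.lt_top⟩
  -- Chosen so that `p̄ (1 + κ) ≤ p̄ + gain`; the integrands are then bounded in `L^(1+κ)` by higher
  -- integrability.
  set κ := D.gain / D.pmax with hκ
  have hg := D.gain_pos
  have hpm := D.pmax_pos
  have hκ0 : 0 < κ := by positivity
  have hκ1 : κ ≤ 1 := (div_le_one hpm).2 (by linarith [D.gain_lt_one, D.one_lt_pmax])
  refine tendsto_integral_of_rpow_bound (κ := κ) (B := 4 * (2 * (volume D.Ω).toReal + C₁ + C₂)) hκ0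
    (fun j => (hf j).aestronglyMeasurable) (ae_restrict_of_ae hfg) fun j => ?_
  have hpt : ∀ x, ENNReal.ofReal (|f j x| ^ (1 + κ)) ≤ ENNReal.ofReal 4 * (ENNReal.ofReal 2 +
      ENNReal.ofReal (|u j x| ^ (D.pbar x + D.gain)) +
      ENNReal.ofReal (|v j x| ^ (D.pbar x + D.gain))) := by
    intro x
    rw [← ENNReal.ofReal_add (by norm_num) (by positivity),
      ← ENNReal.ofReal_add (by positivity) (by positivity), ← ENNReal.ofReal_mul (by norm_num)]
    refine ENNReal.ofReal_le_ofReal ?_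
    have hp1 := D.one_lt_pbar x
    have hp2 := D.pbar_le_pmax x
    have key : ∀ y : ℝ, (|y| ^ D.pbar x) ^ (1 + κ) ≤ 1 + |y| ^ (D.pbar x + D.gain) := by
      intro y
      rw [← Real.rpow_mul (abs_nonneg _)]
      refine rpow_le_one_add (abs_nonneg y) (by positivity) ?_
      have : D.pbar x * κ ≤ D.gain := by
        rw [hκ, mul_div_assoc', div_le_iff₀ hpm, mul_comm]
        gcongr
      linarith
    have h1 := key (u j x)
    have h2 := key (v j x)
    set a := |u j x| ^ D.pbar x with ha
    set b := |v j x| ^ D.pbar x with hb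
    have ha0 : 0 ≤ a := by positivity
    have hb0 : 0 ≤ b := by positivity
    have h3 : |f j x| ^ (1 + κ) ≤ (2 * max a b) ^ (1 + κ) := by
      refine Real.rpow_le_rpow (abs_nonneg _) ((hle j x).trans ?_) (by positivity)
      linarith [le_max_left a b, le_max_right a b]
    have h4 : (2 * max a b) ^ (1 + κ) ≤ 4 * (a ^ (1 + κ) + b ^ (1 + κ)) := by
      rw [Real.mul_rpow (by norm_num) (by positivity)]
      have h5 : (2 : ℝ) ^ (1 + κ) ≤ 4 := by
        have : (2 : ℝ) ^ (1 + κ) ≤ 2 ^ (2 : ℝ) :=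
          Real.rpow_le_rpow_of_exponent_le (by norm_num) (by linarith)
        norm_num at this ⊢
        exact this
      have h6 : (max a b) ^ (1 + κ) ≤ a ^ (1 + κ) + b ^ (1 + κ) := by
        rcases max_choice a b with h | h <;> rw [h]
        · have : 0 ≤ b ^ (1 + κ) := by positivity
          linarith
        · have : 0 ≤ a ^ (1 + κ) := by positivity
          linarith
      gcongr
    linarith
  calc ∫⁻ x in D.Ω, ENNReal.ofReal (|f j x| ^ (1 + κ))
      ≤ ∫⁻ x in D.Ω, ENNReal.ofReal 4 * (ENNReal.ofReal 2 + ENNReal.ofReal (|u j x| ^ (D.pbar x + D.gain)) +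
          ENNReal.ofReal (|v j x| ^ (D.pbar x + D.gain))) := lintegral_mono hpt
    _ = ENNReal.ofReal 4 * (ENNReal.ofReal 2 * volume D.Ω +
          (∫⁻ x in D.Ω, ENNReal.ofReal (|u j x| ^ (D.pbar x + D.gain))) +
          ∫⁻ x in D.Ω, ENNReal.ofReal (|v j x| ^ (D.pbar x + D.gain))) := by
        have hm := D.X_measurable (u j)
        have hp : Measurable D.pbar := D.measurable_pbar
        rw [lintegral_const_mul' _ _ ENNReal.ofReal_ne_top, lintegral_add_left (by fun_prop),
          lintegral_add_left measurable_const, setLIntegral_const]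
    _ ≤ ENNReal.ofReal 4 * (ENNReal.ofReal 2 * volume D.Ω + ENNReal.ofReal C₁ + ENNReal.ofReal C₂) := by
        gcongr
        · exact hC₁ _ (hR₁ j)
        · exact hC₂ _ (hR₂ j)
    _ = _ := by
        rw [← ENNReal.ofReal_toReal hΩt, ← ENNReal.ofReal_mul (by norm_num),
          ← ENNReal.ofReal_add (by positivity) hC₁0, ← ENNReal.ofReal_add (by positivity) hC₂0,
          ← ENNReal.ofReal_mul (by norm_num), ENNReal.toReal_ofReal (by positivity)]

end Data

/-! ### Scalar inequalities for powers -/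

section Scalar

lemma abs_rpow_sub_two_mul {q : ℝ} (hq : 1 < q) (a : ℝ) : |(|a| ^ (q - 2) * a)| = |a| ^ (q - 1) := by
  rw [abs_mul, abs_of_nonneg (Real.rpow_nonneg (abs_nonneg a) _)]
  rcases eq_or_ne a 0 with rfl | ha
  · rw [abs_zero, mul_zero, Real.zero_rpow (by linarith)]
  · have h : 0 < |a| := abs_pos.2 ha
    have := Real.rpow_add h (q - 2) 1
    rw [Real.rpow_one] at this
    rw [← this]
    congr 1
    ring

lemma rpow_sub_two_mul_mul_self {q : ℝ} (hq : 1 < q) (a : ℝ) : |a| ^ (q - 2) * a * a = |a| ^ q := by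
  rcases eq_or_ne a 0 with rfl | ha
  · rw [mul_zero, abs_zero, Real.zero_rpow (by linarith)]
  · have h : 0 < |a| := abs_pos.2 ha
    have := Real.rpow_add h (q - 2) 2
    rw [mul_assoc, ← pow_two, ← sq_abs, ← Real.rpow_two, ← this]
    congr 1
    ring

lemma continuous_rpow_sub_two_mul {q : ℝ} (hq : 1 < q) :
    Continuous fun a : ℝ => |a| ^ (q - 2) * a := by
  rw [continuous_iff_continuousAt]
  intro a
  rcases eq_or_ne a 0 with rfl | ha
  · rw [ContinuousAt, mul_zero, tendsto_zero_iff_abs_tendsto_zero]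
    have h : Tendsto (fun a : ℝ => |a| ^ (q - 1)) (𝓝 0) (𝓝 (|0| ^ (q - 1))) :=
      (continuous_abs.tendsto 0).rpow_const (Or.inr (by linarith))
    rw [abs_zero, Real.zero_rpow (by linarith)] at h
    refine h.congr fun a => ?_
    exact (abs_rpow_sub_two_mul hq a).symm
  · exact (continuous_abs.continuousAt.rpow_const (Or.inl (abs_pos.2 ha).ne')).mul continuousAt_id

lemma rpow_sub_one_mul_le {q : ℝ} (hq : 1 < q) {a b : ℝ} (ha : 0 ≤ a) (hb : 0 ≤ b) :
    a ^ (q - 1) * b ≤ a ^ q + b ^ q := by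
  have key : ∀ c : ℝ, 0 ≤ c → c ^ (q - 1) * c = c ^ q := by
    intro c hc
    rcases eq_or_lt_of_le hc with rfl | h
    · rw [mul_zero, Real.zero_rpow (by linarith)]
    · rw [← Real.rpow_add_one h.ne']
      congr 1
      ring
  have ha' : 0 ≤ a ^ q := by positivity
  have hb' : 0 ≤ b ^ q := by positivity
  rcases le_total b a with h | h
  · have : a ^ (q - 1) * b ≤ a ^ (q - 1) * a := by gcongr
    rw [key a ha] at this
    linarith
  · have : a ^ (q - 1) * b ≤ b ^ (q - 1) * b := by
      gcongr
    rw [key b hb] at this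
    linarith

lemma abs_rpow_sub_two_mul_mul_le {q : ℝ} (hq : 1 < q) (a b : ℝ) :
    |(|a| ^ (q - 2) * a * b)| ≤ |a| ^ q + |b| ^ q := by
  rw [abs_mul, abs_rpow_sub_two_mul hq]
  exact rpow_sub_one_mul_le hq (abs_nonneg _) (abs_nonneg _)

/-- The tangent inequality for `|·|^q / q`. -/
lemma rpow_tangent_le {q : ℝ} (hq : 1 < q) (a b : ℝ) :
    |a| ^ (q - 2) * a * b - |a| ^ q ≤ |b| ^ q / q - |a| ^ q / q := by
  have hc := (Real.HolderConjugate.conjExponent hq)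
  have h1 := Real.young_inequality_of_nonneg (a := |b|) (b := |a| ^ (q - 1)) (abs_nonneg _)
    (by positivity) hc
  have h2 : (|a| ^ (q - 1)) ^ q.conjExponent = |a| ^ q := by
    rw [← Real.rpow_mul (abs_nonneg _)]
    congr 1
    unfold Real.conjExponent
    have : q - 1 ≠ 0 := by linarith
    field_simp
  have h3 : |a| ^ q / q.conjExponent = |a| ^ q - |a| ^ q / q := by
    unfold Real.conjExponent
    have : q - 1 ≠ 0 := by linarith
    field_simp
  rw [h2, h3] at h1
  have h4 : |a| ^ (q - 2) * a * b ≤ |b| * |a| ^ (q - 1) := by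
    refine (le_abs_self _).trans ?_
    rw [abs_mul, abs_rpow_sub_two_mul hq, mul_comm]
  linarith

/-- If `|a| ≠ |b|`, strict convexity on the half-line applies; if `|a| = |b|`, then `b = -a ≠ 0` and
the midpoint is zero. -/
lemma abs_midpoint_rpow_lt {q : ℝ} (hq : 1 < q) {a b : ℝ} (hab : a ≠ b) :
    |1 / 2 * (a + b)| ^ q < (|a| ^ q + |b| ^ q) / 2 := by
  have h1 : |1 / 2 * (a + b)| ≤ 1 / 2 * |a| + 1 / 2 * |b| := by
    rw [abs_mul, abs_of_pos (by norm_num : (0 : ℝ) < 1 / 2), ← mul_add]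
    gcongr
    exact abs_add_le _ _
  by_cases h : |a| = |b|
  · have hne : b = -a := by
      rcases abs_eq_abs.1 h with h | h
      · exact absurd h hab
      · linarith
    have ha : a ≠ 0 := by
      rintro rfl
      exact hab (by rw [hne, neg_zero])
    have hpos : 0 < |a| ^ q := by
      have := abs_pos.2 ha
      positivity
    have h0 : |1 / 2 * (a + b)| ^ q = 0 := by
      rw [hne, add_neg_cancel, mul_zero, abs_zero, Real.zero_rpow (by linarith)]
    rw [h0, ← h]
    linarith
  · have h2 := (strictConvexOn_rpow hq).2 (abs_nonneg a : |a| ∈ Ici (0 : ℝ))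
      (abs_nonneg b : |b| ∈ Ici (0 : ℝ)) h (by norm_num : (0 : ℝ) < 1 / 2)
      (by norm_num : (0 : ℝ) < 1 / 2) (by norm_num)
    simp only [smul_eq_mul] at h2
    have h3 := Real.rpow_le_rpow (abs_nonneg _) h1 (by linarith : 0 ≤ q)
    linarith

end Scalar

/-! ### Strict convexity of the modular and norm convergence -/

namespace Data

variable {N : ℕ} (D : Data N)

lemma integrable_density (u : D.X) : Integrable (gagliardoDensity D.s D.p u) := by
  refine ⟨(D.measurable_density (D.X_measurable u)).aestronglyMeasurable, ?_⟩
  rw [hasFiniteIntegral_iff_ofReal (Eventually.of_forall fun z => D.density_nonneg _ _)]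
  exact D.X_modular_lt_top u

lemma rho_eq_integral (u : D.X) : D.rho u = ∫ z, gagliardoDensity D.s D.p u z := by
  rw [integral_eq_lintegral_of_nonneg_ae (Eventually.of_forall fun z => D.density_nonneg _ _)
    (D.measurable_density (D.X_measurable u)).aestronglyMeasurable]
  rfl

lemma rho_congr_integral {u : D.X} {f : Eu N → ℝ} (h : (u : Eu N → ℝ) =ᵐ[volume] f) :
    D.rho u = ∫ z, gagliardoDensity D.s D.p f z := by
  rw [rho_eq_integral]
  refine integral_congr_ae ?_
  have h1 : ∀ᵐ z : Eu N × Eu N, u z.1 = f z.1 := Measure.quasiMeasurePreserving_fst.ae h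
  have h2 : ∀ᵐ z : Eu N × Eu N, u z.2 = f z.2 := Measure.quasiMeasurePreserving_snd.ae h
  filter_upwards [h1, h2] with z hz1 hz2
  simp only [gagliardoDensity, hz1, hz2]

/-- Strict convexity of the Gagliardo modular. -/
lemma rho_midpoint_lt {u v : D.X} (hne : u ≠ v) (hu : D.rho u ≤ 1) (hv : D.rho v ≤ 1) :
    D.rho ((1 / 2 : ℝ) • (u + v)) < 1 := by
  have hae : (((1 / 2 : ℝ) • (u + v) : D.X) : Eu N → ℝ) =ᵐ[volume]
      fun x => 1 / 2 * (u x + v x) := by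
    filter_upwards [D.X_smul (1 / 2) (u + v), D.X_add u v] with x h1 h2
    rw [h1, h2]
  have hlt : ∀ z : Eu N × Eu N, u z.1 - u z.2 ≠ v z.1 - v z.2 →
      gagliardoDensity D.s D.p (fun x => 1 / 2 * (u x + v x)) z <
        (gagliardoDensity D.s D.p u z + gagliardoDensity D.s D.p v z) / 2 := by
    intro z hz
    have hzz : z.1 ≠ z.2 := by
      intro h
      apply hz
      rw [h, sub_self, sub_self]
    have hn : 0 < ‖z.1 - z.2‖ := norm_pos_iff.2 (sub_ne_zero.2 hzz)
    have hp := D.p_pos z.1 z.2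
    have h1 := abs_midpoint_rpow_lt (D.one_lt_p z.1 z.2) hz
    unfold gagliardoDensity
    have e : 1 / 2 * (u z.1 + v z.1) - 1 / 2 * (u z.2 + v z.2)
        = 1 / 2 * (u z.1 - u z.2 + (v z.1 - v z.2)) := by ring
    rw [e, ← add_div, div_right_comm]
    exact div_lt_div_of_pos_right h1 (by positivity)
  have hle : ∀ z : Eu N × Eu N, gagliardoDensity D.s D.p (fun x => 1 / 2 * (u x + v x)) z ≤
        (gagliardoDensity D.s D.p u z + gagliardoDensity D.s D.p v z) / 2 := by
    intro z
    by_cases hz : u z.1 - u z.2 = v z.1 - v z.2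
    · have e : 1 / 2 * (u z.1 + v z.1) - 1 / 2 * (u z.2 + v z.2) = u z.1 - u z.2 := by linarith
      simp only [gagliardoDensity, e, ← hz]
      linarith
    · exact (hlt z hz).le
  have hint : Integrable (fun z => (gagliardoDensity D.s D.p u z + gagliardoDensity D.s D.p v z) / 2) :=
    ((D.integrable_density u).add (D.integrable_density v)).div_const 2
  have hmid : Integrable (gagliardoDensity D.s D.p (fun x => 1 / 2 * (u x + v x))) := by
    have hm : Measurable fun x => 1 / 2 * (u x + v x) :=
      ((D.X_measurable u).add (D.X_measurable v)).const_mul _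
    refine hint.mono' (D.measurable_density hm).aestronglyMeasurable
      (Eventually.of_forall fun z => ?_)
    rw [Real.norm_of_nonneg (D.density_nonneg _ _)]
    exact hle z
  have hsum : ∫ z, (gagliardoDensity D.s D.p u z + gagliardoDensity D.s D.p v z) / 2
      = (D.rho u + D.rho v) / 2 := by
    rw [integral_div, integral_add (D.integrable_density u) (D.integrable_density v),
      rho_eq_integral, rho_eq_integral]
  rw [D.rho_congr_integral hae]
  by_contra hcon
  rw [not_lt] at hcon
  have hzero : ∫ z, ((gagliardoDensity D.s D.p u z + gagliardoDensity D.s D.p v z) / 2 -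
      gagliardoDensity D.s D.p (fun x => 1 / 2 * (u x + v x)) z) = 0 := by
    refine le_antisymm ?_ (integral_nonneg fun z => sub_nonneg.2 (hle z))
    rw [integral_sub hint hmid, hsum]
    linarith
  rw [integral_eq_zero_iff_of_nonneg (fun z => sub_nonneg.2 (hle z)) (hint.sub hmid)] at hzero
  -- Equality of the integrals forces `u x - u y = v x - v y` almost everywhere, so `u - v` has no
  -- modular at all.
  have hsub : D.rho (u - v) = 0 := by
    rw [D.rho_congr_integral (D.X_sub u v), ← integral_zero (Eu N × Eu N) ℝ (μ := volume)]
    refine integral_congr_ae ?_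
    filter_upwards [hzero] with z hz
    have hz' : u z.1 - u z.2 = v z.1 - v z.2 := by
      by_contra hne
      have := hlt z hne
      rw [Pi.zero_apply] at hz
      linarith
    have e : u z.1 - v z.1 - (u z.2 - v z.2) = 0 := by linarith
    simp only [gagliardoDensity, e]
    rw [abs_zero, Real.zero_rpow (D.p_pos _ _).ne', zero_div]
  exact D.rho_ne_zero (sub_ne_zero.2 hne) hsub

/-- A.e. convergence together with convergence of the modulars implies norm convergence. -/
theorem TendstoBdd.tendsto {D : Data N} {u : ℕ → D.X} {w : D.X} (h : D.TendstoBdd u w)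
    (hr : Tendsto (fun j => D.rho (u j)) atTop (𝓝 (D.rho w))) : Tendsto u atTop (𝓝 w) := by
  rw [← tendsto_sub_nhds_zero_iff]
  refine D.tendsto_of_rho_tendsto ?_
  have e : ∀ j, D.rho (u j - w) = ∫ z, gagliardoDensity D.s D.p (fun x => u j x - w x) z :=
    fun j => D.rho_congr_integral (D.X_sub (u j) w)
  simp only [e]
  simp only [rho_eq_integral] at hr
  have hm : ∀ j, Measurable fun x => u j x - w x := fun j =>
    (D.X_measurable (u j)).sub (D.X_measurable w)
  -- The constant comes from `|a - b|^p ≤ 2^p (|a|^p + |b|^p)`.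
  refine tendsto_integral_zero_of_dominated (C := 2 ^ D.pmax) (by positivity)
    (fun j => D.integrable_density (u j)) (D.integrable_density w) (fun j z => D.density_nonneg _ z)
    (fun z => D.density_nonneg _ z) (D.tendsto_density h.ae) hr
    (fun j => (D.measurable_density (hm j)).aestronglyMeasurable)
    (fun j => Eventually.of_forall fun z => D.density_nonneg _ z)
    (fun j => Eventually.of_forall fun z => ?_) ?_
  · have hp := D.p_pos z.1 z.2
    have hpm := D.p_le_pmax z.1 z.2
    unfold gagliardoDensity
    rw [← add_div, mul_div_assoc']
    refine div_le_div_of_nonneg_right ?_ (by positivity)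
    set a := u j z.1 - u j z.2
    set b := w z.1 - w z.2
    have e : u j z.1 - w z.1 - (u j z.2 - w z.2) = a - b := by ring
    rw [e]
    calc |a - b| ^ D.p z.1 z.2 ≤ (2 * max |a| |b|) ^ D.p z.1 z.2 := by
          refine Real.rpow_le_rpow (abs_nonneg _) ((abs_sub _ _).trans ?_) hp.le
          linarith [le_max_left |a| |b|, le_max_right |a| |b|]
      _ = 2 ^ D.p z.1 z.2 * (max |a| |b|) ^ D.p z.1 z.2 :=
          Real.mul_rpow (by norm_num) (by positivity)
      _ ≤ 2 ^ D.pmax * (|a| ^ D.p z.1 z.2 + |b| ^ D.p z.1 z.2) := by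
          have h1 : (max |a| |b|) ^ D.p z.1 z.2 ≤ |a| ^ D.p z.1 z.2 + |b| ^ D.p z.1 z.2 := by
            have ha : 0 ≤ |a| ^ D.p z.1 z.2 := by positivity
            have hb : 0 ≤ |b| ^ D.p z.1 z.2 := by positivity
            rcases max_choice |a| |b| with h | h <;> rw [h] <;> linarith
          gcongr
          norm_num
  · have h0 := D.tendsto_density (u := fun j x => u j x - w x) (w := fun _ => 0) (by
      filter_upwards [h.ae] with x hx
      simpa using hx.sub_const (w x))
    filter_upwards [h0] with z hz
    have e : gagliardoDensity D.s D.p (fun _ => 0) z = 0 := by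
      simp only [gagliardoDensity]
      rw [sub_self, abs_zero, Real.zero_rpow (D.p_pos _ _).ne', zero_div]
    rwa [e] at hz

/-! ### The pairing, its maximizer on the unit ball, and the map `T` -/

/-- The pairing `∫_Ω |u|^{p̄-2} u v`. -/
noncomputable def pair (u v : D.X) : ℝ := ∫ x in D.Ω, |u x| ^ (D.pbar x - 2) * u x * v x

lemma measurable_pair (u v : D.X) : Measurable fun x => |u x| ^ (D.pbar x - 2) * u x * v x := by
  have h1 := D.X_measurable u
  have h2 := D.X_measurable v
  have h3 := D.measurable_pbar
  fun_prop

lemma integrable_pair (u v : D.X) : Integrable fun x => |u x| ^ (D.pbar x - 2) * u x * v x :=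
  ((D.integrable_rpow_pbar u).add (D.integrable_rpow_pbar v)).mono'
    (D.measurable_pair u v).aestronglyMeasurable
    (Eventually.of_forall fun x => abs_rpow_sub_two_mul_mul_le (D.one_lt_pbar x) _ _)

lemma pair_self (u : D.X) : D.pair u u = ∫ x in D.Ω, |u x| ^ D.pbar x := by
  unfold pair
  simp only [rpow_sub_two_mul_mul_self (D.one_lt_pbar _)]

lemma pair_self_pos {u : D.X} (hu : u ≠ 0) : 0 < D.pair u u := by
  rw [pair_self]
  exact D.integral_rpow_pbar_pos hu

lemma pair_smul_right (u v : D.X) (c : ℝ) : D.pair u (c • v) = c * D.pair u v := by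
  unfold pair
  rw [← integral_const_mul]
  refine integral_congr_ae (ae_restrict_of_ae ?_)
  filter_upwards [D.X_smul c v] with x hx
  rw [hx]
  ring

lemma pair_add_right (u v w : D.X) : D.pair u (v + w) = D.pair u v + D.pair u w := by
  unfold pair
  rw [← integral_add (D.integrable_pair u v).integrableOn (D.integrable_pair u w).integrableOn]
  refine integral_congr_ae (ae_restrict_of_ae ?_)
  filter_upwards [D.X_add v w] with x hx
  rw [hx]
  ring

lemma pair_neg_left (u v : D.X) : D.pair (-u) v = -D.pair u v := by
  unfold pair
  rw [← integral_neg]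
  refine integral_congr_ae (ae_restrict_of_ae ?_)
  filter_upwards [D.X_neg u] with x hx
  rw [hx, abs_neg]
  ring

lemma pair_neg_right (u v : D.X) : D.pair u (-v) = -D.pair u v := by
  rw [← neg_one_smul ℝ v, pair_smul_right]
  ring

lemma TendstoBdd.tendsto_pair {D : Data N} {u v : ℕ → D.X} {w z : D.X} (hu : D.TendstoBdd u w)
    (hv : D.TendstoBdd v z) : Tendsto (fun j => D.pair (u j) (v j)) atTop (𝓝 (D.pair w z)) := by
  refine hu.tendsto_integral hv (fun j => D.measurable_pair _ _)
    (fun j x => abs_rpow_sub_two_mul_mul_le (D.one_lt_pbar x) _ _) ?_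
  filter_upwards [hu.ae, hv.ae] with x h1 h2
  exact (((continuous_rpow_sub_two_mul (D.one_lt_pbar x)).tendsto _).comp h1).mul h2

lemma TendstoBdd.tendsto_sig {D : Data N} {u : ℕ → D.X} {w : D.X} (hu : D.TendstoBdd u w) :
    Tendsto (fun j => D.sig (u j)) atTop (𝓝 (D.sig w)) := by
  refine hu.tendsto_integral hu (fun j => ?_) (fun j x => ?_) ?_
  · have := D.X_measurable (u j)
    have := D.measurable_pbar
    fun_prop
  · have hp := D.one_lt_pbar x
    have h0 : 0 ≤ |u j x| ^ D.pbar x := by positivity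
    rw [abs_of_nonneg (by positivity)]
    have := div_le_self h0 hp.le
    linarith
  · filter_upwards [hu.ae] with x hx
    exact (hx.abs.rpow_const (Or.inr (D.pbar_pos x).le)).div_const _

/-- As `t` passes `k w`, the value `sig (t⁻¹ • w)` crosses one strictly, and `sig` converges for
each fixed `t`; this traps `k (u j)` on both sides. -/
lemma TendstoBdd.tendsto_k {D : Data N} {u : ℕ → D.X} {w : D.X} (hu : D.TendstoBdd u w)
    (hw : w ≠ 0) : Tendsto (fun j => D.k (u j)) atTop (𝓝 (D.k w)) := by
  obtain ⟨hk, hk1⟩ := D.k_spec hw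
  have hs : ∀ t : ℝ, Tendsto (fun j => D.sig (t⁻¹ • u j)) atTop (𝓝 (D.sig (t⁻¹ • w))) := fun t =>
    (hu.smul t⁻¹).tendsto_sig
  refine tendsto_order.2 ⟨fun a ha => ?_, fun a ha => ?_⟩
  · set t := max a (D.k w / 2) with ht
    have ht0 : 0 < t := lt_max_of_lt_right (by positivity)
    have htk : t < D.k w := max_lt ha (by linarith)
    have h1 : 1 < D.sig (t⁻¹ • w) := by
      by_contra hcon
      exact absurd ((D.k_le_iff w ht0).2 (not_lt.1 hcon)) (not_le.2 htk)
    filter_upwards [(hs t).eventually_const_lt h1] with j hj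
    refine (le_max_left a (D.k w / 2)).trans_lt (not_le.1 fun hle => ?_)
    exact absurd ((D.k_le_iff _ ht0).1 hle) (not_le.2 hj)
  · set t := (a + D.k w) / 2 with ht
    have htk : D.k w < t := by linarith
    have hta : t < a := by linarith
    have ht0 : 0 < t := hk.trans htk
    have h1 : D.sig (t⁻¹ • w) < 1 := by
      have h2 := D.sig_smul_le (u := (D.k w)⁻¹ • w) (a := D.k w / t) (by positivity)
        ((div_le_one ht0).2 htk.le)
      have e : D.k w / t * (D.k w)⁻¹ = t⁻¹ := by field_simp
      rw [smul_smul, e, hk1, mul_one] at h2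
      exact h2.trans_lt ((div_lt_one ht0).2 htk)
    filter_upwards [(hs t).eventually_lt_const h1] with j hj
    exact ((D.k_le_iff _ ht0).2 hj.le).trans_lt hta

/-- The pairing with `u` is bounded by `k` on `X`. -/
lemma pair_le_k_mul {u v : D.X} (hu : u ∈ D.M) (hv : v ≠ 0) :
    D.pair u v ≤ D.k v * D.pair u u := by
  obtain ⟨hk, hk1⟩ := D.k_spec hv
  set z := (D.k v)⁻¹ • v with hz
  -- The integrated tangent inequality. Since `sig z = sig u = 1`, its right side vanishes.
  have h1 : D.pair u z - D.pair u u ≤ D.sig z - D.sig u := by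
    rw [D.pair_self u]
    unfold pair sig
    rw [← integral_sub (D.integrable_pair u z).integrableOn (D.integrable_rpow_pbar u).integrableOn,
      ← integral_sub (D.integrable_rpow_pbar_div z).integrableOn
        (D.integrable_rpow_pbar_div u).integrableOn]
    refine integral_mono
      ((D.integrable_pair u z).integrableOn.sub (D.integrable_rpow_pbar u).integrableOn)
      ((D.integrable_rpow_pbar_div z).integrableOn.sub
        (D.integrable_rpow_pbar_div u).integrableOn) fun x => ?_
    exact rpow_tangent_le (D.one_lt_pbar x) _ _
  rw [hk1, D.sig_eq_one hu, sub_self, hz, pair_smul_right, sub_nonpos, inv_mul_le_iff₀ hk] at h1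
  exact h1

/-- `w` maximizes the pairing with `u` over the closed unit ball of `X`. -/
def IsPairMax (u w : D.X) : Prop := D.K w ≤ 1 ∧ ∀ v, D.K v ≤ 1 → D.pair u v ≤ D.pair u w

lemma bddAbove_pair (u : D.X) : BddAbove (D.pair u '' {v | D.K v ≤ 1}) := by
  obtain ⟨C, hC0, hC⟩ := D.exists_integral_rpow_pbar_le 1
  refine ⟨(∫ x in D.Ω, |u x| ^ D.pbar x) + C, ?_⟩
  rintro _ ⟨v, hv, rfl⟩
  have h1 : ∫ x in D.Ω, |v x| ^ D.pbar x ≤ C := by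
    have h2 := hC v ((D.K_le_one_iff v).1 hv)
    rw [← ofReal_integral_eq_lintegral_ofReal (D.integrable_rpow_pbar v).integrableOn
      (Eventually.of_forall fun x => by positivity)] at h2
    exact (ENNReal.ofReal_le_ofReal_iff hC0).1 h2
  refine le_trans ?_ (add_le_add_right h1 _)
  unfold pair
  rw [← integral_add (D.integrable_rpow_pbar u).integrableOn (D.integrable_rpow_pbar v).integrableOn]
  refine integral_mono (D.integrable_pair u v).integrableOn
    ((D.integrable_rpow_pbar u).integrableOn.add (D.integrable_rpow_pbar v).integrableOn) fun x => ?_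
  exact (le_abs_self _).trans (abs_rpow_sub_two_mul_mul_le (D.one_lt_pbar x) _ _)

/-- Direct method: a maximizing sequence has a subsequence in the sense of `TendstoBdd`, along which
the pairing is continuous and, by Fatou, the unit ball is closed. -/
lemma exists_isPairMax (u : D.X) : ∃ w, D.IsPairMax u w := by
  have hne : (D.pair u '' {v | D.K v ≤ 1}).Nonempty :=
    ⟨_, 0, by rw [mem_ofPred_eq, K_zero]; exact zero_le_one, rfl⟩
  have hb := D.bddAbove_pair u
  obtain ⟨a, -, ha, hmem⟩ := exists_seq_tendsto_sSup hne hb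
  choose v hv hva using hmem
  obtain ⟨φ, hφ, w, hw⟩ := D.exists_subseq_tendstoBdd (u := v) (R := 1)
    fun j => (D.K_le_one_iff _).1 (hv j)
  have hlim := (D.tendstoBdd_const u).tendsto_pair hw
  have hlim' : Tendsto (fun j => D.pair u ((v ∘ φ) j)) atTop
      (𝓝 (sSup (D.pair u '' {v | D.K v ≤ 1}))) := by
    have := ha.comp hφ.tendsto_atTop
    refine this.congr fun j => ?_
    exact (hva _).symm
  refine ⟨w, hw.K_le one_pos (Eventually.of_forall fun j => hv _), fun z hz => ?_⟩
  rw [tendsto_nhds_unique hlim hlim']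
  exact le_csSup hb ⟨z, hz, rfl⟩

variable {D}

lemma IsPairMax.pair_pos {u w : D.X} (h : D.IsPairMax u w) (hu : u ≠ 0) : 0 < D.pair u w := by
  have hK := D.K_pos hu
  have h1 := h.2 ((D.K u)⁻¹ • u) (by
    rw [K_smul, abs_of_pos (by positivity), inv_mul_cancel₀ hK.ne'])
  rw [pair_smul_right] at h1
  have := D.pair_self_pos hu
  exact lt_of_lt_of_le (by positivity) h1

lemma IsPairMax.ne_zero {u w : D.X} (h : D.IsPairMax u w) (hu : u ≠ 0) : w ≠ 0 := by
  rintro rfl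
  have h1 := h.pair_pos hu
  have h2 := D.pair_smul_right u 0 0
  rw [smul_zero, zero_mul] at h2
  linarith

lemma IsPairMax.K_eq_one {u w : D.X} (h : D.IsPairMax u w) (hu : u ≠ 0) : D.K w = 1 := by
  refine le_antisymm h.1 ?_
  have hK := D.K_pos (h.ne_zero hu)
  have h1 := h.2 ((D.K w)⁻¹ • w) (by
    rw [K_smul, abs_of_pos (by positivity), inv_mul_cancel₀ hK.ne'])
  have h2 := h.pair_pos hu
  rw [pair_smul_right, inv_mul_le_iff₀ hK] at h1
  by_contra hcon
  nlinarith

lemma IsPairMax.rho_eq_one {u w : D.X} (h : D.IsPairMax u w) (hu : u ≠ 0) : D.rho w = 1 := by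
  have := D.rho_inv_K_smul (h.ne_zero hu)
  rwa [h.K_eq_one hu, inv_one, one_smul] at this

/-- A strictly interior competitor has strictly smaller pairing. -/
lemma IsPairMax.pair_lt_of_rho_lt {u w v : D.X} (h : D.IsPairMax u w) (hu : u ≠ 0)
    (hv : D.rho v < 1) : D.pair u v < D.pair u w := by
  have hK : D.K v ≤ 1 := (D.K_le_one_iff v).2 hv.le
  -- With equality `v` would itself be a maximizer, and maximizers have modular one.
  refine lt_of_le_of_ne (h.2 v hK) fun heq => ?_
  have hmax : D.IsPairMax u v := ⟨hK, fun z hz => heq ▸ h.2 z hz⟩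
  exact hv.ne (hmax.rho_eq_one hu)

/-- The midpoint of two distinct maximizers would have modular below one and so a strictly smaller
pairing, against linearity. -/
lemma IsPairMax.unique {u w z : D.X} (h : D.IsPairMax u w) (h' : D.IsPairMax u z) (hu : u ≠ 0) :
    w = z := by
  by_contra hne
  have h1 := D.rho_midpoint_lt hne (h.rho_eq_one hu).le (h'.rho_eq_one hu).le
  have h2 := h.pair_lt_of_rho_lt hu h1
  have h3 := h'.2 w h.1
  have h4 := h.2 z h'.1
  rw [pair_smul_right, pair_add_right] at h2
  linarith

lemma IsPairMax.neg {u w : D.X} (h : D.IsPairMax u w) : D.IsPairMax (-u) (-w) := by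
  refine ⟨by rw [K_neg]; exact h.1, fun v hv => ?_⟩
  have := h.2 (-v) (by rwa [K_neg])
  rw [pair_neg_left, pair_neg_left, pair_neg_right]
  rw [pair_neg_right] at this
  linarith

variable (D)

/-- The maximizer of the pairing with `u` over the unit ball of `X`. -/
noncomputable def maxi (u : D.X) : D.X := (D.exists_isPairMax u).choose

lemma maxi_spec (u : D.X) : D.IsPairMax u (D.maxi u) := (D.exists_isPairMax u).choose_spec

lemma maxi_ne_zero {u : D.X} (hu : u ≠ 0) : D.maxi u ≠ 0 := (D.maxi_spec u).ne_zero hu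

lemma maxi_neg {u : D.X} (hu : u ≠ 0) : D.maxi (-u) = -D.maxi u :=
  (D.maxi_spec (-u)).unique (D.maxi_spec u).neg (neg_ne_zero.2 hu)

/-- The normalized maximizer. -/
noncomputable def T (u : D.X) : D.X := (D.k (D.maxi u))⁻¹ • D.maxi u

lemma T_mem_M {u : D.X} (hu : u ≠ 0) : D.T u ∈ D.M := D.inv_k_smul_mem_M (D.maxi_ne_zero hu)

lemma T_neg {u : D.X} (hu : u ≠ 0) : D.T (-u) = -D.T u := by
  unfold T
  rw [D.maxi_neg hu, D.k_neg (D.maxi_ne_zero hu), smul_neg]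

lemma K_T {u : D.X} (hu : u ≠ 0) : D.K (D.T u) = (D.k (D.maxi u))⁻¹ := by
  have := D.k_pos (D.maxi_ne_zero hu)
  rw [T, K_smul, (D.maxi_spec u).K_eq_one hu, mul_one, abs_of_pos (by positivity)]

/-- Maximality tested with `u / K(u)`, followed by `pair_le_k_mul`, gives `⟨u, u⟩ / K(u) ≤ ⟨u, maxi
u⟩ ≤ k(maxi u) ⟨u, u⟩`, and `K(T u) = 1 / k(maxi u)`. -/
lemma K_T_le {u : D.X} (hu : u ∈ D.M) : D.K (D.T u) ≤ D.K u := by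
  have hu0 := D.ne_zero_of_mem_M hu
  have hK := D.K_pos hu0
  have hk := D.k_pos (D.maxi_ne_zero hu0)
  have hp := D.pair_self_pos hu0
  have h1 := (D.maxi_spec u).2 ((D.K u)⁻¹ • u) (by
    rw [K_smul, abs_of_pos (by positivity), inv_mul_cancel₀ hK.ne'])
  have h2 := D.pair_le_k_mul hu (D.maxi_ne_zero hu0)
  rw [pair_smul_right] at h1
  have h3 := le_of_mul_le_mul_right (h1.trans h2) hp
  rw [D.K_T hu0]
  exact (inv_le_comm₀ hK hk).1 h3

/-- If `T` does not decrease `K` at `u`, then `u / K(u)` is the maximizer. -/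
lemma isPairMax_of_K_T_eq {u : D.X} (hu : u ∈ D.M) (h : D.K (D.T u) = D.K u) :
    D.IsPairMax u ((D.K u)⁻¹ • u) := by
  have hu0 := D.ne_zero_of_mem_M hu
  have hK := D.K_pos hu0
  rw [D.K_T hu0] at h
  refine ⟨by rw [K_smul, abs_of_pos (by positivity), inv_mul_cancel₀ hK.ne'], fun v hv => ?_⟩
  -- Under the equality assumption the upper bound `k(maxi u) ⟨u, u⟩` is exactly the pairing of `u`
  -- with `u / K(u)`.
  refine ((D.maxi_spec u).2 v hv).trans ((D.pair_le_k_mul hu (D.maxi_ne_zero hu0)).trans_eq ?_)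
  rw [pair_smul_right, ← h, inv_inv]

/-- The competitors form a fixed ball and the pairing is continuous in both arguments, so maximality
survives the limit; uniqueness identifies that limit. -/
lemma TendstoBdd.exists_tendsto_maxi {D : Data N} {u : ℕ → D.X} {w : D.X} (h : D.TendstoBdd u w)
    (hw : w ≠ 0) : ∃ φ : ℕ → ℕ, StrictMono φ ∧
      D.TendstoBdd (fun j => D.maxi (u (φ j))) (D.maxi w) := by
  obtain ⟨φ, hφ, z, hz⟩ := D.exists_subseq_tendstoBdd (u := fun j => D.maxi (u j)) (R := 1)
    fun j => (D.K_le_one_iff _).1 (D.maxi_spec _).1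
  have hz1 : D.K z ≤ 1 := hz.K_le one_pos (Eventually.of_forall fun j => (D.maxi_spec _).1)
  have hmax : D.IsPairMax w z := by
    refine ⟨hz1, fun v hv => ?_⟩
    have h1 := (h.comp hφ.tendsto_atTop).tendsto_pair hz
    have h2 := (h.comp hφ.tendsto_atTop).tendsto_pair (D.tendstoBdd_const v)
    exact le_of_tendsto_of_tendsto' h2 h1 fun j => (D.maxi_spec _).2 v hv
  refine ⟨φ, hφ, ?_⟩
  rw [← hmax.unique (D.maxi_spec w) hw]
  exact hz

/-- The images converge in norm although the arguments need not: all maximizers, including the limit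
one, have modular one, so no modular is lost. -/
lemma TendstoBdd.exists_tendsto_T {D : Data N} {u : ℕ → D.X} {w : D.X} (h : D.TendstoBdd u w)
    (hu : ∀ j, u j ≠ 0) (hw : w ≠ 0) : ∃ φ : ℕ → ℕ, StrictMono φ ∧
      Tendsto (fun j => D.T (u (φ j))) atTop (𝓝 (D.T w)) := by
  obtain ⟨φ, hφ, h1⟩ := h.exists_tendsto_maxi hw
  refine ⟨φ, hφ, ?_⟩
  have h2 := h1.tendsto (by
    simp only [(D.maxi_spec _).rho_eq_one (hu _), (D.maxi_spec w).rho_eq_one hw]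
    exact tendsto_const_nhds)
  exact ((h1.tendsto_k (D.maxi_ne_zero hw)).inv₀ (D.k_pos (D.maxi_ne_zero hw)).ne').smul h2

lemma continuousOn_T : ContinuousOn D.T D.M := by
  rw [continuousOn_iff_continuous_domRestrict, continuous_iff_seqContinuous]
  intro x p hx
  refine tendsto_of_subseq_tendsto fun ns hns => ?_
  have h1 : Tendsto (fun j => (x (ns j) : D.X)) atTop (𝓝 (p : D.X)) :=
    (continuous_subtype_val.tendsto p).comp (hx.comp hns)
  obtain ⟨φ, hφ, h2⟩ := D.exists_subseq_of_tendsto h1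
  obtain ⟨ψ, hψ, h3⟩ := h2.exists_tendsto_T (fun j => D.ne_zero_of_mem_M (x _).2)
    (D.ne_zero_of_mem_M p.2)
  exact ⟨φ ∘ ψ, h3⟩

/-! ### The Euler–Lagrange equation -/

/-- The integrand of the derivative of the modular. -/
noncomputable def derivDensity (w v : Eu N → ℝ) (z : Eu N × Eu N) : ℝ :=
  |w z.1 - w z.2| ^ (D.p z.1 z.2 - 2) * (w z.1 - w z.2) * (v z.1 - v z.2) /
    ‖z.1 - z.2‖ ^ ((N : ℝ) + D.s * D.p z.1 z.2)

/-- The Gateaux derivative of the modular. -/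
noncomputable def derivRho (w v : D.X) : ℝ := ∫ z, D.derivDensity w v z

lemma measurable_derivDensity {w v : Eu N → ℝ} (hw : Measurable w) (hv : Measurable v) :
    Measurable (D.derivDensity w v) := by
  have hp := D.measurable_p
  unfold derivDensity
  fun_prop

lemma abs_derivDensity_le (w v : Eu N → ℝ) (z : Eu N × Eu N) : |D.derivDensity w v z| ≤
    D.pmax * (gagliardoDensity D.s D.p w z + gagliardoDensity D.s D.p v z) := by
  have hp := D.p_pos z.1 z.2
  have hpm := D.p_le_pmax z.1 z.2
  unfold derivDensity gagliardoDensity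
  set r := ‖z.1 - z.2‖ ^ ((N : ℝ) + D.s * D.p z.1 z.2) with hr
  have hr0 : 0 ≤ r := by positivity
  rw [abs_div, abs_of_nonneg hr0, ← add_div, mul_div_assoc', mul_comm (D.p z.1 z.2) r, ← div_div,
    div_right_comm]
  refine div_le_div_of_nonneg_right ?_ hr0
  rw [le_div_iff₀ hp, mul_comm]
  have h := abs_rpow_sub_two_mul_mul_le (D.one_lt_p z.1 z.2) (w z.1 - w z.2) (v z.1 - v z.2)
  exact mul_le_mul hpm h (abs_nonneg _) D.pmax_pos.le

lemma integrable_derivDensity (w v : D.X) : Integrable (D.derivDensity w v) :=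
  (((D.integrable_density w).add (D.integrable_density v)).const_mul D.pmax).mono'
    (D.measurable_derivDensity (D.X_measurable w) (D.X_measurable v)).aestronglyMeasurable
    (Eventually.of_forall fun z => D.abs_derivDensity_le w v z)

lemma ae_prod_of_ae {q : Eu N → Prop} (h : ∀ᵐ x, q x) :
    ∀ᵐ z : Eu N × Eu N, q z.1 ∧ q z.2 :=
  (Measure.quasiMeasurePreserving_fst.ae h).and (Measure.quasiMeasurePreserving_snd.ae h)

lemma derivRho_add_right (w v v' : D.X) :
    D.derivRho w (v + v') = D.derivRho w v + D.derivRho w v' := by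
  unfold derivRho
  rw [← integral_add (D.integrable_derivDensity w v) (D.integrable_derivDensity w v')]
  refine integral_congr_ae ?_
  filter_upwards [ae_prod_of_ae (D.X_add v v')] with z hz
  simp only [derivDensity, hz.1, hz.2]
  ring

lemma derivRho_smul_right (w v : D.X) (c : ℝ) : D.derivRho w (c • v) = c * D.derivRho w v := by
  unfold derivRho
  rw [← integral_const_mul]
  refine integral_congr_ae ?_
  filter_upwards [ae_prod_of_ae (D.X_smul c v)] with z hz
  simp only [derivDensity, hz.1, hz.2]
  ring

lemma hasDerivAt_rho (w v : D.X) :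
    HasDerivAt (fun t : ℝ => D.rho (w + t • v)) (D.derivRho w v) 0 := by
  have e : (fun t : ℝ => D.rho (w + t • v)) =
      fun t : ℝ => ∫ z, gagliardoDensity D.s D.p (fun x => w x + t * v x) z := by
    funext t
    refine D.rho_congr_integral ?_
    filter_upwards [D.X_add w (t • v), D.X_smul t v] with x h1 h2
    rw [h1, h2]
  rw [e]
  have hwm := D.X_measurable w
  have hvm := D.X_measurable v
  have hm : ∀ t : ℝ, Measurable fun x => w x + t * v x := fun t => hwm.add (hvm.const_mul t)
  -- For `|t| < 1` one has `|a + t b| ≤ 2 max(|a|, |b|)`, whence a dominating function independent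
  -- of `t`.
  have h := (hasDerivAt_integral_of_dominated_loc_of_deriv_le (μ := (volume : Measure (Eu N × Eu N)))
    (F := fun (t : ℝ) z => gagliardoDensity D.s D.p (fun x => w x + t * v x) z)
    (F' := fun (t : ℝ) z => D.derivDensity (fun x => w x + t * v x) v z) (x₀ := 0)
    (s := Metric.ball 0 1)
    (bound := fun z => D.pmax * (2 ^ D.pmax * (gagliardoDensity D.s D.p w z +
      gagliardoDensity D.s D.p v z) + gagliardoDensity D.s D.p v z))
    (Metric.ball_mem_nhds 0 one_pos)
    (Eventually.of_forall fun t => (D.measurable_density (hm t)).aestronglyMeasurable)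
    (by simpa using D.integrable_density w)
    (D.measurable_derivDensity (hm 0) hvm).aestronglyMeasurable
    (Eventually.of_forall fun z t ht => ?_)
    (((((D.integrable_density w).add (D.integrable_density v)).const_mul _).add
      (D.integrable_density v)).const_mul _)
    (Eventually.of_forall fun z t _ => ?_)).2
  · simpa [derivRho] using h
  · rw [Real.norm_eq_abs]
    refine (D.abs_derivDensity_le _ _ z).trans ?_
    refine mul_le_mul_of_nonneg_left (add_le_add_left ?_ _) D.pmax_pos.le
    have hp := D.p_pos z.1 z.2
    have hpm := D.p_le_pmax z.1 z.2
    have ht1 : |t| ≤ 1 := by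
      rw [mem_ball_zero_iff, Real.norm_eq_abs] at ht
      exact ht.le
    unfold gagliardoDensity
    rw [← add_div, mul_div_assoc']
    refine div_le_div_of_nonneg_right ?_ (by positivity)
    set a := w z.1 - w z.2
    set b := v z.1 - v z.2
    have e : w z.1 + t * v z.1 - (w z.2 + t * v z.2) = a + t * b := by ring
    rw [e]
    calc |a + t * b| ^ D.p z.1 z.2 ≤ (2 * max |a| |b|) ^ D.p z.1 z.2 := by
          refine Real.rpow_le_rpow (abs_nonneg _) ((abs_add_le _ _).trans ?_) hp.le
          rw [abs_mul]
          have : |t| * |b| ≤ |b| := mul_le_of_le_one_left (abs_nonneg _) ht1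
          linarith [le_max_left |a| |b|, le_max_right |a| |b|]
      _ = 2 ^ D.p z.1 z.2 * (max |a| |b|) ^ D.p z.1 z.2 :=
          Real.mul_rpow (by norm_num) (by positivity)
      _ ≤ 2 ^ D.pmax * (|a| ^ D.p z.1 z.2 + |b| ^ D.p z.1 z.2) := by
          have h1 : (max |a| |b|) ^ D.p z.1 z.2 ≤ |a| ^ D.p z.1 z.2 + |b| ^ D.p z.1 z.2 := by
            have ha : 0 ≤ |a| ^ D.p z.1 z.2 := by positivity
            have hb : 0 ≤ |b| ^ D.p z.1 z.2 := by positivity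
            rcases max_choice |a| |b| with h | h <;> rw [h] <;> linarith
          gcongr
          norm_num
  · have hp := D.p_pos z.1 z.2
    unfold gagliardoDensity derivDensity
    have h1 : HasDerivAt (fun t : ℝ => w z.1 + t * v z.1 - (w z.2 + t * v z.2)) (v z.1 - v z.2) t := by
      exact ((hasDerivAt_mul_const (v z.1)).const_add (w z.1)).fun_sub
        ((hasDerivAt_mul_const (v z.2)).const_add (w z.2))
    have h2 := ((hasDerivAt_abs_rpow _ (D.one_lt_p z.1 z.2)).comp t h1).div_const
      (D.p z.1 z.2 * ‖z.1 - z.2‖ ^ ((N : ℝ) + D.s * D.p z.1 z.2))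
    refine h2.congr_deriv ?_
    rw [mul_assoc (D.p z.1 z.2), mul_assoc (D.p z.1 z.2), mul_div_mul_left _ _ hp.ne']

/-- Otherwise a small step along `v` would enter `rho < 1` with the pairing unchanged, contrary to
`pair_lt_of_rho_lt`. -/
lemma IsPairMax.derivRho_nonneg {D : Data N} {u w v : D.X} (h : D.IsPairMax u w) (hu : u ≠ 0)
    (hv : D.pair u v = 0) : 0 ≤ D.derivRho w v := by
  by_contra hneg
  rw [not_le] at hneg
  have h1 := (D.hasDerivAt_rho w v).tendsto_slope
  have h2 : ∀ᶠ t in 𝓝[>] (0 : ℝ), slope (fun t : ℝ => D.rho (w + t • v)) 0 t < 0 :=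
    (h1.mono_left (nhdsWithin_mono _ fun t ht => (ne_of_gt ht))).eventually_lt_const hneg
  obtain ⟨t, ht, ht0⟩ := (h2.and self_mem_nhdsWithin).exists
  have ht0 : 0 < t := ht0
  rw [slope_def_field, zero_smul, add_zero, h.rho_eq_one hu, sub_zero, div_neg_iff] at ht
  have h3 : D.rho (w + t • v) < 1 := by
    rcases ht with ht | ht
    · linarith [ht.2]
    · linarith [ht.1]
  have h4 := h.pair_lt_of_rho_lt hu h3
  rw [pair_add_right, pair_smul_right, hv, mul_zero, add_zero] at h4
  exact lt_irrefl _ h4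

/-- The Lagrange multiplier rule for the maximizer. -/
lemma IsPairMax.derivRho_eq {D : Data N} {u w : D.X} (h : D.IsPairMax u w) (hu : u ≠ 0)
    (v : D.X) : D.derivRho w v = D.pair u v / D.pair u w * D.derivRho w w := by
  set c := D.pair u v / D.pair u w with hc
  have hpos := h.pair_pos hu
  -- Projecting `v` along `w` into the kernel of the pairing gives a direction admissible with both
  -- signs, so the derivative vanishes on it.
  have hz : D.pair u (v + (-c) • w) = 0 := by
    rw [pair_add_right, pair_smul_right, hc]
    field_simp
    ring
  have h1 := h.derivRho_nonneg hu hz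
  have h2 := h.derivRho_nonneg hu (v := (-1 : ℝ) • (v + (-c) • w)) (by
    rw [pair_smul_right, hz, mul_zero])
  rw [derivRho_smul_right] at h2
  rw [derivRho_add_right, derivRho_smul_right] at h1 h2
  linarith

/-- A function `u ∈ M` such that `u / K(u)` maximizes the pairing with `u` is an eigenfunction. -/
theorem isEigenpair_of_isPairMax {u : D.X} (hu : u ∈ D.M) (h : D.IsPairMax u ((D.K u)⁻¹ • u)) :
    D.IsEigenpair (D.K u) u := by
  have hu0 := D.ne_zero_of_mem_M hu
  have hk : D.k u = 1 := hu
  have hK := D.K_pos hu0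
  set w := (D.K u)⁻¹ • u with hw
  have hnab : ∀ᵐ z : Eu N × Eu N, D.nablaS u z / D.K u = (w z.1 - w z.2) / ‖z.1 - z.2‖ ^ D.s := by
    filter_upwards [ae_prod_of_ae (D.X_smul (D.K u)⁻¹ u)] with z hz
    rw [hz.1, hz.2, nablaS]
    field_simp
  have hden : ∀ z : Eu N × Eu N, z.1 ≠ z.2 → ‖z.1 - z.2‖ ^ ((N : ℝ) + D.s * D.p z.1 z.2)
      = (‖z.1 - z.2‖ ^ D.s) ^ D.p z.1 z.2 * ‖z.1 - z.2‖ ^ N := by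
    intro z hz
    have hn : 0 < ‖z.1 - z.2‖ := norm_pos_iff.2 (sub_ne_zero.2 hz)
    rw [Real.rpow_add hn, Real.rpow_natCast, Real.rpow_mul hn.le, mul_comm]
  have hL : ∀ φ : D.X, ∫ z : Eu N × Eu N, |D.nablaS u z / D.K u| ^ (D.p z.1 z.2 - 2) *
      (D.nablaS u z / D.K u) * D.nablaS φ z / ‖z.1 - z.2‖ ^ N = D.derivRho w φ := by
    intro φ
    refine integral_congr_ae ?_
    filter_upwards [hnab] with z hz
    rw [hz]
    -- On the diagonal both integrands are zero; off it the base `‖z.1 - z.2‖` is positive and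
    -- powers can be split.
    by_cases hzz : z.1 = z.2
    · simp [derivDensity, nablaS, hzz]
    · have hn : 0 < ‖z.1 - z.2‖ := norm_pos_iff.2 (sub_ne_zero.2 hzz)
      rw [derivDensity, hden z hzz, nablaS]
      set r := ‖z.1 - z.2‖ ^ D.s with hr
      have hr0 : 0 < r := by positivity
      rw [abs_div, abs_of_pos hr0, Real.div_rpow (abs_nonneg _) hr0.le, Real.rpow_sub hr0,
        Real.rpow_two]
      field_simp
  have hN : ∫ z : Eu N × Eu N, |D.nablaS u z / D.K u| ^ D.p z.1 z.2 / ‖z.1 - z.2‖ ^ N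
      = D.derivRho w w := by
    refine integral_congr_ae ?_
    filter_upwards [hnab] with z hz
    rw [hz, derivDensity, rpow_sub_two_mul_mul_self (D.one_lt_p _ _)]
    by_cases hzz : z.1 = z.2
    · simp [hzz, Real.zero_rpow (D.p_pos z.2 z.2).ne']
    · rw [hden z hzz]
      have hn : 0 < ‖z.1 - z.2‖ := norm_pos_iff.2 (sub_ne_zero.2 hzz)
      have hr0 : 0 < ‖z.1 - z.2‖ ^ D.s := by positivity
      rw [abs_div, abs_of_pos hr0, Real.div_rpow (abs_nonneg _) hr0.le, div_div]
  have hS : D.S u = D.derivRho w w / D.pair u u := by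
    unfold S
    rw [hN, hk, pair_self]
    simp only [div_one]
  refine ⟨hu0, fun φ => ?_⟩
  have hp : ∫ x in D.Ω, |u x / D.k u| ^ (D.pbar x - 2) * (u x / D.k u) * φ x = D.pair u φ := by
    unfold pair
    rw [hk]
    simp only [div_one]
  -- As `⟨u, w⟩ = ⟨u, u⟩ / K(u)`, the multiplier equals `K(u) S(u)`.
  rw [hL, hp, hS, h.derivRho_eq hu0, hw, pair_smul_right]
  have := D.pair_self_pos hu0
  field_simp

/-! ### Lipschitz functions supported in `Ω` belong to `X` -/

/-- A radial integrable majorant for the Gagliardo kernel of a bounded Lipschitz function. -/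
noncomputable def majorant (t : ℝ) : ℝ :=
  if t ≤ 1 then t ^ ((1 - D.s) - N) else t ^ (-N - D.s)

lemma measurable_majorant : Measurable D.majorant :=
  Measurable.ite measurableSet_Iic (by fun_prop) (by fun_prop)

lemma majorant_nonneg {t : ℝ} (ht : 0 ≤ t) : 0 ≤ D.majorant t := by
  unfold majorant
  split_ifs <;> positivity

/-- In polar coordinates the factor `t^(N-1)` leaves `t^(-s)` near zero and `t^(-1-s)` at infinity,
both integrable as `0 < s < 1`. -/
lemma integrable_majorant_norm : Integrable (fun z : Eu N => D.majorant ‖z‖) := by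
  have := D.nontrivial_Eu
  rw [integrable_fun_norm_addHaar volume (f := D.majorant), finrank_euclideanSpace_fin]
  have hN : ((N - 1 : ℕ) : ℝ) = N - 1 := by
    rw [Nat.cast_sub D.N_pos, Nat.cast_one]
  rw [← Ioc_union_Ioi_eq_Ioi zero_le_one]
  refine IntegrableOn.union ?_ ?_
  · have h : IntegrableOn (fun t : ℝ => t ^ (-D.s)) (Ioc 0 1) :=
      (intervalIntegrable_iff_integrableOn_Ioc_of_le zero_le_one).1
        (intervalIntegral.intervalIntegrable_rpow' (by linarith [D.s_lt_one]))
    refine h.congr_fun (fun t ht => ?_) measurableSet_Ioc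
    simp only [majorant, if_pos ht.2, smul_eq_mul]
    rw [← Real.rpow_natCast, hN, ← Real.rpow_add ht.1]
    congr 1
    ring
  · have h : IntegrableOn (fun t : ℝ => t ^ (-1 - D.s)) (Ioi 1) :=
      integrableOn_Ioi_rpow_of_lt (by linarith [D.s_pos]) one_pos
    refine h.congr_fun (fun t ht => ?_) measurableSet_Ioi
    simp only [majorant, if_neg (not_le.2 (mem_Ioi.1 ht)), smul_eq_mul]
    rw [← Real.rpow_natCast, hN, ← Real.rpow_add (one_pos.trans ht)]
    congr 1
    ring

/-- For `t ≤ 1` the Lipschitz bound leaves `t^((1-s)p - N)`; for `t > 1` boundedness leaves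
`t^(-N-sp)`. In both cases `p > 1` finishes. -/
lemma density_le_majorant {f : Eu N → ℝ} {z : Eu N × Eu N} (h1 : |f z.1 - f z.2| ≤ 1)
    (hf : |f z.1 - f z.2| ≤ ‖z.1 - z.2‖) :
    gagliardoDensity D.s D.p f z ≤ D.majorant ‖z.1 - z.2‖ := by
  have hp := D.one_lt_p z.1 z.2
  have hp0 := D.p_pos z.1 z.2
  have hs := D.s_pos
  have hs1 := D.s_lt_one
  set t := ‖z.1 - z.2‖ with ht
  rcases (norm_nonneg (z.1 - z.2)).eq_or_lt with h0 | h0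
  · rw [← ht] at h0
    rw [← h0] at hf
    have : |f z.1 - f z.2| = 0 := le_antisymm hf (abs_nonneg _)
    unfold gagliardoDensity
    rw [this, Real.zero_rpow hp0.ne', zero_div]
    exact D.majorant_nonneg (norm_nonneg _)
  rw [← ht] at h0
  have key : gagliardoDensity D.s D.p f z
      ≤ |f z.1 - f z.2| ^ D.p z.1 z.2 / t ^ ((N : ℝ) + D.s * D.p z.1 z.2) := by
    unfold gagliardoDensity
    refine div_le_div_of_nonneg_left (by positivity) (by positivity) ?_
    exact le_mul_of_one_le_left (by positivity) hp.le
  refine key.trans ?_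
  unfold majorant
  split_ifs with ht1
  · calc _ ≤ t ^ D.p z.1 z.2 / t ^ ((N : ℝ) + D.s * D.p z.1 z.2) := by gcongr
      _ = t ^ (D.p z.1 z.2 - (N + D.s * D.p z.1 z.2)) := (Real.rpow_sub h0 _ _).symm
      _ ≤ _ := Real.rpow_le_rpow_of_exponent_ge h0 ht1 (by nlinarith)
  · rw [not_le] at ht1
    calc _ ≤ 1 / t ^ ((N : ℝ) + D.s * D.p z.1 z.2) := by
          gcongr
          exact Real.rpow_le_one (abs_nonneg _) h1 hp0.le
      _ = t ^ (-((N : ℝ) + D.s * D.p z.1 z.2)) := by rw [Real.rpow_neg h0.le, one_div]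
      _ ≤ _ := Real.rpow_le_rpow_of_exponent_le ht1.le (by nlinarith)

/-- The density vanishes unless one of the two points lies in `Ω`; Tonelli then bounds the modular
by twice the volume of `Ω` times the integral of the majorant. -/
lemma modular_lt_top_of_lipschitz {f : Eu N → ℝ} (h1 : ∀ x y, |f x - f y| ≤ 1)
    (hf : ∀ x y, |f x - f y| ≤ ‖x - y‖) (h0 : ∀ x, x ∉ D.Ω → f x = 0) :
    gagliardoModular D.s D.p f < ∞ := by
  have hΩ : MeasurableSet D.Ω := D.isOpen_Ω.measurableSet
  set H : Eu N → ℝ≥0∞ := fun z => ENNReal.ofReal (D.majorant ‖z‖) with hH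
  have hHm : Measurable H := (D.measurable_majorant.comp measurable_norm).ennreal_ofReal
  have hHi : ∫⁻ z, H z < ∞ := D.integrable_majorant_norm.lintegral_lt_top
  have hfin : volume D.Ω * ∫⁻ z, H z < ∞ :=
    ENNReal.mul_lt_top D.isBounded_Ω.measure_lt_top hHi
  have hm1 : Measurable fun z : Eu N × Eu N => D.Ω.indicator 1 z.1 * H (z.1 - z.2) :=
    ((measurable_one.indicator hΩ).comp measurable_fst).mul
      (hHm.comp (measurable_fst.sub measurable_snd))
  have hm2 : Measurable fun z : Eu N × Eu N => D.Ω.indicator 1 z.2 * H (z.1 - z.2) :=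
    ((measurable_one.indicator hΩ).comp measurable_snd).mul
      (hHm.comp (measurable_fst.sub measurable_snd))
  calc gagliardoModular D.s D.p f
      ≤ ∫⁻ z : Eu N × Eu N, (D.Ω.indicator 1 z.1 * H (z.1 - z.2)
          + D.Ω.indicator 1 z.2 * H (z.1 - z.2)) := by
        refine lintegral_mono fun z => ?_
        have hd : ENNReal.ofReal (gagliardoDensity D.s D.p f z) ≤ H (z.1 - z.2) :=
          ENNReal.ofReal_le_ofReal (D.density_le_majorant (h1 _ _) (hf _ _))
        by_cases hz1 : z.1 ∈ D.Ω
        · refine le_add_right ?_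
          simpa [hz1] using hd
        by_cases hz2 : z.2 ∈ D.Ω
        · refine le_add_left ?_
          simpa [hz2] using hd
        have : gagliardoDensity D.s D.p f z = 0 := by
          unfold gagliardoDensity
          rw [h0 _ hz1, h0 _ hz2, sub_zero, abs_zero, Real.zero_rpow (D.p_pos _ _).ne', zero_div]
        simp [this]
    _ = volume D.Ω * (∫⁻ z, H z) + volume D.Ω * ∫⁻ z, H z := by
        rw [lintegral_add_left hm1]
        congr 1
        · rw [Measure.volume_eq_prod, lintegral_prod _ hm1.aemeasurable]
          simp only
          have : ∀ x : Eu N, ∫⁻ y, D.Ω.indicator 1 x * H (x - y)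
              = D.Ω.indicator 1 x * ∫⁻ z, H z := fun x => by
            rw [lintegral_const_mul _ (f := fun y => H (x - y)) (by fun_prop),
              lintegral_sub_left_eq_self]
          simp only [this]
          rw [lintegral_mul_const _ (measurable_one.indicator hΩ), lintegral_indicator_one hΩ]
        · rw [Measure.volume_eq_prod, lintegral_prod_symm _ hm2.aemeasurable]
          simp only
          have : ∀ y : Eu N, ∫⁻ x, D.Ω.indicator 1 y * H (x - y)
              = D.Ω.indicator 1 y * ∫⁻ z, H z := fun y => by
            rw [lintegral_const_mul _ (f := fun x => H (x - y)) (by fun_prop),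
              lintegral_sub_right_eq_self]
          simp only [this]
          rw [lintegral_mul_const _ (measurable_one.indicator hΩ), lintegral_indicator_one hΩ]
    _ < ∞ := ENNReal.add_lt_top.2 ⟨hfin, hfin⟩

lemma pbarModular_lt_top_of_bounded {f : Eu N → ℝ} (h1 : ∀ x, |f x| ≤ 1)
    (h0 : ∀ x, x ∉ D.Ω → f x = 0) : D.pbarModular f < ∞ := by
  have hΩ : MeasurableSet D.Ω := D.isOpen_Ω.measurableSet
  calc D.pbarModular f ≤ ∫⁻ x, D.Ω.indicator 1 x := by
        refine lintegral_mono fun x => ?_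
        by_cases hx : x ∈ D.Ω
        · simpa [hx] using Real.rpow_le_one (abs_nonneg _) (h1 x) (D.pbar_pos x).le
        · simp [h0 x hx, Real.zero_rpow (D.pbar_pos x).ne']
    _ = volume D.Ω := lintegral_indicator_one hΩ
    _ < ∞ := D.isBounded_Ω.measure_lt_top

/-- The tent function of height and radius `r` centred at `x`. -/
noncomputable def tent (x : Eu N) (r : ℝ) (y : Eu N) : ℝ := max 0 (r - ‖y - x‖)

lemma continuous_tent (x : Eu N) (r : ℝ) : Continuous (tent x r) := by
  unfold tent
  fun_prop

lemma tent_self (x : Eu N) {r : ℝ} (hr : 0 ≤ r) : tent x r x = r := by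
  simp [tent, hr]

lemma tent_eq_zero {x y : Eu N} {r : ℝ} (h : y ∉ Metric.ball x r) : tent x r y = 0 := by
  rw [Metric.mem_ball, not_lt, dist_eq_norm] at h
  exact max_eq_left (by linarith)

lemma tent_mem_Icc (x : Eu N) {r : ℝ} (hr1 : r ≤ 1) (y : Eu N) :
    tent x r y ∈ Icc (0 : ℝ) 1 :=
  ⟨le_max_left _ _, max_le zero_le_one (by linarith [norm_nonneg (y - x)])⟩

lemma abs_tent_sub_le (x : Eu N) (r : ℝ) (y z : Eu N) : |tent x r y - tent x r z| ≤ ‖y - z‖ := by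
  refine (abs_max_sub_max_le_max _ _ _ _).trans ?_
  rw [sub_self, abs_zero, max_eq_right (abs_nonneg _)]
  have e : r - ‖y - x‖ - (r - ‖z - x‖) = ‖z - x‖ - ‖y - x‖ := by ring
  have e2 : y - z = -(z - x - (y - x)) := by abel
  rw [e, e2, norm_neg]
  exact abs_norm_sub_norm_le _ _

lemma exists_X_ae_eq_tent {x : Eu N} {r : ℝ} (hr1 : r ≤ 1)
    (h : Metric.ball x r ⊆ D.Ω) : ∃ u : D.X, (u : Eu N → ℝ) =ᵐ[volume] tent x r := by
  have h0 : ∀ y, y ∉ D.Ω → tent x r y = 0 := fun y hy => tent_eq_zero fun h1 => hy (h h1)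
  have h1 := tent_mem_Icc x hr1
  refine ⟨D.mkX (tent x r) (continuous_tent x r).measurable
    (D.pbarModular_lt_top_of_bounded (fun y => ?_) h0)
    (D.modular_lt_top_of_lipschitz (fun y z => ?_) (abs_tent_sub_le x r) h0)
    (Eventually.of_forall h0), D.mkX_coe _ _ _ _ _⟩
  · rw [abs_of_nonneg (h1 y).1]
    exact (h1 y).2
  · rw [abs_le]
    constructor <;> linarith [(h1 y).1, (h1 y).2, (h1 z).1, (h1 z).2]

lemma X_sum {ι : Type*} (s : Finset ι) (u : ι → D.X) :
    ((∑ i ∈ s, u i : D.X) : Eu N → ℝ) =ᵐ[volume] fun x => ∑ i ∈ s, u i x := by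
  classical
  induction s using Finset.induction_on with
  | empty => simpa using D.X_zero
  | insert a s ha ih =>
    rw [Finset.sum_insert ha]
    filter_upwards [D.X_add (u a) (∑ i ∈ s, u i), ih] with x h1 h2
    rw [h1, h2, Finset.sum_insert ha]

/-- `X` is infinite dimensional. -/
lemma exists_linearIndependent (n : ℕ) : ∃ e : Fin n → D.X, LinearIndependent ℝ e := by
  have := D.nontrivial_Eu
  have hinf : D.Ω.Infinite := by
    obtain ⟨x, hx⟩ := D.nonempty_Ω
    exact infinite_of_mem_nhds x (D.isOpen_Ω.mem_nhds hx)
  obtain ⟨t, htΩ, htc⟩ := hinf.exists_subset_card_eq n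
  set x : Fin n → Eu N := fun i => (t.equivFinOfCardEq htc).symm i with hx
  have hxinj : Function.Injective x :=
    Subtype.val_injective.comp (t.equivFinOfCardEq htc).symm.injective
  have hxΩ : ∀ i, x i ∈ D.Ω := fun i => htΩ ((t.equivFinOfCardEq htc).symm i).2
  have hev : ∀ᶠ r in 𝓝[>] (0 : ℝ), r ≤ 1 ∧ (∀ i, Metric.ball (x i) r ⊆ D.Ω) ∧
      ∀ i j, i ≠ j → r ≤ dist (x j) (x i) := by
    refine (Filter.Eventually.filter_mono nhdsWithin_le_nhds (eventually_le_nhds one_pos)).and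
      ((eventually_all.2 fun i => ?_).and (eventually_all.2 fun i => eventually_all.2 fun j => ?_))
    · obtain ⟨ε, hε, hb⟩ := Metric.isOpen_iff.1 D.isOpen_Ω _ (hxΩ i)
      filter_upwards [nhdsWithin_le_nhds (eventually_le_nhds hε)] with r hr
      exact (Metric.ball_subset_ball hr).trans hb
    · by_cases hij : i = j
      · exact Eventually.of_forall fun r h => absurd hij h
      · filter_upwards [nhdsWithin_le_nhds (eventually_le_nhds
          (dist_pos.2 fun h => hij (hxinj h).symm))] with r hr _ using hr
  obtain ⟨r, ⟨hr1, hball, hdist⟩, hr⟩ := (hev.and self_mem_nhdsWithin).exists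
  have hr : 0 < r := hr
  choose e he using fun i => D.exists_X_ae_eq_tent hr1 (hball i)
  refine ⟨e, Fintype.linearIndependent_iff.2 fun c hc j => ?_⟩
  have h1 : (fun y => ∑ i, c i * tent (x i) r y) =ᵐ[volume] fun _ => 0 := by
    have h2 := D.X_sum Finset.univ fun i => c i • e i
    rw [hc] at h2
    filter_upwards [h2, D.X_zero, ae_all_iff.2 he, ae_all_iff.2 fun i => D.X_smul (c i) (e i)]
      with y h2 h3 h4 h5
    rw [h3] at h2
    simp only [h5, h4] at h2
    exact h2.symm
  -- Continuity upgrades the a.e. identity to every point, and at the centre `x j` only the `j`-th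
  -- tent is nonzero.
  have h2 := congrFun (Continuous.ae_eq_iff_eq volume
    (continuous_finsetSum _ fun i _ => continuous_const.mul (continuous_tent (x i) r))
    continuous_const |>.1 h1) (x j)
  change ∑ i, c i * tent (x i) r (x j) = 0 at h2
  rw [Finset.sum_eq_single j (fun i _ hij => by
    rw [tent_eq_zero (by simpa using hdist i j hij), mul_zero]) (by simp),
    tent_self _ hr.le] at h2
  exact (mul_eq_zero.1 h2).resolve_right hr.ne'

end Data

/-! ### The genus -/

section Genus

variable {V W : Type*} [TopologicalSpace V] [Neg V] [TopologicalSpace W] [Neg W]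

lemma genus_le {A : Set V} {m : ℕ} (g : V → EuclideanSpace ℝ (Fin m)) (hg : ContinuousOn g A)
    (hodd : ∀ u ∈ A, g (-u) = -g u) (h0 : ∀ u ∈ A, g u ≠ 0) : genus A ≤ m :=
  iInf₂_le m ⟨g, hg, hodd, h0⟩

lemma genus_le_of_mapsTo {A : Set V} {B : Set W} (f : V → W) (hf : ContinuousOn f A)
    (hodd : ∀ u ∈ A, f (-u) = -f u) (hAB : MapsTo f A B) : genus A ≤ genus B := by
  refine le_iInf₂ fun m ⟨g, hg, hgodd, hg0⟩ => genus_le (g ∘ f) (hg.comp hf hAB)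
    (fun u hu => ?_) fun u hu => hg0 _ (hAB hu)
  rw [Function.comp_apply, hodd u hu, hgodd _ (hAB hu), Function.comp_apply]

lemma nonempty_of_one_le_genus {A : Set V} (h : 1 ≤ genus A) : A.Nonempty := by
  rw [nonempty_iff_ne_empty]
  rintro rfl
  have h1 : genus (∅ : Set V) ≤ (0 : ℕ) :=
    genus_le (fun _ => 0) (continuousOn_empty _) (by simp) (by simp)
  have h2 := h.trans h1
  norm_num at h2

lemma le_genus_sphere (n : ℕ) : ((n + 1 : ℕ) : ℕ∞)
    ≤ genus (Metric.sphere (0 : EuclideanSpace ℝ (Fin (n + 1))) 1) := by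
  refine le_iInf₂ fun m ⟨g, hg, hgodd, hg0⟩ => ?_
  rw [Nat.cast_le]
  by_contra! hm
  -- An odd map into `ℝ^m` with `m ≤ n` is padded with zero coordinates to one into `ℝ^n`.
  obtain ⟨x, hx, hx0⟩ := borsuk_ulam
    (fun x (i : Fin n) => if h : (i : ℕ) < m then g x ⟨i, h⟩ else 0)
    (continuousOn_pi.2 fun i => by
      split_ifs with h
      · exact (continuous_apply _).comp_continuousOn
          ((PiLp.continuous_ofLp 2 _).comp_continuousOn hg)
      · exact continuousOn_const)
    (fun x hx => by
      funext i
      rw [hgodd x hx]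
      by_cases h : (i : ℕ) < m <;> simp [h])
  refine hg0 x hx ?_
  ext i
  have h := congrFun hx0 ⟨i, by omega⟩
  simpa using h

end Genus

namespace Data

variable {N : ℕ} (D : Data N)

lemma continuousOn_k : ContinuousOn D.k {0}ᶜ := by
  rw [continuousOn_iff_continuous_domRestrict, continuous_iff_seqContinuous]
  intro x p hx
  refine tendsto_of_subseq_tendsto fun ns hns => ?_
  have h1 : Tendsto (fun j => (x (ns j) : D.X)) atTop (𝓝 (p : D.X)) :=
    (continuous_subtype_val.tendsto p).comp (hx.comp hns)
  obtain ⟨φ, hφ, h2⟩ := D.exists_subseq_of_tendsto h1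
  exact ⟨φ, h2.tendsto_k p.2⟩

/-! ### The minimax classes -/

lemma minimaxClass_anti {m n : ℕ} (h : m ≤ n) : D.minimaxClass n ⊆ D.minimaxClass m :=
  fun _ ⟨h1, h2, h3, h4⟩ => ⟨h1, h2, h3, (Nat.cast_le.2 h).trans h4⟩

lemma Lam_mono : Monotone D.Lam := fun _ _ h => biInf_mono (D.minimaxClass_anti h)

/-- The competitor is a Euclidean sphere mapped linearly and injectively into `X` and then scaled
radially onto `M`; the scaling is odd and continuous away from zero. -/
lemma minimaxClass_nonempty (n : ℕ) : (D.minimaxClass (n + 1)).Nonempty := by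
  obtain ⟨e, he⟩ := D.exists_linearIndependent (n + 1)
  set v : EuclideanSpace ℝ (Fin (n + 1)) → D.X := fun x => ∑ i, x i • e i with hv
  have hvc : Continuous v := continuous_finsetSum _ fun i _ =>
    (EuclideanSpace.proj i : EuclideanSpace ℝ (Fin (n + 1)) →L[ℝ] ℝ).continuous.smul
      continuous_const
  have hvneg : ∀ x, v (-x) = -v x := fun x => by
    simp only [hv, PiLp.neg_apply, neg_smul, Finset.sum_neg_distrib]
  have hv0 : ∀ x ∈ Metric.sphere (0 : EuclideanSpace ℝ (Fin (n + 1))) 1, v x ≠ 0 := by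
    intro x hx h0
    have : x = 0 := by
      ext i
      exact Fintype.linearIndependent_iff.1 he _ h0 i
    rw [this] at hx
    simp at hx
  set θ : EuclideanSpace ℝ (Fin (n + 1)) → D.X := fun x => (D.k (v x))⁻¹ • v x with hθ
  have hθc : ContinuousOn θ (Metric.sphere 0 1) :=
    ((D.continuousOn_k.comp hvc.continuousOn hv0).inv₀ fun x hx =>
      (D.k_pos (hv0 x hx)).ne').smul hvc.continuousOn
  have hθneg : ∀ x ∈ Metric.sphere (0 : EuclideanSpace ℝ (Fin (n + 1))) 1, θ (-x) = -θ x := by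
    intro x hx
    simp only [hθ, hvneg, D.k_neg (hv0 x hx), smul_neg]
  refine ⟨θ '' Metric.sphere 0 1, ?_, (isCompact_sphere 0 1).image_of_continuousOn hθc, ?_, ?_⟩
  · rintro _ ⟨x, hx, rfl⟩
    exact D.inv_k_smul_mem_M (hv0 x hx)
  · rintro _ ⟨x, hx, rfl⟩
    exact ⟨-x, by simpa using hx, hθneg x hx⟩
  · exact (le_genus_sphere n).trans (genus_le_of_mapsTo θ hθc hθneg (mapsTo_image _ _))

lemma T_image_mem_minimaxClass {n : ℕ} {A : Set D.X} (hA : A ∈ D.minimaxClass n) :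
    D.T '' A ∈ D.minimaxClass n := by
  obtain ⟨hM, hc, hs, hg⟩ := hA
  have hT := D.continuousOn_T.mono hM
  have hneg : ∀ u ∈ A, D.T (-u) = -D.T u := fun u hu => D.T_neg (D.ne_zero_of_mem_M (hM hu))
  refine ⟨?_, hc.image_of_continuousOn hT, ?_,
    hg.trans (genus_le_of_mapsTo D.T hT hneg (mapsTo_image _ _))⟩
  · rintro _ ⟨u, hu, rfl⟩
    exact D.T_mem_M (D.ne_zero_of_mem_M (hM hu))
  · rintro _ ⟨u, hu, rfl⟩
    exact ⟨-u, hs u hu, hneg u hu⟩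

/-- Positive genus excludes the empty set, whose supremum is `⊥` and which is admissible for `n =
0`; compactness of one competitor bounds the value above. -/
lemma exists_Lam_eq {n : ℕ} (hn : 1 ≤ n) : ∃ L : ℝ, D.Lam n = L := by
  obtain ⟨m, rfl⟩ := Nat.exists_eq_add_of_le' hn
  have h0 : (0 : EReal) ≤ D.Lam (m + 1) := by
    refine le_iInf₂ fun A hA => ?_
    obtain ⟨u, hu⟩ := nonempty_of_one_le_genus (le_trans (by simp) hA.2.2.2)
    exact le_trans (EReal.coe_nonneg.2 (D.K_nonneg u)) (le_iSup₂_of_le u hu le_rfl)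
  have h1 : D.Lam (m + 1) < ⊤ := by
    obtain ⟨A, hA⟩ := D.minimaxClass_nonempty m
    obtain ⟨R, hR⟩ := hA.2.1.isBounded.exists_norm_le
    refine (iInf₂_le A hA).trans_lt (lt_of_le_of_lt (iSup₂_le fun u hu => ?_) (EReal.coe_lt_top R))
    exact EReal.coe_le_coe_iff.2 (hR u hu)
  exact ⟨_, (EReal.coe_toReal h1.ne (ne_bot_of_le_ne_bot EReal.zero_ne_bot h0)).symm⟩

/-- Take a nearly optimal `A`. Its image under `T` competes too, so some `u ∈ A` has `K (T u)`
nearly at least `L`, while `K u` is nearly at most `L`. -/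
lemma exists_almost_fixed {n : ℕ} {L : ℝ} (hL : D.Lam n = L) {ε : ℝ} (hε : 0 < ε) :
    ∃ u ∈ D.M, D.K u < L + ε ∧ L - ε < D.K (D.T u) := by
  have h1 : D.Lam n < ((L + ε : ℝ) : EReal) := by
    rw [hL, EReal.coe_lt_coe_iff]
    linarith
  unfold Lam at h1
  simp only [iInf_lt_iff] at h1
  obtain ⟨A, hA, h1⟩ := h1
  have h2 : ((L - ε : ℝ) : EReal) < ⨆ u ∈ D.T '' A, (D.K u : EReal) := by
    refine lt_of_lt_of_le ?_ (biInf_le (fun B : Set D.X => ⨆ u ∈ B, (D.K u : EReal))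
      (D.T_image_mem_minimaxClass hA))
    change _ < D.Lam n
    rw [hL, EReal.coe_lt_coe_iff]
    linarith
  simp only [lt_iSup_iff] at h2
  obtain ⟨_, ⟨u, hu, rfl⟩, h2⟩ := h2
  refine ⟨u, hA.1 hu, EReal.coe_lt_coe_iff.1 (lt_of_le_of_lt ?_ h1), EReal.coe_lt_coe_iff.1 h2⟩
  exact le_iSup₂_of_le u hu le_rfl

/-- Every finite minimax value is an eigenvalue. -/
theorem exists_isEigenpair {n : ℕ} {L : ℝ} (hL : D.Lam n = L) :
    ∃ u ∈ D.M, D.IsEigenpair L u := by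
  choose u huM huK huT using fun j : ℕ =>
    D.exists_almost_fixed hL (Nat.one_div_pos_of_nat (α := ℝ) (n := j))
  have hε : Tendsto (fun j : ℕ => 1 / ((j : ℝ) + 1)) atTop (𝓝 0) :=
    tendsto_one_div_add_atTop_nhds_zero_nat
  have hK1 : ∀ j, D.K (u j) ≤ max (L + 1) 1 := fun j => by
    refine (huK j).le.trans (le_max_of_le_left ?_)
    have : 1 / ((j : ℝ) + 1) ≤ 1 := by
      rw [div_le_one (by positivity)]
      linarith [(Nat.cast_nonneg j : (0 : ℝ) ≤ j)]
    linarith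
  obtain ⟨φ, hφ, w, hw⟩ := D.exists_subseq_tendstoBdd
    fun j => D.rho_le_of_K_le (le_max_right _ _) (hK1 j)
  have hwM : w ∈ D.M := by
    refine D.mem_M_of_sig_eq_one (tendsto_nhds_unique hw.tendsto_sig ?_)
    simp only [Function.comp_apply, D.sig_eq_one (huM _)]
    exact tendsto_const_nhds
  have hw0 := D.ne_zero_of_mem_M hwM
  have hL0 : 0 ≤ L := by
    refine le_of_tendsto_of_tendsto' (tendsto_const_nhds (x := (0 : ℝ)))
      (by simpa using hε.const_add L) fun j => (D.K_nonneg (u j)).trans (huK j).le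
  -- Under a.e. convergence `K` is only lower semicontinuous. The reverse inequality comes through
  -- `T`, whose values converge in norm.
  have hKw : D.K w ≤ L := by
    refine le_of_forall_pos_le_add fun ε hε0 => hw.K_le (by positivity) ?_
    filter_upwards [(hε.comp hφ.tendsto_atTop).eventually_le_const hε0] with j hj
    exact (huK _).le.trans (add_le_add_right hj L)
  obtain ⟨ψ, hψ, hT⟩ := hw.exists_tendsto_T (fun j => D.ne_zero_of_mem_M (huM _)) hw0
  have hTw : L ≤ D.K (D.T w) := by
    have h1 : Tendsto (fun j => L - 1 / ((φ (ψ j) : ℝ) + 1)) atTop (𝓝 L) := by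
      simpa using (hε.comp (hφ.tendsto_atTop.comp hψ.tendsto_atTop)).const_sub L
    exact le_of_tendsto_of_tendsto' h1 hT.norm fun j => (huT _).le
  have hTK := D.K_T_le hwM
  have hKL : D.K w = L := le_antisymm hKw (hTw.trans hTK)
  refine ⟨w, hwM, ?_⟩
  rw [← hKL]
  exact D.isEigenpair_of_isPairMax hwM
    (D.isPairMax_of_K_T_eq hwM (le_antisymm hTK (hKL.le.trans hTw)))

/-! ### Divergence of the minimax values -/

/-- Otherwise a sequence in `M` with bounded `K` would converge a.e. to zero, although `sig = 1`
passes to the limit. -/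
lemma exists_le_norm_J (R : ℝ) : ∃ δ : ℝ, 0 < δ ∧ ∀ u ∈ D.M, D.K u ≤ R → δ ≤ ‖D.J u‖ := by
  by_contra! h
  choose u huM huK huJ using fun j : ℕ => h (1 / ((j : ℝ) + 1)) Nat.one_div_pos_of_nat
  obtain ⟨φ, hφ, w, hw⟩ := D.exists_subseq_tendstoBdd
    fun j => D.rho_le_of_K_le (le_max_right R 1) ((huK j).trans (le_max_left _ _))
  have hJ : Tendsto (fun j => D.J (u (φ j))) atTop (𝓝 (D.J 0)) := by
    rw [map_zero]
    exact (squeeze_zero_norm (fun j => (huJ j).le) tendsto_one_div_add_atTop_nhds_zero_nat).comp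
      hφ.tendsto_atTop
  obtain ⟨ψ, hψ, hae⟩ := (tendstoInMeasure_of_tendsto_Lp hJ).exists_seq_tendsto_ae
  have hw0 : w = 0 := by
    refine D.X_ext ?_
    filter_upwards [hae, hw.ae, ae_all_iff.2 fun j => D.J_coe (u j), D.J_coe 0] with x h1 h2 h3 h4
    simp only [h3, h4] at h1
    exact tendsto_nhds_unique (h2.comp hψ.tendsto_atTop) h1
  have h1 : Tendsto (fun j => D.sig (u (φ j))) atTop (𝓝 (D.sig w)) := hw.tendsto_sig
  simp only [D.sig_eq_one (huM _)] at h1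
  rw [hw0, sig_zero] at h1
  exact one_ne_zero (tendsto_nhds_unique tendsto_const_nhds h1)

lemma exists_genus_le (R : ℝ) :
    ∃ m : ℕ, ∀ A ⊆ D.M, (∀ u ∈ A, D.K u ≤ R) → genus A ≤ m := by
  obtain ⟨δ, hδ, hJ⟩ := D.exists_le_norm_J R
  obtain ⟨t, ht, hcov⟩ := Metric.totallyBounded_iff.1
    (D.totallyBounded_J_image ((max R 1) ^ D.pmax)) δ hδ
  have : Fintype t := ht.fintype
  set y : Fin (Fintype.card t) → Lp ℝ 1 (volume : Measure (Eu N)) :=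
    fun i => (Fintype.equivFin t).symm i with hy
  have hJc := D.continuous_J
  -- Each coordinate is a bump around `y i` minus its mirror image around `-y i`. If `J u` is within
  -- `δ` of the centre `c`, then `‖J u‖ ≥ δ` forces `‖J u + c‖ > δ`: the mirrored bump vanishes and
  -- the coordinate is positive.
  refine ⟨Fintype.card t, fun A hAM hAK => genus_le
    (fun u => WithLp.toLp 2 fun i => max 0 (δ - ‖D.J u - y i‖) - max 0 (δ - ‖D.J u + y i‖))
    ?_ (fun u _ => ?_) fun u hu h0 => ?_⟩
  · refine ((PiLp.continuous_toLp 2 _).comp (continuous_pi fun i => ?_)).continuousOn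
    fun_prop
  · ext i
    have h1 : ‖D.J (-u) - y i‖ = ‖D.J u + y i‖ := by
      rw [map_neg, ← norm_neg]
      congr 1
      abel
    have h2 : ‖D.J (-u) + y i‖ = ‖D.J u - y i‖ := by
      rw [map_neg, ← norm_neg]
      congr 1
      abel
    simp only [h1, h2, PiLp.neg_apply, neg_sub]
  · have hmem : D.J u ∈ D.J '' {v | D.rho v ≤ (max R 1) ^ D.pmax} :=
      ⟨u, D.rho_le_of_K_le (le_max_right _ _) ((hAK u hu).trans (le_max_left _ _)), rfl⟩
    obtain ⟨c, hc, hball⟩ := mem_iUnion₂.1 (hcov hmem)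
    rw [Metric.mem_ball, dist_eq_norm] at hball
    have h1 := congrArg (fun x => x (Fintype.equivFin t ⟨c, hc⟩)) h0
    simp only [hy, Equiv.symm_apply_apply, PiLp.zero_apply] at h1
    have h2 : 2 * ‖D.J u‖ ≤ ‖D.J u - c‖ + ‖D.J u + c‖ := by
      have h3 := norm_add_le (D.J u - c) (D.J u + c)
      have e : D.J u - c + (D.J u + c) = (2 : ℝ) • D.J u := by
        rw [two_smul]
        abel
      rwa [e, norm_smul, Real.norm_ofNat] at h3
    have h3 := hJ u (hAM hu) (hAK u hu)
    rw [max_eq_left (b := δ - ‖D.J u + c‖) (by linarith),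
      max_eq_right (b := δ - ‖D.J u - c‖) (by linarith)] at h1
    linarith

lemma tendsto_Lam : Tendsto D.Lam atTop (𝓝 ⊤) := by
  rw [EReal.tendsto_nhds_top_iff_real]
  intro R
  obtain ⟨m, hm⟩ := D.exists_genus_le (R + 1)
  filter_upwards [eventually_gt_atTop m] with n hn
  refine lt_of_lt_of_le (EReal.coe_lt_coe_iff.2 (lt_add_one R)) (le_iInf₂ fun A hA => ?_)
  by_contra! hlt
  have h1 := hA.2.2.2.trans (hm A hA.1 fun u hu =>
    EReal.coe_le_coe_iff.1 ((le_iSup₂_of_le u hu le_rfl).trans hlt.le))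
  exact absurd (Nat.cast_le.1 h1) (not_le.2 hn)

end Data

end FracEigen

theorem mainTheorem11 (N : ℕ) (D : FracEigen.Data N) :
    (∀ m n : ℕ, 1 ≤ m → m ≤ n → D.Lam m ≤ D.Lam n) ∧
    Filter.Tendsto D.Lam Filter.atTop (nhds (⊤ : EReal)) ∧
    ∀ n : ℕ, 1 ≤ n → ∃ L : ℝ, D.Lam n = (L : EReal) ∧ ∃ u ∈ D.M, D.IsEigenpair L u := by
  refine ⟨fun m n _ h => D.Lam_mono h, D.tendsto_Lam, fun n hn => ?_⟩
  obtain ⟨L, hL⟩ := D.exists_Lam_eq hn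
  exact ⟨L, hL, D.exists_isEigenpair hL⟩
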